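/- Fix an integer $s\ge 2$. For $\mathbf{x}\in\{0,1\}^n$ let $\mathscr B_{1,s}(\mathbf{x})\subseteq\{0,1\}^{n-1}$ be the set of sequences that can be obtained from $\mathbf{x}$ by one deletion and at most $s$ substitutions. For a positive integer $k$, let $m$ be the smallest positive integer such that there is a binary narrow-sense primitive BCH code of length $2^m-1$, designed distance $2s+1$ and dimension $k'\ge k$; choose such a code (that is, a primitive element $\alpha$ of $\mathbb F_{2^m}$), let $h_{\mathrm{BCH}}:\{0,1\}^{k'}\to\{0,1\}^{2^m-1}$ be its encoding function that is systematic on the first $k'$ coordinates, put $n_0=2^m-1-(k'-k)$, and let $h:\{0,1\}^k\to\{0,1\}^{n_0}$ be given by $h(\mathbf{x})=(\mathbf{x},\mathbf{p})$, where $(\mathbf{0},\mathbf{x},\mathbf{p})=h_{\mathrm{BCH}}(\mathbf{0},\mathbf{x})$ and $\mathbf 0$ is the zero vector of length $k'-k$. Then there is a number $n_1=n_1(n_0)$, depending only on $s$ and $n_0$, with $n_1=2(s+2)\log_2 n_0+o(\log_2 n_0)$ as $n_0\to\infty$, such that for every $k\ge 1$ and every such $h$ there is a function $g:\{0,1\}^{n_0}\to\{0,1\}^{n_1}$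 for which, for every $\mathbf{x}\in\{0,1\}^k$, $h(\mathbf{x})$ can be recovered from $g(h(\mathbf{x}))$ and any $\mathbf{y}\in\mathscr B_{1,s}(h(\mathbf{x}))$. Moreover, $g(h(\mathbf{x}))$ can be computed from $h(\mathbf{x})$ in time $O(n_0^{s+3})$, and $h(\mathbf{x})$ can be computed from $g(h(\mathbf{x}))$ and $\mathbf{y}$ in time $O(n_0^{s+2})$. Here time is the number of steps of a random access machine with words of $O(\log n_0)$ bits; each of the two computations is done by one program that depends only on $s$ and that also receives $n_0$, $k$, $m$ and the minimal polynomial of $\alpha$ over $\mathbb F_2$; and the implied constants depend only on $s$. -/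

import Mathlib

/-- Binary words of length `n`. -/
abbrev BinWord (n : ℕ) : Type := Fin n → ZMod 2

/-- The sequences obtained from `x` by `t` deletions and at most `s` substitutions: `y` differs in
at most `s` places from a subsequence of `x` of length `n - t`. -/
def delSubBall (t s : ℕ) {n : ℕ} (x : BinWord n) : Set (BinWord (n - t)) :=
  {y | ∃ e : Fin (n - t) ↪o Fin n, hammingDist y (x ∘ e) ≤ s}

/-- The binary narrow-sense primitive BCH code of length `2 ^ m - 1` and designed distance
`2 * s + 1` (for `α` a primitive element of the field with `2 ^ m` elements): the words `c` whose
polynomial `∑ i, c i X ^ i` vanishes at `α, α ^ 2, …, α ^ (2 * s)`. -/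
noncomputable def bchCode (s m : ℕ) (α : GaloisField 2 m) :
    Submodule (ZMod 2) (BinWord (2 ^ m - 1)) where
  carrier := {c | ∀ j ∈ Finset.Icc 1 (2 * s),
    ∑ i, algebraMap (ZMod 2) (GaloisField 2 m) (c i) * (α ^ j) ^ (i : ℕ) = 0}
  add_mem' := by
    intro a b ha hb j hj
    simp only [Pi.add_apply, map_add, add_mul, Finset.sum_add_distrib, ha j hj, hb j hj, add_zero]
  zero_mem' := by
    intro j _
    simp
  smul_mem' := by
    intro r a ha j hj
    simp only [Pi.smul_apply, smul_eq_mul, map_mul, mul_assoc, ← Finset.mul_sum, ha j hj, mul_zero]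

/-- The dimension of the BCH code. -/
noncomputable def bchDim (s m : ℕ) (α : GaloisField 2 m) : ℕ :=
  Module.finrank (ZMod 2) (bchCode s m α)

theorem bchDim_le (s m : ℕ) (α : GaloisField 2 m) : bchDim s m α ≤ 2 ^ m - 1 := by
  have h := Submodule.finrank_le (bchCode s m α)
  simpa [bchDim] using h

/-- The data from which the precoding function for information words of length `k` is built: the
smallest positive `m` for which a binary narrow-sense primitive BCH code of length `2 ^ m - 1`,
designed distance `2 * s + 1` and dimension at least `k` exists, such a code (given by a primitive
element `α`), and an encoding function of this code that is systematic on the first coordinates. -/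
structure BCHPrecoder (s k : ℕ) where
  /-- The degree of the field extension. -/
  m : ℕ
  m_pos : 0 < m
  /-- The primitive element. -/
  α : GaloisField 2 m
  primitive : orderOf α = 2 ^ m - 1
  le_dim : k ≤ bchDim s m α
  minimal : ∀ (m' : ℕ) (β : GaloisField 2 m'), 0 < m' → orderOf β = 2 ^ m' - 1 →
    k ≤ bchDim s m' β → m ≤ m'
  /-- The systematic encoding function of the BCH code. -/
  enc : BinWord (bchDim s m α) → BinWord (2 ^ m - 1)
  enc_mem : ∀ u, enc u ∈ bchCode s m α
  enc_systematic : ∀ u i, enc u (Fin.castLE (bchDim_le s m α) i) = u i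

namespace BCHPrecoder

variable {s k : ℕ} (H : BCHPrecoder s k)

/-- The number `k' - k` of information symbols of the BCH code that are set to zero. -/
noncomputable def short : ℕ := bchDim s H.m H.α - k

/-- The length of the precoded words, `2 ^ m - 1 - (k' - k)`. -/
noncomputable def n₀ : ℕ := 2 ^ H.m - 1 - H.short

/-- The word `(0, x)` of length `k'`. -/
noncomputable def pad (x : BinWord k) : BinWord (bchDim s H.m H.α) := fun i =>
  if hi : H.short ≤ (i : ℕ) then
    x ⟨(i : ℕ) - H.short, by have h1 := i.isLt; have h2 := H.le_dim; unfold short at *; omega⟩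
  else 0

/-- The precoding function: `h x = (x, p)`, where `(0, x, p)` is the BCH codeword that encodes
`(0, x)`. -/
noncomputable def h (x : BinWord k) : BinWord H.n₀ := fun i =>
  H.enc (H.pad x) ⟨H.short + (i : ℕ), by have h1 := i.isLt; unfold n₀ at h1; omega⟩

/-- The minimal polynomial of `α` over the field with two elements, its coefficients read as
binary digits. -/
noncomputable def polyCode : ℕ :=
  ∑ i ∈ Finset.range (H.m + 1), ((minpoly (ZMod 2) H.α).coeff i).val * 2 ^ i

/-- The parameters that describe the precoding function to an algorithm. -/
noncomputable def description : List ℕ := [H.n₀, k, H.m, H.polyCode]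

end BCHPrecoder

theorem bch_exists_primitive (m : ℕ) (hm : 0 < m) : ∃ α : GaloisField 2 m, orderOf α = 2 ^ m - 1 := by
  have : Finite (GaloisField 2 m) := inferInstance
  have hc := GaloisField.card 2 m hm.ne'
  obtain ⟨u, hu⟩ := IsCyclic.exists_generator (α := (GaloisField 2 m)ˣ)
  refine ⟨u, ?_⟩
  rw [orderOf_units, orderOf_eq_card_of_forall_mem_zpowers hu, Nat.card_units, hc]

theorem bch_le_dim (s m : ℕ) (hm : 0 < m) (α : GaloisField 2 m) :
    2 ^ m - 1 ≤ bchDim s m α + 2 * s * m := by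
  let φ : BinWord (2 ^ m - 1) →ₗ[ZMod 2] (Fin (2 * s) → GaloisField 2 m) :=
    LinearMap.pi fun j => ∑ i : Fin (2 ^ m - 1), (LinearMap.toSpanSingleton (ZMod 2) _
      ((α ^ ((j : ℕ) + 1)) ^ (i : ℕ))).comp (LinearMap.proj i)
  have hk : LinearMap.ker φ = bchCode s m α := by
    ext c
    simp only [LinearMap.mem_ker, φ, funext_iff, LinearMap.pi_apply, Pi.zero_apply]
    constructor
    · intro h j hj
      rw [Finset.mem_Icc] at hj
      have := h ⟨j - 1, by omega⟩
      simp only [Nat.sub_add_cancel hj.1] at this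
      simpa [Algebra.smul_def] using this
    · intro h j
      have := h (j + 1) (Finset.mem_Icc.2 ⟨by omega, by omega⟩)
      simpa [Algebra.smul_def] using this
  have h1 := LinearMap.finrank_range_add_finrank_ker φ
  have h2 := Submodule.finrank_le (LinearMap.range φ)
  rw [Module.finrank_pi_fintype] at h2
  simp only [GaloisField.finrank 2 hm.ne', Finset.sum_const, Finset.card_univ, Fintype.card_fin,
    smul_eq_mul] at h2
  rw [hk] at h1
  simp only [Module.finrank_fintype_fun_eq_card, Fintype.card_fin] at h1
  unfold bchDim
  omega

/-- Shifting a codeword that starts with `t` zeros by `t` places gives a codeword. -/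
theorem bch_shift_mem (s m t : ℕ) (hm : 0 < m) (α : GaloisField 2 m) (hα : orderOf α = 2 ^ m - 1)
    (c : BinWord (2 ^ m - 1)) (hc : c ∈ bchCode s m α) (h0 : ∀ i : Fin (2 ^ m - 1), (i : ℕ) < t → c i = 0) :
    (fun i : Fin (2 ^ m - 1) => if h : (i : ℕ) + t < 2 ^ m - 1 then c ⟨i + t, h⟩ else 0)
      ∈ bchCode s m α := by
  intro j hj
  have hne : α ≠ 0 := by
    rintro rfl
    have : 2 ^ m - 1 = 0 := by rw [← hα]; simp
    have := Nat.one_lt_two_pow hm.ne'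
    omega
  have key : (α ^ j) ^ t * ∑ i : Fin (2 ^ m - 1), algebraMap (ZMod 2) (GaloisField 2 m)
      (if h : (i : ℕ) + t < 2 ^ m - 1 then c ⟨i + t, h⟩ else 0) * (α ^ j) ^ (i : ℕ) = 0 := by
    rw [← hc j hj, Finset.mul_sum]
    apply Finset.sum_bij_ne_zero (fun i _ hi => ⟨(i : ℕ) + t, by
      by_contra h
      simp [h] at hi⟩)
    · simp
    · intro a _ _ b _ _ h
      simpa [Fin.ext_iff] using h
    · intro b _ hb
      have hbt : t ≤ (b : ℕ) := by
        by_contra h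
        exact hb (by rw [h0 b (by omega)]; simp)
      have e : (b : ℕ) - t + t = b := by omega
      refine ⟨⟨b - t, by omega⟩, Finset.mem_univ _, ?_, ?_⟩
      · simp only [e, b.isLt, dite_true, Fin.eta]
        intro h
        apply hb
        rw [mul_left_comm, ← pow_add, add_comm t, e] at h
        exact h
      · simp [e]
    · intro a _ ha
      have h : (a : ℕ) + t < 2 ^ m - 1 := by
        by_contra h
        simp [h] at ha
      simp only [h, dite_true]
      rw [mul_left_comm, ← pow_add, add_comm t]
  exact (mul_eq_zero.1 key).resolve_left (pow_ne_zero _ (pow_ne_zero _ hne))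

theorem bch_eq_zero_of_prefix (s m : ℕ) (hm : 0 < m) (α : GaloisField 2 m)
    (hα : orderOf α = 2 ^ m - 1) (c : BinWord (2 ^ m - 1)) (hc : c ∈ bchCode s m α)
    (h0 : ∀ i : Fin (2 ^ m - 1), (i : ℕ) < bchDim s m α → c i = 0) : c = 0 := by
  by_contra hne
  obtain ⟨i₀, hi₀⟩ : ∃ i, c i ≠ 0 := by
    by_contra h
    push Not at h
    exact hne (funext h)
  obtain ⟨a, ha, hmin⟩ : ∃ a, c a ≠ 0 ∧ ∀ b, b < a → c b = 0 := by
    have := WellFounded.has_min (wellFounded_lt (α := Fin (2 ^ m - 1))) {i | c i ≠ 0} ⟨i₀, hi₀⟩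
    obtain ⟨a, ha, h⟩ := this
    refine ⟨a, ha, fun b hb => ?_⟩
    by_contra hcb
    exact h b hcb hb
  have hda : bchDim s m α ≤ a := by
    by_contra h
    exact ha (h0 a (by omega))
  let v : Fin (bchDim s m α + 1) → bchCode s m α := fun t => ⟨_, bch_shift_mem s m t hm α hα c hc (by
    intro i hi
    have := t.isLt
    exact h0 i (by omega))⟩
  have hv : LinearIndependent (ZMod 2) v := by
    rw [Fintype.linearIndependent_iff]
    intro g hg
    by_contra hex
    push Not at hex
    obtain ⟨t₀, ht₀⟩ := hex
    obtain ⟨t, ht, hmax⟩ : ∃ t, g t ≠ 0 ∧ ∀ b, t < b → g b = 0 := by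
      obtain ⟨t, ht, h⟩ := WellFounded.has_min
        (wellFounded_gt (α := Fin (bchDim s m α + 1))) {i | g i ≠ 0} ⟨t₀, ht₀⟩
      refine ⟨t, ht, fun b hb => ?_⟩
      by_contra hcb
      exact h b hcb hb
    have htl := t.isLt
    have hg' := congrFun (congrArg Subtype.val hg) ⟨(a : ℕ) - t, by omega⟩
    simp only [Submodule.coe_sum, Submodule.coe_smul, Finset.sum_apply, Pi.smul_apply, v,
      smul_eq_mul, Submodule.coe_zero, Pi.zero_apply] at hg'
    rw [Finset.sum_eq_single t] at hg'
    · have e : (a : ℕ) - t + t = a := by omega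
      simp only [e, a.isLt, dite_true, Fin.eta] at hg'
      exact (mul_ne_zero ht ha) hg'
    · intro b _ hb
      rcases lt_or_gt_of_ne hb with h | h
      · have h' : (b : ℕ) < t := h
        rw [dif_pos (by omega), hmin _ (by rw [Fin.lt_def]; simp only; omega), mul_zero]
      · rw [hmax b h, zero_mul]
    · simp
  have := hv.fintype_card_le_finrank
  simp only [Fintype.card_fin] at this
  unfold bchDim at this
  omega

/-- The precoding data exist for every positive length. -/
theorem BCHPrecoder.nonempty (s k : ℕ) (hk : 0 < k) : Nonempty (BCHPrecoder s k) := by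
  classical
  have hex : ∃ m, 0 < m ∧ ∃ α : GaloisField 2 m, orderOf α = 2 ^ m - 1 ∧ k ≤ bchDim s m α := by
    have hex : ∃ m, 0 < m ∧ k + 2 * s * m + 1 ≤ 2 ^ m := by
      refine ⟨4 * (k + 2 * s + 1), by omega, ?_⟩
      have h := Nat.lt_two_pow_self (n := k + 2 * s + 1)
      have h4 := Nat.pow_le_pow_left (Nat.succ_le_of_lt h) 4
      rw [pow_mul']
      refine le_trans ?_ h4
      set N := k + 2 * s + 1 with hN
      have h5 : 2 * s * (4 * N) ≤ N * (4 * N) := Nat.mul_le_mul_right _ (by omega)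
      have : Nat.succ N ^ 4 = N ^ 4 + 4 * N ^ 3 + 6 * N ^ 2 + 4 * N + 1 := by
        rw [Nat.succ_eq_add_one]; ring
      rw [this]
      nlinarith [Nat.zero_le (N ^ 4), Nat.zero_le (N ^ 3), Nat.zero_le (N ^ 2)]
    obtain ⟨m, hm, h⟩ := hex
    obtain ⟨α, hα⟩ := bch_exists_primitive m hm
    have := bch_le_dim s m hm α
    exact ⟨m, hm, α, hα, by omega⟩
  obtain ⟨m, ⟨hm, α, hα, hd⟩, hmin⟩ : ∃ m, (0 < m ∧ ∃ α : GaloisField 2 m,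
      orderOf α = 2 ^ m - 1 ∧ k ≤ bchDim s m α) ∧ ∀ m', (0 < m' ∧ ∃ α : GaloisField 2 m',
      orderOf α = 2 ^ m' - 1 ∧ k ≤ bchDim s m' α) → m ≤ m' :=
    ⟨Nat.find hex, Nat.find_spec hex, fun m' h => Nat.find_min' hex h⟩
  let φ : bchCode s m α →ₗ[ZMod 2] BinWord (bchDim s m α) :=
    (LinearMap.funLeft (ZMod 2) (ZMod 2) (Fin.castLE (bchDim_le s m α))).comp
      (bchCode s m α).subtype
  have hinj : Function.Injective φ := by
    rw [← LinearMap.ker_eq_bot, LinearMap.ker_eq_bot']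
    intro c hc
    ext1
    refine bch_eq_zero_of_prefix s m hm α hα c c.2 fun i hi => ?_
    exact congrFun hc ⟨i, hi⟩
  have hsurj : Function.Surjective φ :=
    (LinearMap.injective_iff_surjective_of_finrank_eq_finrank 
      (by rw [Module.finrank_fintype_fun_eq_card, Fintype.card_fin, bchDim])).1 hinj
  choose e he using hsurj
  exact ⟨⟨m, hm, α, hα, hd, fun m' β h1 h2 h3 => hmin m' ⟨h1, β, h2, h3⟩,
    fun u => e u, fun u => (e u).2, fun u i => congrFun (he u) i⟩⟩

/-- A binary word as a list of machine words, one symbol in each. -/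
def BinWord.toWords {n : ℕ} (c : BinWord n) : List ℕ := List.ofFn fun i => (c i).val

namespace WordRAM

/-- The binary operations of the machine on words; comparisons give `0` or `1`. -/
inductive BinOp
  | add | sub | mul | div | mod | and | or | xor | shl | shr | lt | eq

/-- The value of an operation. -/
def BinOp.eval : BinOp → ℕ → ℕ → ℕ
  | .add, a, b => a + b
  | .sub, a, b => a - b
  | .mul, a, b => a * b
  | .div, a, b => a / b
  | .mod, a, b => a % b
  | .and, a, b => a &&& b
  | .or, a, b => a ||| b
  | .xor, a, b => a ^^^ b
  | .shl, a, b => a <<< b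
  | .shr, a, b => a >>> b
  | .lt, a, b => if a < b then 1 else 0
  | .eq, a, b => if a = b then 1 else 0

/-- Programs of a random access machine; `r`, `a`, `b` are names of registers. A program mentions
finitely many registers; arrays live in the memory, which is addressed through registers. -/
inductive Prog
  /-- Do nothing. -/
  | skip
  /-- `reg r := c`. -/
  | const (r c : ℕ)
  /-- `reg r := reg a ∘ reg b`. -/
  | op (o : BinOp) (r a b : ℕ)
  /-- `reg r := mem (reg a)`. -/
  | load (r a : ℕ)
  /-- `mem (reg a) := reg b`. -/
  | store (a b : ℕ)
  /-- One program after the other. -/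
  | seq (p q : Prog)
  /-- If `reg a ≠ 0` then `p`, else `q`. -/
  | ite (a : ℕ) (p q : Prog)
  /-- While `reg a ≠ 0` repeat `p`. -/
  | loop (a : ℕ) (p : Prog)

/-- The contents of the registers and of the memory. -/
structure State where
  reg : ℕ → ℕ
  mem : ℕ → ℕ

/-- The state after writing a register. -/
def State.setReg (σ : State) (r v : ℕ) : State := ⟨Function.update σ.reg r v, σ.mem⟩

/-- The state after writing a memory cell. -/
def State.setMem (σ : State) (a v : ℕ) : State := ⟨σ.reg, Function.update σ.mem a v⟩

/-- `Exec w p σ τ t`: on the machine with words of `w` bits, the program `p` started in the state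
`σ` halts in the state `τ` after `t` steps. Each instruction and each test is one step. An
instruction whose result does not fit into a word has no execution. -/
inductive Exec (w : ℕ) : Prog → State → State → ℕ → Prop
  | skip (σ : State) : Exec w .skip σ σ 1
  | const (σ : State) (r c : ℕ) (hv : c < 2 ^ w) : Exec w (.const r c) σ (σ.setReg r c) 1
  | op (σ : State) (o : BinOp) (r a b : ℕ) (hv : o.eval (σ.reg a) (σ.reg b) < 2 ^ w) :
      Exec w (.op o r a b) σ (σ.setReg r (o.eval (σ.reg a) (σ.reg b))) 1
  | load (σ : State) (r a : ℕ) : Exec w (.load r a) σ (σ.setReg r (σ.mem (σ.reg a))) 1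
  | store (σ : State) (a b : ℕ) : Exec w (.store a b) σ (σ.setMem (σ.reg a) (σ.reg b)) 1
  | seq {p q : Prog} {σ τ υ : State} {t u : ℕ} (hp : Exec w p σ τ t) (hq : Exec w q τ υ u) :
      Exec w (.seq p q) σ υ (t + u)
  | ite_true {a : ℕ} {p q : Prog} {σ τ : State} {t : ℕ} (ha : σ.reg a ≠ 0)
      (hp : Exec w p σ τ t) : Exec w (.ite a p q) σ τ (t + 1)
  | ite_false {a : ℕ} {p q : Prog} {σ τ : State} {t : ℕ} (ha : σ.reg a = 0)
      (hq : Exec w q σ τ t) : Exec w (.ite a p q) σ τ (t + 1)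
  | loop_done {a : ℕ} {p : Prog} {σ : State} (ha : σ.reg a = 0) : Exec w (.loop a p) σ σ 1
  | loop_step {a : ℕ} {p : Prog} {σ τ υ : State} {t u : ℕ} (ha : σ.reg a ≠ 0)
      (hp : Exec w p σ τ t) (hl : Exec w (.loop a p) τ υ u) : Exec w (.loop a p) σ υ (t + u + 1)

/-- The machine is deterministic: final state and number of steps are determined. -/
theorem Exec.det {w : ℕ} {p : Prog} {σ τ τ' : State} {t t' : ℕ}
    (h : Exec w p σ τ t) (h' : Exec w p σ τ' t') : τ = τ' ∧ t = t' := by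
  induction h generalizing τ' t' with
  | skip | const | op | load | store => cases h'; simp
  | seq _ _ ih1 ih2 =>
    cases h' with
    | seq a b => obtain ⟨rfl, rfl⟩ := ih1 a; obtain ⟨rfl, rfl⟩ := ih2 b; simp
  | ite_true ha _ ih =>
    cases h' with
    | ite_true _ a => obtain ⟨rfl, rfl⟩ := ih a; simp
    | ite_false h _ => exact absurd h ha
  | ite_false ha _ ih =>
    cases h' with
    | ite_true h _ => exact absurd ha h
    | ite_false _ a => obtain ⟨rfl, rfl⟩ := ih a; simp
  | loop_done ha =>
    cases h' with
    | loop_done => simp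
    | loop_step h => exact absurd ha h
  | loop_step ha _ _ ih1 ih2 =>
    cases h' with
    | loop_done h => exact absurd h ha
    | loop_step _ a b => obtain ⟨rfl, rfl⟩ := ih1 a; obtain ⟨rfl, rfl⟩ := ih2 b; simp

/-- The initial state: the input in the memory cells `0, 1, …`, its length in register `0`, and `0`
everywhere else. -/
def initial (input : List ℕ) : State where
  reg r := if r = 0 then input.length else 0
  mem a := input.getD a 0

/-- The state `τ` shows the output: its length in register `0`, its entries in the memory cells
`0, 1, …`. -/
def HasOutput (τ : State) (output : List ℕ) : Prop :=
  τ.reg 0 = output.length ∧ ∀ (i : ℕ) (hi : i < output.length), τ.mem i = output[i]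

/-- On the machine with words of `w` bits, into which all input words and the input length fit, `p`
turns `input` into `output` in at most `T` steps. -/
def ComputesWithin (w : ℕ) (p : Prog) (input output : List ℕ) (T : ℕ) : Prop :=
  input.length < 2 ^ w ∧ (∀ v ∈ input, v < 2 ^ w) ∧
    ∃ (τ : State) (t : ℕ), Exec w p (initial input) τ t ∧ HasOutput τ output ∧ t ≤ T

end WordRAM

/-! Write `n` for the length of the precoded words. The hash of a word `c` consists of a modulus `a`
and the residue modulo `a` of an integer attached to `c`, its `checksum`.

The checksum separates any two different words that agree, up to `2 * s` substitutions, after one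
deletion in each (`eq_of_skip_of_checksum_eq`). Summation by parts expresses the difference of two
checksums through the first `2 * s + 3` moments of the tail sums `u` of `c - c'`. These moments are
digits in a large base, so they all vanish if the checksums agree. The sequence `u` changes sign at
most `2 * s + 2` times, so some polynomial of that degree has the same sign pattern, and the
vanishing moments force `u = 0` (`eq_zero_of_moments`). The checksum has `O(log n)` bits, but with a
constant quadratic in `s`; this is why only its residue is stored.

A modulus can be short because few words compete with `c`. The decoder inserts a symbol `b` at a
position `p` of the received word and corrects the substitutions with the BCH code. Its minimum
distance is at least `2 * s + 1`, so the positions to correct are determined by the syndrome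
(`findPattern_complete`). The received word comes from `c` by a deletion and a pattern of
substitutions, so there are at most `2 * n ^ 2 * (n + 1) ^ s` competitors. The modulus must divide
no nonzero difference between their checksums and that of `c`. It is a product of `2 * (s + 2)`
factors. Each is below a power of two of order `sqrt n * log n`, and each divides the number of
nonzero differences still divisible by the product by more than `sqrt n`. Such a factor exists by
averaging against the von Mangoldt function and Chebyshev's lower bound for `ψ` (`exists_factor`).
Hence `a` and the residue have `(s + 2) * log n + o(log n)` bits each. Factors this small can also
be found by exhaustive search within `O(n ^ (s + 3))` steps.

The decoder tries all `2 * n` insertions and accepts those whose corrected word has the right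
residue. The true insertion is accepted. For any accepted one, `a` divides a difference of
checksums, which is therefore zero, and so the corrected word is `c` (`decoded_eq`).

For the running time, both algorithms are written in a small language of terms and commands. Each
construct has a value, a condition that excludes overflow, and a cost, and one compilation theorem
(`Term.runs`, `Cmd.runs`) transfers all three to the machine. Field elements are bit strings, and a
table indexed by syndromes finds a substitution pattern with one memory access. -/

namespace WordRAM

/-! ### Terms and their compilation -/

/-- `k`-fold iteration of `f`, which also receives the index of the round. -/
def iter {α : Type*} (f : ℕ → α → α) (a : α) : ℕ → α
  | 0 => a
  | k + 1 => f k (iter f a k)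

/-- Expressions with local variables (named by their level in the environment), memory access,
conditionals and bounded recursion. -/
inductive Term
  /-- The variable of level `i`. -/
  | var (i : ℕ)
  /-- A literal. -/
  | lit (c : ℕ)
  /-- A binary operation. -/
  | bin (o : BinOp) (a b : Term)
  /-- The content of a memory cell. -/
  | get (a : Term)
  /-- A conditional. -/
  | ite (c a b : Term)
  /-- Evaluate `f` with the value of `a` as a new variable. -/
  | bind (a f : Term)
  /-- Bounded recursion: `n` rounds, starting from `a`, `f` receives the round and the accumulator
  as new variables. -/
  | fold (n a f : Term)
  /-- Keep only the last `d` variables. -/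
  | scope (d : ℕ) (a : Term)

namespace Term

/-- The value of a term. -/
def eval (μ : ℕ → ℕ) : Term → List ℕ → ℕ
  | var i, E => E.getD i 0
  | lit c, _ => c
  | bin o a b, E => o.eval (eval μ a E) (eval μ b E)
  | get a, E => μ (eval μ a E)
  | ite c a b, E => if eval μ c E = 0 then eval μ b E else eval μ a E
  | bind a f, E => eval μ f (E ++ [eval μ a E])
  | fold n a f, E => iter (fun i x => eval μ f (E ++ [i, x])) (eval μ a E) (eval μ n E)
  | scope d a, E => eval μ a (E.drop (E.length - d))

/-- No operation overflows the words below `W`. Only operations that can overflow are concerned. -/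
def ok (W : ℕ) (μ : ℕ → ℕ) : Term → List ℕ → Prop
  | var i, E => i < E.length
  | lit c, _ => c < W
  | bin o a b, E => ok W μ a E ∧ ok W μ b E ∧ (match o with
      | .add => eval μ a E + eval μ b E < W
      | .mul => eval μ a E * eval μ b E < W
      | .shl => eval μ a E <<< eval μ b E < W
      | _ => True)
  | get a, E => ok W μ a E
  | ite c a b, E => ok W μ c E ∧ (eval μ c E ≠ 0 → ok W μ a E) ∧ (eval μ c E = 0 → ok W μ b E)
  | bind a f, E => ok W μ a E ∧ ok W μ f (E ++ [eval μ a E])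
  | fold n a f, E => ok W μ n E ∧ ok W μ a E ∧ ∀ i < eval μ n E,
      ok W μ f (E ++ [i, iter (fun i x => eval μ f (E ++ [i, x])) (eval μ a E) i])
  | scope d a, E => d ≤ E.length ∧ ok W μ a (E.drop (E.length - d))

/-- A bound for the number of steps. -/
def cost (μ : ℕ → ℕ) : Term → List ℕ → ℕ
  | var _, _ => 1
  | lit _, _ => 1
  | bin _ a b, E => cost μ a E + cost μ b E + 1
  | get a, E => cost μ a E + 1
  | ite c a b, E => cost μ c E + (if eval μ c E = 0 then cost μ b E else cost μ a E) + 1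
  | bind a f, E => cost μ a E + cost μ f (E ++ [eval μ a E]) + 1
  | fold n a f, E => cost μ n E + cost μ a E + (∑ i ∈ Finset.range (eval μ n E),
      (cost μ f (E ++ [i, iter (fun i x => eval μ f (E ++ [i, x])) (eval μ a E) i]) + 5)) + 5
  | scope d a, E => cost μ a (E.drop (E.length - d))

/-- Copy register `a` to register `r`. -/
def move (r a : ℕ) : Prog := .op .or r a a

/-- The machine code of a term. The variable of level `i` is in register `2 * (o + i)`, `d` variables
exist, odd registers from `2 * k + 1` on may be used, and the result is put into this register. -/
def code : Term → (o d k : ℕ) → Prog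
  | var i, o, _, k => move (2 * k + 1) (2 * (o + i))
  | lit c, _, _, k => .const (2 * k + 1) c
  | bin op a b, o, d, k => .seq (code a o d k) (.seq (code b o d (k + 1))
      (.op op (2 * k + 1) (2 * k + 1) (2 * (k + 1) + 1)))
  | get a, o, d, k => .seq (code a o d k) (.load (2 * k + 1) (2 * k + 1))
  | ite c a b, o, d, k => .seq (code c o d k) (.ite (2 * k + 1) (code a o d k) (code b o d k))
  | bind a f, o, d, k => .seq (code a o d k) (.seq (move (2 * (o + d)) (2 * k + 1))
      (code f o (d + 1) k))
  | fold n a f, o, d, k => .seq (code n o d k) (.seq (code a o d (k + 1))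
      (.seq (move (2 * (o + d + 1)) (2 * (k + 1) + 1)) (.seq (.const (2 * (o + d)) 0)
      (.seq (.op .lt (2 * (k + 1) + 1) (2 * (o + d)) (2 * k + 1))
      (.seq (.loop (2 * (k + 1) + 1) (.seq (code f o (d + 2) (k + 1))
        (.seq (move (2 * (o + d + 1)) (2 * (k + 1) + 1)) (.seq (.const (2 * (k + 1) + 1) 1)
        (.seq (.op .add (2 * (o + d)) (2 * (o + d)) (2 * (k + 1) + 1))
        (.op .lt (2 * (k + 1) + 1) (2 * (o + d)) (2 * k + 1)))))))
      (move (2 * k + 1) (2 * (o + d + 1))))))))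
  | scope e a, o, d, k => code a (o + (d - e)) e k

end Term

/-- All registers and memory cells hold words below `W`. -/
def State.Small (W : ℕ) (σ : State) : Prop := (∀ r, σ.reg r < W) ∧ ∀ a, σ.mem a < W

theorem State.Small.setReg {W : ℕ} {σ : State} (h : σ.Small W) (r : ℕ) {v : ℕ} (hv : v < W) :
    (σ.setReg r v).Small W := by
  refine ⟨fun q => ?_, h.2⟩
  by_cases hq : q = r
  · simp [State.setReg, hq, hv]
  · simpa [State.setReg, hq] using h.1 q

theorem State.Small.setMem {W : ℕ} {σ : State} (h : σ.Small W) (r : ℕ) {v : ℕ} (hv : v < W) :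
    (σ.setMem r v).Small W := by
  refine ⟨h.1, fun q => ?_⟩
  by_cases hq : q = r
  · simp [State.setMem, hq, hv]
  · simpa [State.setMem, hq] using h.2 q

theorem BinOp.eval_lt {w : ℕ} (hw : 0 < w) (o : BinOp) {a b : ℕ} (ha : a < 2 ^ w) (hb : b < 2 ^ w)
    (h : match o with
      | .add => a + b < 2 ^ w
      | .mul => a * b < 2 ^ w
      | .shl => a <<< b < 2 ^ w
      | _ => True) : o.eval a b < 2 ^ w := by
  have h1 : 1 < 2 ^ w := Nat.one_lt_two_pow hw.ne'
  cases o <;> simp only [BinOp.eval] at *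
  · exact h
  · omega
  · exact h
  · exact (Nat.div_le_self _ _).trans_lt ha
  · exact (Nat.mod_le _ _).trans_lt ha
  · exact Nat.and_lt_two_pow _ hb
  · exact Nat.or_lt_two_pow ha hb
  · exact Nat.xor_lt_two_pow ha hb
  · exact h
  · rw [Nat.shiftRight_eq_div_pow]; exact (Nat.div_le_self _ _).trans_lt ha
  · split_ifs <;> omega
  · split_ifs <;> omega

/-- The program halts within `T` steps, and its final state satisfies `Q`. -/
def Runs (w : ℕ) (p : Prog) (σ : State) (T : ℕ) (Q : State → Prop) : Prop :=
  ∃ τ t, Exec w p σ τ t ∧ t ≤ T ∧ Q τ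

theorem Runs.mono {w : ℕ} {p : Prog} {σ : State} {T T' : ℕ} {Q Q' : State → Prop}
    (h : Runs w p σ T Q) (hT : T ≤ T') (hQ : ∀ τ, Q τ → Q' τ) : Runs w p σ T' Q' := by
  obtain ⟨τ, t, h1, h2, h3⟩ := h
  exact ⟨τ, t, h1, h2.trans hT, hQ _ h3⟩

theorem Runs.seq {w : ℕ} {p q : Prog} {σ : State} {T U : ℕ} {Q : State → Prop}
    (h : Runs w p σ T fun τ => Runs w q τ U Q) : Runs w (.seq p q) σ (T + U) Q := by
  obtain ⟨τ, t, h1, h2, υ, u, h3, h4, h5⟩ := h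
  exact ⟨υ, t + u, .seq h1 h3, by omega, h5⟩

theorem Runs.op {w : ℕ} {o : BinOp} {r a b : ℕ} {σ : State} {Q : State → Prop}
    (hv : o.eval (σ.reg a) (σ.reg b) < 2 ^ w)
    (h : Q (σ.setReg r (o.eval (σ.reg a) (σ.reg b)))) : Runs w (.op o r a b) σ 1 Q :=
  ⟨_, 1, .op σ o r a b hv, le_rfl, h⟩

theorem Runs.const {w r c : ℕ} {σ : State} {Q : State → Prop} (hv : c < 2 ^ w)
    (h : Q (σ.setReg r c)) : Runs w (.const r c) σ 1 Q :=
  ⟨_, 1, .const σ r c hv, le_rfl, h⟩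

/-- The machine has no copy instruction; the disjunction of a word with itself serves as one and
cannot overflow. -/
theorem Runs.move {w r a : ℕ} {σ : State} {Q : State → Prop} (hs : σ.Small (2 ^ w))
    (h : Q (σ.setReg r (σ.reg a))) : Runs w (Term.move r a) σ 1 Q :=
  .op (by simpa [BinOp.eval] using hs.1 a) (by simpa [BinOp.eval] using h)

theorem Runs.load {w r a : ℕ} {σ : State} {Q : State → Prop}
    (h : Q (σ.setReg r (σ.mem (σ.reg a)))) : Runs w (.load r a) σ 1 Q :=
  ⟨_, 1, .load σ r a, le_rfl, h⟩

theorem Runs.store {w a b : ℕ} {σ : State} {Q : State → Prop}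
    (h : Q (σ.setMem (σ.reg a) (σ.reg b))) : Runs w (.store a b) σ 1 Q :=
  ⟨_, 1, .store σ a b, le_rfl, h⟩

/-- A loop over `N` rounds with an invariant. -/
theorem Runs.loop {w a : ℕ} {p : Prog} (I : ℕ → State → Prop) (N : ℕ) (T : ℕ → ℕ)
    (h0 : ∀ i σ, I i σ → (σ.reg a ≠ 0 ↔ i < N))
    (hstep : ∀ i σ, i < N → I i σ → Runs w p σ (T i) (I (i + 1)))
    {σ : State} (hσ : I 0 σ) : Runs w (.loop a p) σ (∑ i ∈ Finset.range N, (T i + 1) + 1) (I N) := by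
  -- Induction on the number `j` of rounds still to come, because an execution of a loop unfolds at
  -- its first round.
  suffices H : ∀ j i σ, i + j = N → I i σ →
      Runs w (.loop a p) σ (∑ x ∈ Finset.range j, (T (i + x) + 1) + 1) (I N) by
    simpa using H N 0 σ (by omega) hσ
  intro j
  induction j with
  | zero =>
    intro i σ hi hI
    have : ¬ σ.reg a ≠ 0 := by rw [h0 i σ hI]; omega
    refine ⟨σ, 1, .loop_done (not_not.1 this), by simp, ?_⟩
    simpa [← hi] using hI
  | succ j ih =>
    intro i σ hi hI
    obtain ⟨τ, t, h1, h2, h3⟩ := hstep i σ (by omega) hI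
    obtain ⟨υ, u, h4, h5, h6⟩ := ih (i + 1) τ (by omega) h3
    refine ⟨υ, t + u + 1, .loop_step ((h0 i σ hI).2 (by omega)) h1 h4, ?_, h6⟩
    rw [Finset.sum_range_succ']
    have e : ∀ x, i + 1 + x = i + (x + 1) := fun x => by omega
    simp only [e] at h5
    simp only [add_zero]
    omega

namespace Term

/-- The state after a term was computed: the result is in its register, nothing else of what is in
use changed. -/
structure Done (w : ℕ) (σ : State) (m k v : ℕ) (τ : State) : Prop where
  small : τ.Small (2 ^ w)
  mem : τ.mem = σ.mem
  res : τ.reg (2 * k + 1) = v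
  var : ∀ i < m, τ.reg (2 * i) = σ.reg (2 * i)
  tmp : ∀ i < k, τ.reg (2 * i + 1) = σ.reg (2 * i + 1)

/-- The compiled term computes the value. -/
theorem runs {w : ℕ} (hw : 0 < w) (e : Term) : ∀ (E : List ℕ) (o k : ℕ) (σ : State),
    σ.Small (2 ^ w) → (∀ i < E.length, σ.reg (2 * (o + i)) = E.getD i 0) →
    e.ok (2 ^ w) σ.mem E → Runs w (e.code o E.length k) σ (e.cost σ.mem E)
      (Done w σ (o + E.length) k (e.eval σ.mem E)) := by
  have h1 : 1 < 2 ^ w := Nat.one_lt_two_pow hw.ne'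
  induction e with
  | var i =>
    intro E o k σ hs hE hok
    refine .move hs ⟨hs.setReg _ (hs.1 _), rfl, ?_, ?_, ?_⟩
    · simp [State.setReg, eval, hE i hok]
    · intro j hj; simp [State.setReg, Function.update_apply]; omega
    · intro j hj; simp [State.setReg, Function.update_apply]; omega
  | lit c =>
    intro E o k σ hs hE hok
    refine .const hok ⟨hs.setReg _ hok, rfl, ?_, ?_, ?_⟩
    · simp [State.setReg, eval]
    · intro j hj; simp [State.setReg, Function.update_apply]; omega
    · intro j hj; simp [State.setReg, Function.update_apply]; omega
  | bin op a b iha ihb =>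
    intro E o k σ hs hE hok
    obtain ⟨ha, hb, hv⟩ := hok
    rw [cost, add_assoc]
    refine (iha E o k σ hs hE ha).mono le_rfl (fun τ hτ => ?_) |>.seq
    rw [← hτ.mem] at hb
    -- The first operand waits in temporary `k`; the second one is computed from temporary `k + 1`
    -- on, and `Done.tmp` protects what lies below.
    refine (ihb E o (k + 1) τ hτ.small (fun i hi => by rw [hτ.var _ (by omega), hE i hi])
      hb).mono (Q' := fun υ => _) (by rw [hτ.mem]) (fun υ hυ => ?_) |>.seq
    have r1 : υ.reg (2 * k + 1) = eval σ.mem a E := by rw [hυ.tmp k (by omega), hτ.res]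
    have r2 : υ.reg (2 * (k + 1) + 1) = eval σ.mem b E := by rw [hυ.res, hτ.mem]
    have hv' : op.eval (υ.reg (2 * k + 1)) (υ.reg (2 * (k + 1) + 1)) < 2 ^ w := by
      refine op.eval_lt hw (hυ.small.1 _) (hυ.small.1 _) ?_
      rw [r1, r2]; exact hv
    refine .op hv' ⟨hυ.small.setReg _ hv', by simp [State.setReg, hυ.mem, hτ.mem], ?_, ?_, ?_⟩
    · simp [State.setReg, eval, r1, r2]
    · intro j hj
      rw [← hτ.var j hj, ← hυ.var j hj]
      simp [State.setReg, Function.update_apply]; omega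
    · intro j hj
      rw [← hτ.tmp j hj, ← hυ.tmp j (by omega)]
      simp [State.setReg, Function.update_apply]; omega
  | get a iha =>
    intro E o k σ hs hE hok
    refine (iha E o k σ hs hE hok).mono le_rfl (fun τ hτ => ?_) |>.seq
    refine .load ⟨hτ.small.setReg _ (hτ.small.2 _), by simp [State.setReg, hτ.mem], ?_, ?_, ?_⟩
    · simp [State.setReg, eval, hτ.res, hτ.mem]
    · intro j hj
      rw [← hτ.var j hj]
      simp [State.setReg, Function.update_apply]; omega
    · intro j hj
      rw [← hτ.tmp j hj]
      simp [State.setReg, Function.update_apply]; omega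
  | ite c a b ihc iha ihb =>
    intro E o k σ hs hE hok
    obtain ⟨hc, ha, hb⟩ := hok
    rw [cost, add_assoc]
    refine (ihc E o k σ hs hE hc).mono le_rfl (fun τ hτ => ?_) |>.seq
    rw [← hτ.mem] at ha hb
    by_cases h : eval σ.mem c E = 0
    · obtain ⟨υ, t, e1, e2, e3⟩ := ihb E o k τ hτ.small
        (fun i hi => by rw [hτ.var _ (by omega), hE i hi]) (hb (by rw [hτ.mem, h]))
      refine ⟨υ, t + 1, .ite_false (by rw [hτ.res, h]) e1, by rw [if_pos h, ← hτ.mem]; omega, e3.small,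
        by rw [e3.mem, hτ.mem], ?_, fun j hj => ?_, fun j hj => ?_⟩
      · rw [e3.res, eval, if_pos h, hτ.mem]
      · rw [e3.var j hj, hτ.var j hj]
      · rw [e3.tmp j hj, hτ.tmp j hj]
    · obtain ⟨υ, t, e1, e2, e3⟩ := iha E o k τ hτ.small
        (fun i hi => by rw [hτ.var _ (by omega), hE i hi]) (ha (by rwa [hτ.mem]))
      refine ⟨υ, t + 1, .ite_true (by rwa [hτ.res]) e1, by rw [if_neg h, ← hτ.mem]; omega, e3.small,
        by rw [e3.mem, hτ.mem], ?_, fun j hj => ?_, fun j hj => ?_⟩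
      · rw [e3.res, eval, if_neg h, hτ.mem]
      · rw [e3.var j hj, hτ.var j hj]
      · rw [e3.tmp j hj, hτ.tmp j hj]
  | bind a f iha ihf =>
    intro E o k σ hs hE hok
    obtain ⟨ha, hf⟩ := hok
    rw [cost, add_assoc, add_comm (cost _ f _) 1]
    refine (iha E o k σ hs hE ha).mono le_rfl (fun τ hτ => ?_) |>.seq
    refine .seq (.move hτ.small ?_)
    have ih := ihf (E ++ [eval σ.mem a E]) o k
      (τ.setReg (2 * (o + E.length)) (τ.reg (2 * k + 1))) (hτ.small.setReg _ (hτ.small.1 _))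
      (fun i hi => by
        simp only [List.length_append, List.length_singleton] at hi
        rcases Nat.lt_succ_iff_lt_or_eq.1 hi with h | h
        · rw [List.getD_append _ _ _ _ h, ← hE i h, ← hτ.var _ (by omega)]
          simp [State.setReg, Function.update_apply]; omega
        · subst h
          simp [State.setReg, hτ.res]) (by simpa [State.setReg, hτ.mem] using hf)
    have hm : (τ.setReg (2 * (o + E.length)) (τ.reg (2 * k + 1))).mem = σ.mem := hτ.mem
    simp only [hm, List.length_append, List.length_singleton] at ih
    refine ih.mono le_rfl fun υ hυ => ⟨hυ.small, hυ.mem.trans hm, by rw [hυ.res, eval],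
      fun j hj => ?_, fun j hj => ?_⟩
    · rw [hυ.var j (by omega), ← hτ.var j hj]
      simp [State.setReg, Function.update_apply]; omega
    · rw [hυ.tmp j (by omega), ← hτ.tmp j hj]
      simp [State.setReg, Function.update_apply]; omega
  | scope e a iha =>
    intro E o k σ hs hE hok
    obtain ⟨he, ha⟩ := hok
    have hl : (E.drop (E.length - e)).length = e := by rw [List.length_drop]; omega
    -- The last `e` variables become a frame of their own by a shift of the offset; nothing is
    -- copied.
    have ih := iha (E.drop (E.length - e)) (o + (E.length - e)) k σ hs (fun i hi => by
      rw [hl] at hi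
      rw [add_assoc, hE _ (by omega)]
      simp [List.getD_eq_getElem?_getD]) ha
    rw [hl] at ih
    refine ih.mono le_rfl fun υ hυ => ⟨hυ.small, hυ.mem, by rw [hυ.res, eval],
      fun j hj => hυ.var j (by omega), hυ.tmp⟩
  | fold n a f ihn iha ihf =>
    intro E o k σ hs hE hok
    obtain ⟨hn, ha, hf⟩ := hok
    set N := eval σ.mem n E with hN
    set g := iter (fun i x => eval σ.mem f (E ++ [i, x])) (eval σ.mem a E) with hg
    have hcost : cost σ.mem (fold n a f) E = cost σ.mem n E + (cost σ.mem a E + (1 + (1 + (1 +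
      ((∑ i ∈ Finset.range N, ((cost σ.mem f (E ++ [i, g i]) + (1 + (1 + (1 + 1)))) + 1) + 1)
        + 1))))) := by
      have e5 : ∀ x, x + (1 + (1 + (1 + 1))) + 1 = x + 5 := fun x => by omega
      rw [cost]; simp only [e5, ← hN, ← hg]; omega
    rw [hcost]
    refine (ihn E o k σ hs hE hn).mono le_rfl (fun τ hτ => ?_) |>.seq
    rw [← hτ.mem] at ha
    refine (iha E o (k + 1) τ hτ.small (fun i hi => by rw [hτ.var _ (by omega), hE i hi])
      ha).mono (Q' := fun υ => _) (by rw [hτ.mem]) (fun υ hυ => ?_) |>.seq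
    refine .seq (.move hυ.small ?_)
    refine .seq (.const (by omega) ?_)
    have hNw : N < 2 ^ w := by rw [hN, ← hτ.res]; exact hτ.small.1 _
    have key : ∀ i, (if i < N then 1 else 0) < 2 ^ w := fun i => by split_ifs <;> omega
    -- Before round `i`, temporary `k` holds the number of rounds, the two new variables hold `i`
    -- and the accumulator, and temporary `k + 1` holds the truth value of `i < N` that the loop
    -- tests.
    let I : ℕ → State → Prop := fun i ξ => ξ.Small (2 ^ w) ∧ ξ.mem = σ.mem ∧
      ξ.reg (2 * k + 1) = N ∧ ξ.reg (2 * (o + E.length)) = i ∧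
      ξ.reg (2 * (o + E.length + 1)) = g i ∧ ξ.reg (2 * (k + 1) + 1) = (if i < N then 1 else 0) ∧
      (∀ j < o + E.length, ξ.reg (2 * j) = σ.reg (2 * j)) ∧
      ∀ j < k, ξ.reg (2 * j + 1) = σ.reg (2 * j + 1)
    have e0 : ((υ.setReg (2 * (o + E.length + 1)) (υ.reg (2 * (k + 1) + 1))).setReg
        (2 * (o + E.length)) 0).Small (2 ^ w) :=
      (hυ.small.setReg _ (hυ.small.1 _)).setReg _ (by omega)
    refine .seq (.op (BinOp.eval_lt hw _ (e0.1 _) (e0.1 _) trivial) (.seq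
      (.mono (.loop I N _ ?_ ?_ ?_) le_rfl fun ξ hξ => ?_)))
    · rintro i ξ ⟨-, -, -, -, -, h, -⟩
      rw [h]; split_ifs <;> simp_all
    · rintro i ξ hi ⟨i1, i2, i3, i4, i5, i6, i7, i8⟩
      have ih := ihf (E ++ [i, g i]) o (k + 1) ξ i1 (fun j hj => by
        simp only [List.length_append, List.length_cons, List.length_nil] at hj
        rcases lt_trichotomy j E.length with h | h | h
        · rw [List.getD_append _ _ _ _ h, i7 _ (by omega), hE j h]
        · subst h; simp [i4]
        · have : j = E.length + 1 := by omega
          subst this; simp [i5, ← add_assoc]) (by rw [i2]; exact hf i hi)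
      rw [i2] at ih
      simp only [List.length_append, List.length_cons, List.length_nil, zero_add] at ih
      refine ih.mono le_rfl (fun ζ hζ => ?_) |>.seq
      show Runs _ _ _ (1 + (1 + (1 + 1))) _
      refine .seq (.move hζ.small ?_)
      refine .seq (.const h1 ?_)
      have z1 := (hζ.small.setReg (2 * (o + E.length + 1)) (hζ.small.1 (2 * (k + 1) + 1))).setReg
        (2 * (k + 1) + 1) h1
      have q1 : ζ.reg (2 * (o + E.length)) = i := by rw [hζ.var _ (by omega), i4]
      have q2 : ζ.reg (2 * k + 1) = N := by rw [hζ.tmp _ (by omega), i3]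
      have n1 : 2 * (o + E.length) ≠ 2 * (k + 1) + 1 := by omega
      have n2 : 2 * (o + E.length) ≠ 2 * (o + E.length + 1) := by omega
      have n3 : 2 * k + 1 ≠ 2 * (k + 1) + 1 := by omega
      have n4 : 2 * k + 1 ≠ 2 * (o + E.length + 1) := by omega
      have n5 : 2 * k + 1 ≠ 2 * (o + E.length) := by omega
      refine .seq (.op ?_ (.op ?_ ?_))
      · simp only [BinOp.eval, State.setReg, Function.update_self, Function.update_of_ne n1,
          Function.update_of_ne n2, q1]
        omega
      · simp only [BinOp.eval, State.setReg, Function.update_self, Function.update_of_ne n1,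
          Function.update_of_ne n2, q1, Function.update_of_ne n3, Function.update_of_ne n4,
          Function.update_of_ne n5, q2]
        exact key _
      · simp only [BinOp.eval, State.setReg, Function.update_self, Function.update_of_ne n1,
          Function.update_of_ne n2, q1, Function.update_of_ne n3, Function.update_of_ne n4,
          Function.update_of_ne n5, q2]
        refine ⟨?_, hζ.mem.trans i2, ?_, ?_, ?_, ?_, fun j hj => ?_, fun j hj => ?_⟩
        · exact (z1.setReg _ (by omega)).setReg _ (key _)
        · simp only [Function.update_of_ne n3, Function.update_of_ne n4,
            Function.update_of_ne n5, q2]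
        · simp only [Function.update_of_ne n1, Function.update_self]
        · have n6 : 2 * (o + E.length + 1) ≠ 2 * (k + 1) + 1 := by omega
          simp only [Function.update_of_ne n6, Function.update_of_ne n2.symm, Function.update_self]
          rw [hζ.res, hg, iter, ← hg]
        · simp
        · rw [← i7 j hj, ← hζ.var j (by omega)]
          simp [Function.update_apply]
          grind
        · rw [← i8 j hj, ← hζ.tmp j (by omega)]
          simp [Function.update_apply]
          grind
    · have n1 : 2 * (o + E.length) ≠ 2 * (k + 1) + 1 := by omega
      have n2 : 2 * (o + E.length) ≠ 2 * (o + E.length + 1) := by omega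
      have n3 : 2 * k + 1 ≠ 2 * (k + 1) + 1 := by omega
      have n4 : 2 * k + 1 ≠ 2 * (o + E.length + 1) := by omega
      have n5 : 2 * k + 1 ≠ 2 * (o + E.length) := by omega
      have n6 : 2 * (o + E.length + 1) ≠ 2 * (k + 1) + 1 := by omega
      have q2 : υ.reg (2 * k + 1) = N := by rw [hυ.tmp _ (by omega), hτ.res]
      simp only [BinOp.eval, State.setReg, Function.update_self, Function.update_of_ne n4,
          Function.update_of_ne n5, q2]
      refine ⟨e0.setReg _ (key _), hυ.mem.trans hτ.mem, ?_, ?_, ?_, ?_, fun j hj => ?_,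
        fun j hj => ?_⟩
      · simp only [Function.update_of_ne n3, Function.update_of_ne n4,
            Function.update_of_ne n5, q2]
      · simp only [Function.update_of_ne n1, Function.update_self]
      · simp only [Function.update_of_ne n6, Function.update_of_ne n2.symm, Function.update_self]
        rw [hυ.res, hg, iter, hτ.mem]
      · simp
      · rw [← hτ.var j hj, ← hυ.var j (by omega)]
        simp [Function.update_apply]
        grind
      · rw [← hτ.tmp j hj, ← hυ.tmp j (by omega)]
        simp [Function.update_apply]
        grind
    · obtain ⟨i1, i2, i3, i4, i5, i6, i7, i8⟩ := hξ
      refine .move i1 ⟨i1.setReg _ (i1.1 _), i2, ?_, fun j hj => ?_, fun j hj => ?_⟩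
      · simp [State.setReg, i5, eval, hg, hN]
      · rw [← i7 j hj]
        simp [State.setReg, Function.update_apply]; omega
      · rw [← i8 j hj]
        simp [State.setReg, Function.update_apply]; omega

/-- The call of a term as a function, with the values of the arguments as its only variables. -/
def call (f : Term) (as : List Term) : Term := as.foldr bind (scope as.length f)

/-- The values of the arguments of a call. -/
def evalArgs (μ : ℕ → ℕ) : List Term → List ℕ → List ℕ
  | [], _ => []
  | a :: as, E => a.eval μ E :: evalArgs μ as (E ++ [a.eval μ E])

/-- No operation overflows in the arguments of a call. -/
def okArgs (W : ℕ) (μ : ℕ → ℕ) : List Term → List ℕ → Prop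
  | [], _ => True
  | a :: as, E => a.ok W μ E ∧ okArgs W μ as (E ++ [a.eval μ E])

/-- The number of steps for the arguments of a call. -/
def costArgs (μ : ℕ → ℕ) : List Term → List ℕ → ℕ
  | [], _ => 0
  | a :: as, E => a.cost μ E + 1 + costArgs μ as (E ++ [a.eval μ E])

theorem length_evalArgs (μ : ℕ → ℕ) (as : List Term) : ∀ E, (evalArgs μ as E).length = as.length := by
  induction as with
  | nil => intro E; rfl
  | cons a as ih => intro E; simp [evalArgs, ih]

/-- Variables are named by level, so arguments appended to the environment do not rename those of
the caller. Each argument is evaluated after the earlier ones were appended. -/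
theorem foldr_bind (μ : ℕ → ℕ) (W : ℕ) (g : Term) (as : List Term) : ∀ E,
    ((as.foldr bind g).eval μ E = g.eval μ (E ++ evalArgs μ as E)) ∧
    ((as.foldr bind g).ok W μ E ↔ okArgs W μ as E ∧ g.ok W μ (E ++ evalArgs μ as E)) ∧
    ((as.foldr bind g).cost μ E = costArgs μ as E + g.cost μ (E ++ evalArgs μ as E)) := by
  induction as with
  | nil => intro E; simp [evalArgs, okArgs, costArgs]
  | cons a as ih =>
    intro E
    obtain ⟨h1, h2, h3⟩ := ih (E ++ [a.eval μ E])
    simp only [List.foldr_cons, eval, ok, cost, evalArgs, okArgs, costArgs, h1, h2, h3, and_assoc]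
    simp only [List.append_assoc, List.singleton_append, true_and]
    omega

theorem eval_call (μ : ℕ → ℕ) (f : Term) (as : List Term) (E : List ℕ) :
    (call f as).eval μ E = f.eval μ (evalArgs μ as E) := by
  rw [call, (foldr_bind μ 0 _ as E).1, eval]
  congr 1
  simp [length_evalArgs]

theorem ok_call (W : ℕ) (μ : ℕ → ℕ) (f : Term) (as : List Term) (E : List ℕ) :
    (call f as).ok W μ E ↔ okArgs W μ as E ∧ f.ok W μ (evalArgs μ as E) := by
  rw [call, (foldr_bind μ W _ as E).2.1, ok]
  simp [length_evalArgs]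

theorem cost_call (μ : ℕ → ℕ) (f : Term) (as : List Term) (E : List ℕ) :
    (call f as).cost μ E = costArgs μ as E + f.cost μ (evalArgs μ as E) := by
  rw [call, (foldr_bind μ 0 _ as E).2.2, cost]
  simp [length_evalArgs]

end Term

end WordRAM

/-! ### Commands and whole programs -/

namespace WordRAM

/-- Commands that change the memory, with local variables as in terms. -/
inductive Cmd
  /-- Store `v` in the cell `a`. -/
  | put (a v : Term)
  /-- One after the other. -/
  | seq (p q : Cmd)
  /-- Repeat for `i < n`, with `i` as a new variable. -/
  | loop (n : Term) (p : Cmd)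
  /-- Use the value of `a` as a new variable. -/
  | bind (a : Term) (p : Cmd)

namespace Cmd

/-- The memory after a command. -/
def run : Cmd → List ℕ → (ℕ → ℕ) → ℕ → ℕ
  | put a v, E, μ => Function.update μ (a.eval μ E) (v.eval μ E)
  | seq p q, E, μ => run q E (run p E μ)
  | loop n p, E, μ => iter (fun i => run p (E ++ [i])) μ (n.eval μ E)
  | bind a p, E, μ => run p (E ++ [a.eval μ E]) μ

/-- No operation overflows. -/
def ok (W : ℕ) : Cmd → List ℕ → (ℕ → ℕ) → Prop
  | put a v, E, μ => a.ok W μ E ∧ v.ok W μ E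
  | seq p q, E, μ => ok W p E μ ∧ ok W q E (run p E μ)
  | loop n p, E, μ => n.ok W μ E ∧ ∀ i < n.eval μ E,
      ok W p (E ++ [i]) (iter (fun i => run p (E ++ [i])) μ i)
  | bind a p, E, μ => a.ok W μ E ∧ ok W p (E ++ [a.eval μ E]) μ

/-- A bound for the number of steps. -/
def cost : Cmd → List ℕ → (ℕ → ℕ) → ℕ
  | put a v, E, μ => a.cost μ E + v.cost μ E + 1
  | seq p q, E, μ => cost p E μ + cost q E (run p E μ)
  | loop n p, E, μ => n.cost μ E + (∑ i ∈ Finset.range (n.eval μ E),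
      (cost p (E ++ [i]) (iter (fun i => run p (E ++ [i])) μ i) + 4)) + 3
  | bind a p, E, μ => a.cost μ E + cost p (E ++ [a.eval μ E]) μ + 1

/-- The machine code of a command, with registers used as for terms. -/
def code : Cmd → (o d k : ℕ) → Prog
  | put a v, o, d, k => .seq (a.code o d k) (.seq (v.code o d (k + 1))
      (.store (2 * k + 1) (2 * (k + 1) + 1)))
  | seq p q, o, d, k => .seq (code p o d k) (code q o d k)
  | loop n p, o, d, k => .seq (n.code o d k) (.seq (.const (2 * (o + d)) 0)
      (.seq (.op .lt (2 * (k + 1) + 1) (2 * (o + d)) (2 * k + 1))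
      (.loop (2 * (k + 1) + 1) (.seq (code p o (d + 1) (k + 1))
        (.seq (.const (2 * (k + 1) + 1) 1)
        (.seq (.op .add (2 * (o + d)) (2 * (o + d)) (2 * (k + 1) + 1))
        (.op .lt (2 * (k + 1) + 1) (2 * (o + d)) (2 * k + 1))))))))
  | bind a p, o, d, k => .seq (a.code o d k) (.seq (Term.move (2 * (o + d)) (2 * k + 1))
      (code p o (d + 1) k))

/-- The state after a command was executed: nothing but the memory changed of what is in use. -/
structure Done (w : ℕ) (σ : State) (m k : ℕ) (μ : ℕ → ℕ) (τ : State) : Prop where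
  small : τ.Small (2 ^ w)
  mem : τ.mem = μ
  var : ∀ i < m, τ.reg (2 * i) = σ.reg (2 * i)
  tmp : ∀ i < k, τ.reg (2 * i + 1) = σ.reg (2 * i + 1)

/-- The compiled command has the effect that it should have. -/
theorem runs {w : ℕ} (hw : 0 < w) (c : Cmd) : ∀ (E : List ℕ) (o k : ℕ) (σ : State),
    σ.Small (2 ^ w) → (∀ i < E.length, σ.reg (2 * (o + i)) = E.getD i 0) →
    c.ok (2 ^ w) E σ.mem → Runs w (c.code o E.length k) σ (c.cost E σ.mem)
      (Done w σ (o + E.length) k (c.run E σ.mem)) := by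
  have h1 : 1 < 2 ^ w := Nat.one_lt_two_pow hw.ne'
  induction c with
  | put a v =>
    intro E o k σ hs hE hok
    obtain ⟨ha, hb⟩ := hok
    rw [cost, add_assoc]
    refine (a.runs hw E o k σ hs hE ha).mono le_rfl (fun τ hτ => ?_) |>.seq
    rw [← hτ.mem] at hb
    refine (v.runs hw E o (k + 1) τ hτ.small (fun i hi => by rw [hτ.var _ (by omega), hE i hi])
      hb).mono (Q' := fun υ => _) (by rw [hτ.mem]) (fun υ hυ => ?_) |>.seq
    have r1 : υ.reg (2 * k + 1) = a.eval σ.mem E := by rw [hυ.tmp k (by omega), hτ.res]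
    have r2 : υ.reg (2 * (k + 1) + 1) = v.eval σ.mem E := by rw [hυ.res, hτ.mem]
    refine .store ⟨hυ.small.setMem _ (hυ.small.1 _), ?_, fun j hj => ?_, fun j hj => ?_⟩
    · simp [State.setMem, run, r1, r2, hυ.mem, hτ.mem]
    · rw [← hτ.var j hj, ← hυ.var j hj]; rfl
    · rw [← hτ.tmp j hj, ← hυ.tmp j (by omega)]; rfl
  | seq p q ihp ihq =>
    intro E o k σ hs hE hok
    obtain ⟨ha, hb⟩ := hok
    refine (ihp E o k σ hs hE ha).mono le_rfl (fun τ hτ => ?_) |>.seq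
    rw [← hτ.mem] at hb
    refine (ihq E o k τ hτ.small (fun i hi => by rw [hτ.var _ (by omega), hE i hi])
      hb).mono (by rw [hτ.mem]) (fun υ hυ => ⟨hυ.small, ?_, fun j hj => ?_, fun j hj => ?_⟩)
    · rw [hυ.mem, hτ.mem, run]
    · rw [hυ.var j hj, hτ.var j hj]
    · rw [hυ.tmp j hj, hτ.tmp j hj]
  | bind a p ihp =>
    intro E o k σ hs hE hok
    obtain ⟨ha, hf⟩ := hok
    rw [cost, add_assoc, add_comm (cost p _ _) 1]
    refine (a.runs hw E o k σ hs hE ha).mono le_rfl (fun τ hτ => ?_) |>.seq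
    refine .seq (.move hτ.small ?_)
    have ih := ihp (E ++ [a.eval σ.mem E]) o k
      (τ.setReg (2 * (o + E.length)) (τ.reg (2 * k + 1))) (hτ.small.setReg _ (hτ.small.1 _))
      (fun i hi => by
        simp only [List.length_append, List.length_singleton] at hi
        rcases Nat.lt_succ_iff_lt_or_eq.1 hi with h | h
        · rw [List.getD_append _ _ _ _ h, ← hE i h, ← hτ.var _ (by omega)]
          simp [State.setReg, Function.update_apply]; omega
        · subst h
          simp [State.setReg, hτ.res]) (by simpa [State.setReg, hτ.mem] using hf)
    have hm : (τ.setReg (2 * (o + E.length)) (τ.reg (2 * k + 1))).mem = σ.mem := hτ.mem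
    simp only [hm, List.length_append, List.length_singleton] at ih
    refine ih.mono le_rfl fun υ hυ => ⟨hυ.small, hυ.mem, fun j hj => ?_, fun j hj => ?_⟩
    · rw [hυ.var j (by omega), ← hτ.var j hj]
      simp [State.setReg, Function.update_apply]; omega
    · rw [hυ.tmp j (by omega), ← hτ.tmp j hj]
      simp [State.setReg, Function.update_apply]; omega
  | loop n p ihp =>
    intro E o k σ hs hE hok
    obtain ⟨hn, hf⟩ := hok
    set N := n.eval σ.mem E with hN
    set g := iter (fun i => run p (E ++ [i])) σ.mem with hg
    have hcost : cost (loop n p) E σ.mem = n.cost σ.mem E + (1 + (1 +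
      (∑ i ∈ Finset.range N, ((cost p (E ++ [i]) (g i) + (1 + (1 + 1))) + 1) + 1))) := by
      have e5 : ∀ x, x + (1 + (1 + 1)) + 1 = x + 4 := fun x => by omega
      rw [cost]; simp only [e5, ← hN, ← hg]; omega
    rw [hcost]
    refine (n.runs hw E o k σ hs hE hn).mono le_rfl (fun υ hυ => ?_) |>.seq
    refine .seq (.const (by omega) ?_)
    have hNw : N < 2 ^ w := by rw [hN, ← hυ.res]; exact hυ.small.1 _
    have key : ∀ i, (if i < N then 1 else 0) < 2 ^ w := fun i => by split_ifs <;> omega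
    -- As for terms, but the memory takes the place of the accumulator.
    let I : ℕ → State → Prop := fun i ξ => ξ.Small (2 ^ w) ∧ ξ.mem = g i ∧
      ξ.reg (2 * k + 1) = N ∧ ξ.reg (2 * (o + E.length)) = i ∧
      ξ.reg (2 * (k + 1) + 1) = (if i < N then 1 else 0) ∧
      (∀ j < o + E.length, ξ.reg (2 * j) = σ.reg (2 * j)) ∧
      ∀ j < k, ξ.reg (2 * j + 1) = σ.reg (2 * j + 1)
    have e0 : (υ.setReg (2 * (o + E.length)) 0).Small (2 ^ w) := hυ.small.setReg _ (by omega)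
    have n1 : 2 * (o + E.length) ≠ 2 * (k + 1) + 1 := by omega
    have n3 : 2 * k + 1 ≠ 2 * (k + 1) + 1 := by omega
    have n5 : 2 * k + 1 ≠ 2 * (o + E.length) := by omega
    refine .seq (.op (BinOp.eval_lt hw _ (e0.1 _) (e0.1 _) trivial) 
      (.mono (.loop I N _ ?_ ?_ ?_) le_rfl fun ξ hξ => ?_))
    · rintro i ξ ⟨-, -, -, -, h, -⟩
      rw [h]; split_ifs <;> simp_all
    · rintro i ξ hi ⟨i1, i2, i3, i4, i6, i7, i8⟩
      have ih := ihp (E ++ [i]) o (k + 1) ξ i1 (fun j hj => by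
        simp only [List.length_append, List.length_singleton] at hj
        rcases Nat.lt_succ_iff_lt_or_eq.1 hj with h | h
        · rw [List.getD_append _ _ _ _ h, i7 _ (by omega), hE j h]
        · subst h; simp [i4]) (by rw [i2]; exact hf i hi)
      rw [i2] at ih
      simp only [List.length_append, List.length_singleton] at ih
      refine ih.mono le_rfl (fun ζ hζ => ?_) |>.seq
      show Runs _ _ _ (1 + (1 + 1)) _
      refine .seq (.const h1 ?_)
      have z1 := hζ.small.setReg (2 * (k + 1) + 1) h1
      have q1 : ζ.reg (2 * (o + E.length)) = i := by rw [hζ.var _ (by omega), i4]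
      have q2 : ζ.reg (2 * k + 1) = N := by rw [hζ.tmp _ (by omega), i3]
      refine .seq (.op ?_ (.op ?_ ?_))
      · simp only [BinOp.eval, State.setReg, Function.update_self, Function.update_of_ne n1, q1]
        omega
      · simp only [BinOp.eval, State.setReg, Function.update_self, Function.update_of_ne n1,
          q1, Function.update_of_ne n3, Function.update_of_ne n5, q2]
        exact key _
      · simp only [BinOp.eval, State.setReg, Function.update_self, Function.update_of_ne n1,
          q1, Function.update_of_ne n3, Function.update_of_ne n5, q2]
        refine ⟨?_, ?_, ?_, ?_, ?_, fun j hj => ?_, fun j hj => ?_⟩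
        · exact (z1.setReg _ (by omega)).setReg _ (key _)
        · rw [hg, iter, ← hg, ← hζ.mem]
        · simp only [Function.update_of_ne n3, Function.update_of_ne n5, q2]
        · simp only [Function.update_of_ne n1, Function.update_self]
        · simp
        · rw [← i7 j hj, ← hζ.var j (by omega)]
          simp [Function.update_apply]
          grind
        · rw [← i8 j hj, ← hζ.tmp j (by omega)]
          simp [Function.update_apply]
          grind
    · have q2 : υ.reg (2 * k + 1) = N := hυ.res
      simp only [BinOp.eval, State.setReg, Function.update_self, 
          Function.update_of_ne n5, q2]
      refine ⟨e0.setReg _ (key _), hυ.mem, ?_, ?_, ?_, fun j hj => ?_, fun j hj => ?_⟩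
      · simp only [Function.update_of_ne n3, Function.update_of_ne n5, q2]
      · simp only [Function.update_of_ne n1, Function.update_self]
      · simp
      · rw [← hυ.var j (by omega)]
        simp [Function.update_apply]
        grind
      · rw [← hυ.tmp j (by omega)]
        simp [Function.update_apply]
        grind
    · obtain ⟨i1, i2, i3, i4, i6, i7, i8⟩ := hξ
      exact ⟨i1, i2, i7, i8⟩

end Cmd

/-- The program that reads a parameter `x`, executes `c`, and returns `ℓ` memory cells. -/
def program (x : Term) (c : Cmd) (ℓ : Term) : Prog :=
  .seq (x.code 1 0 0) (.seq (Term.move 2 1) (.seq (c.code 1 1 0) (.seq (ℓ.code 1 1 0)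
    (Term.move 0 1))))

/-- Frame offset `1` keeps register `0` out of the frame, so that the output length can be put there
at the end. Register `1` is temporary `0`, and register `2` is variable `0`, which holds the
parameter `v`. -/
theorem program_computes {w : ℕ} (hw : 0 < w) {x : Term} {c : Cmd} {ℓ : Term}
    {input output : List ℕ} {μ τ : ℕ → ℕ} {v T : ℕ} (hlen : input.length < 2 ^ w)
    (hin : ∀ v ∈ input, v < 2 ^ w) (hμ : μ = fun a => input.getD a 0)
    (hx : x.ok (2 ^ w) μ []) (hv : x.eval μ [] = v)
    (hc : c.ok (2 ^ w) [v] μ) (hr : c.run [v] μ = τ)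
    (hl : ℓ.ok (2 ^ w) τ [v]) (hl' : ℓ.eval τ [v] = output.length)
    (hout : ∀ (i : ℕ) (hi : i < output.length), τ i = output[i])
    (hT : x.cost μ [] + c.cost [v] μ + ℓ.cost τ [v] + 2 ≤ T) :
    ComputesWithin w (program x c ℓ) input output T := by
  refine ⟨hlen, hin, ?_⟩
  have hs : (initial input).Small (2 ^ w) := by
    constructor
    · intro r; simp only [initial]; split_ifs
      · exact hlen
      · positivity
    · intro a
      simp only [initial, List.getD_eq_getElem?_getD]
      rcases lt_or_ge a input.length with h | h
      · simpa [h] using hin _ (List.getElem_mem h)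
      · simp [h]
  have hm : (initial input).mem = μ := by rw [hμ]; rfl
  have main : Runs w (program x c ℓ) (initial input) (x.cost μ [] + (1 + (c.cost [v] μ +
      (ℓ.cost τ [v] + 1)))) (fun σ => HasOutput σ output) := by
    have r1 := x.runs hw [] 1 0 _ hs (by simp) (by rwa [hm])
    rw [hm] at r1
    refine r1.mono le_rfl (fun α hα => ?_) |>.seq
    refine .seq (.move hα.small ?_)
    have m2 : (α.setReg 2 (α.reg 1)).mem = μ := hα.mem.trans hm
    have r2 := c.runs hw [v] 1 0 (α.setReg 2 (α.reg 1)) (hα.small.setReg _ (hα.small.1 _)) (by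
      intro i hi
      simp only [List.length_singleton, Nat.lt_one_iff] at hi
      subst hi
      simpa [State.setReg, ← hv] using hα.res) (by rwa [m2])
    rw [m2, hr] at r2
    refine r2.mono le_rfl (fun β hβ => ?_) |>.seq
    have r3 := ℓ.runs hw [v] 1 0 β hβ.small (by
      intro i hi
      simp only [List.length_singleton, Nat.lt_one_iff] at hi
      subst hi
      rw [hβ.var _ (by simp)]
      simpa [State.setReg, ← hv] using hα.res) (by rwa [hβ.mem])
    rw [hβ.mem] at r3
    refine r3.mono le_rfl (fun γ hγ => ?_) |>.seq
    refine .move hγ.small ⟨?_, fun i hi => ?_⟩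
    · simpa [State.setReg, hl'] using hγ.res
    · rw [← hout i hi, ← hβ.mem, ← hγ.mem]; rfl
  obtain ⟨σ, t, h1, h2, h3⟩ := main
  exact ⟨σ, t, h1, h3, by omega⟩

end WordRAM

/-! ### The checksum: moments and sign changes -/

/-- The position before the deletion of position `d` of what is at position `j` after it. -/
def skip (d j : ℕ) : ℕ := if j < d then j else j + 1

/-- Uniqueness of signed digits: `K` divides `a 0`, which is smaller than `K` in absolute value, so
it is zero; then `K` is cancelled and the next digit is treated alike. -/
theorem eq_zero_of_sum_pow_mul_eq_zero (K : ℤ) (D : ℕ) : ∀ a : ℕ → ℤ, (∀ j < D, |a j| < K) →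
    ∑ j ∈ Finset.range D, K ^ j * a j = 0 → ∀ j < D, a j = 0 := by
  induction D with
  | zero => intro a _ _ j hj; omega
  | succ D ih =>
    intro a ha hs
    rw [Finset.sum_range_succ'] at hs
    have hs' : K * ∑ j ∈ Finset.range D, K ^ j * a (j + 1) + a 0 = 0 := by
      rw [← hs, Finset.mul_sum]
      simp only [pow_succ, pow_zero, one_mul]
      congr 1
      exact Finset.sum_congr rfl fun j _ => by ring
    have h0 : a 0 = 0 := by
      apply Int.eq_zero_of_abs_lt_dvd (m := K) _ (ha 0 (by omega))
      exact (Dvd.intro _ (eq_neg_of_add_eq_zero_left hs')).neg_right.trans (by simp)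
    have hK : K ≠ 0 := by
      have := ha 0 (by omega)
      have := abs_nonneg (a 0)
      omega
    rw [h0, add_zero] at hs'
    have h1 := ih (fun j => a (j + 1)) (fun j hj => ha _ (by omega))
      ((mul_eq_zero.1 hs').resolve_left hK)
    intro j hj
    cases j with
    | zero => exact h0
    | succ j => exact h1 j (by omega)

/-- A sequence with at most `D` sign changes whose first `D + 1` moments vanish is zero. -/
theorem eq_zero_of_moments (n D : ℕ) (u : ℕ → ℤ) (P : ℕ → Prop) (B : Finset ℕ) (hB : B.card ≤ D)
    (hP : ∀ l, P l → 0 ≤ u l) (hP' : ∀ l, ¬ P l → u l ≤ 0)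
    (hc : ∀ l, l ∉ B → (P l ↔ P (l + 1)))
    (hm : ∀ j < D + 1, ∑ l ∈ Finset.range n, (l : ℤ) ^ j * u l = 0) : ∀ l < n, u l = 0 := by
  classical
  -- Only true changes of `P` may become roots: a root elsewhere would spoil the sign pattern.
  set B' := B.filter fun b => ¬ (P b ↔ P (b + 1)) with hB'
  -- The factor for `b` has its root at `b + 1 / 2`, so `q` vanishes at no integer and changes sign
  -- between `b` and `b + 1`, exactly as `P` does.
  let q : Polynomial ℤ := ∏ b ∈ B', (Polynomial.C (-2) * Polynomial.X + Polynomial.C (2 * (b : ℤ) + 1))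
  let r : ℕ → ℤ := fun l => ∏ b ∈ B', (2 * (b : ℤ) + 1 - 2 * l)
  let ε : ℕ → ℤ := fun l => if P l then 1 else -1
  have hqr : ∀ l : ℕ, q.eval (l : ℤ) = r l := by
    intro l
    simp only [q, r, Polynomial.eval_prod]
    refine Finset.prod_congr rfl fun b _ => ?_
    simp
    ring
  have hdeg : q.natDegree < D + 1 := by
    have h1 : q.natDegree ≤ ∑ b ∈ B', (Polynomial.C (-2) * Polynomial.X +
        Polynomial.C (2 * (b : ℤ) + 1)).natDegree := Polynomial.natDegree_prod_le _ _
    have h2 : ∑ b ∈ B', (Polynomial.C (-2) * Polynomial.X +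
        Polynomial.C (2 * (b : ℤ) + 1)).natDegree ≤ ∑ b ∈ B', 1 :=
      Finset.sum_le_sum fun b _ => Polynomial.natDegree_linear_le
    have h3 : B'.card ≤ B.card := Finset.card_filter_le _ _
    rw [Finset.sum_const, smul_eq_mul, mul_one] at h2
    omega
  have hr0 : ∀ l, r l ≠ 0 := fun l => Finset.prod_ne_zero_iff.2 fun b _ => by omega
  -- Between `l` and `l + 1` only the factor with `b = l` changes sign, and then `ε` changes sign
  -- too.
  have hstep : ∀ l, 0 < (r l * ε l) * (r (l + 1) * ε (l + 1)) := by
    intro l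
    have e1 : r l * r (l + 1) = ∏ b ∈ B', ((2 * (b : ℤ) + 1 - 2 * l) * (2 * (b : ℤ) - 1 - 2 * l)) := by
      simp only [r, ← Finset.prod_mul_distrib]
      refine Finset.prod_congr rfl fun b _ => ?_
      push_cast; ring
    have hpos : ∀ b : ℕ, b ≠ l → 0 < (2 * (b : ℤ) + 1 - 2 * l) * (2 * (b : ℤ) - 1 - 2 * l) := by
      intro b hb
      rcases lt_or_gt_of_ne hb with h | h
      · exact mul_pos_of_neg_of_neg (by omega) (by omega)
      · exact mul_pos (by omega) (by omega)
    have e2 : (r l * ε l) * (r (l + 1) * ε (l + 1)) = (r l * r (l + 1)) * (ε l * ε (l + 1)) := by ring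
    rw [e2]
    by_cases hl : l ∈ B'
    · have hne : ¬ (P l ↔ P (l + 1)) := (Finset.mem_filter.1 hl).2
      have e3 : ε l * ε (l + 1) = -1 := by
        simp only [ε]
        by_cases h1 : P l <;> by_cases h2 : P (l + 1) <;> simp_all
      rw [e3, e1, ← Finset.mul_prod_erase _ _ hl]
      have : 0 < ∏ b ∈ B'.erase l, ((2 * (b : ℤ) + 1 - 2 * l) * (2 * (b : ℤ) - 1 - 2 * l)) :=
        Finset.prod_pos fun b hb => hpos b (Finset.ne_of_mem_erase hb)
      nlinarith
    · have hiff : P l ↔ P (l + 1) := by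
        by_contra h
        by_cases hb : l ∈ B
        · exact hl (Finset.mem_filter.2 ⟨hb, h⟩)
        · exact h (hc l hb)
      have e3 : ε l * ε (l + 1) = 1 := by
        simp only [ε, hiff]
        split_ifs <;> simp
      rw [e3, e1, mul_one]
      exact Finset.prod_pos fun b hb => hpos b (fun h => hl (h ▸ hb))
  have hsign : ∀ l, 0 < (r l * ε l) * (r 0 * ε 0) := by
    intro l
    have hε : ∀ l, ε l ≠ 0 := fun l => by simp only [ε]; split_ifs <;> simp
    induction l with
    | zero => exact mul_self_pos.2 (mul_ne_zero (hr0 0) (hε 0))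
    | succ l ih =>
      have h1 := mul_pos (hstep l) ih
      have h2 : 0 < (r l * ε l) ^ 2 := by
        have := mul_ne_zero (hr0 l) (hε l)
        positivity
      have h3 : (r l * ε l) * (r (l + 1) * ε (l + 1)) * (r l * ε l * (r 0 * ε 0)) =
        (r l * ε l) ^ 2 * (r (l + 1) * ε (l + 1) * (r 0 * ε 0)) := by ring
      rw [h3] at h1
      exact (pos_iff_pos_of_mul_pos h1).1 h2
  have hsum : ∑ l ∈ Finset.range n, r l * u l = 0 := by
    have : ∀ l : ℕ, r l = ∑ j ∈ Finset.range (D + 1), q.coeff j * (l : ℤ) ^ j := fun l => by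
      rw [← hqr, Polynomial.eval_eq_sum_range' hdeg]
    simp only [this, Finset.sum_mul]
    rw [Finset.sum_comm]
    refine Finset.sum_eq_zero fun j hj => ?_
    simp only [mul_assoc, ← Finset.mul_sum, hm j (Finset.mem_range.1 hj), mul_zero]
  -- All terms `r l * u l` have one sign, that of `r 0 * ε 0`, so their vanishing sum makes each of
  -- them zero.
  have hnn : ∀ l ∈ Finset.range n, 0 ≤ (r l * u l) * (r 0 * ε 0) := by
    intro l _
    have h := hsign l
    simp only [ε] at h ⊢
    by_cases hp : P l
    · have := hP l hp
      simp only [hp, if_true, mul_one] at h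
      have e : r l * u l * (r 0 * if P 0 then 1 else -1) =
        u l * (r l * (r 0 * if P 0 then 1 else -1)) := by ring
      rw [e]; positivity
    · have := hP' l hp
      simp only [hp, if_false] at h
      have e : r l * u l * (r 0 * if P 0 then 1 else -1) =
        (- u l) * (r l * -1 * (r 0 * if P 0 then 1 else -1)) := by ring
      rw [e]
      exact mul_nonneg (by omega) h.le
  have hz := (Finset.sum_eq_zero_iff_of_nonneg hnn).1 (by rw [← Finset.sum_mul, hsum, zero_mul])
  intro l hl
  have h1 := hz l (Finset.mem_range.2 hl)
  have h2 : r 0 * ε 0 ≠ 0 := fun h => by have := hsign 0; rw [h] at this; simp at this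
  exact (mul_eq_zero.1 ((mul_eq_zero.1 h1).resolve_right h2)).resolve_left (hr0 l)

/-- The weight of position `i` in the checksum. -/
def weight (s K i : ℕ) : ℕ := ∑ l ∈ Finset.range (i + 1), ∑ j ∈ Finset.range (2 * s + 3), (l * K) ^ j

/-- The checksum of the first `n` entries of `c`. -/
def checksum (s K n : ℕ) (c : ℕ → ℕ) : ℕ := ∑ i ∈ Finset.range n, c i * weight s K i

/-- With `u l` the sum of `c i - c' i` over `i ≥ l`, the hypothesis `hF` reads `∑ j, K ^ j * ∑ l, l
^ j * u l = 0`. As `|u l| ≤ n`, each inner sum is at most `n ^ (2 * s + 4) < K` in absolute value,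
so all these moments vanish, and it remains to count sign changes of `u`. -/
theorem eq_of_skip_of_sum_eq_aux (s n K : ℕ) (hK : n ^ (2 * s + 4) < K) (c c' : ℕ → ℤ)
    (h0 : ∀ i, 0 ≤ c i) (h1 : ∀ i, c i ≤ 1) (h0' : ∀ i, 0 ≤ c' i) (h1' : ∀ i, c' i ≤ 1)
    (d p : ℕ) (hdp : d ≤ p) (hp : p < n) (M : Finset ℕ) (hM : M.card ≤ 2 * s)
    (h : ∀ j, j + 1 < n → j ∉ M → c' (skip p j) = c (skip d j))
    (hF : ∑ i ∈ Finset.range n, (c i - c' i) * weight s K i = 0) :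
    ∀ i < n, c i = c' i := by
  classical
  let u : ℕ → ℤ := fun l => ∑ i ∈ Finset.Ico l n, (c i - c' i)
  have hstep : ∀ l < n, u l = c l - c' l + u (l + 1) := fun l hl =>
    Finset.sum_eq_sum_Ico_succ_bot hl _
  have hend : ∀ l, n ≤ l → u l = 0 := fun l hl => by simp [u, Finset.Ico_eq_empty_of_le hl]
  have hub : ∀ l, |u l| ≤ n := by
    intro l
    refine (Finset.abs_sum_le_sum_abs _ _).trans ?_
    refine (Finset.sum_le_sum (g := fun _ => (1 : ℤ)) fun i _ => ?_).trans ?_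
    · have := h0 i; have := h1 i; have := h0' i; have := h1' i
      rw [abs_le]; constructor <;> omega
    · simp
  have hmom : ∀ j < 2 * s + 3, ∑ l ∈ Finset.range n, (l : ℤ) ^ j * u l = 0 := by
    refine eq_zero_of_sum_pow_mul_eq_zero K _ _ (fun j hj => ?_) ?_
    · have hb : ∀ l ∈ Finset.range n, |(l : ℤ) ^ j * u l| ≤ (n : ℤ) ^ (2 * s + 2) * n := by
        intro l hl
        rw [Finset.mem_range] at hl
        rw [abs_mul, abs_of_nonneg (by positivity)]
        have : (l : ℤ) ^ j ≤ (n : ℤ) ^ (2 * s + 2) := by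
          calc (l : ℤ) ^ j ≤ (n : ℤ) ^ j := by gcongr
            _ ≤ _ := pow_le_pow_right₀ (by omega) (by omega)
        exact mul_le_mul this (hub l) (abs_nonneg _) (by positivity)
      refine ((Finset.abs_sum_le_sum_abs _ _).trans (Finset.sum_le_sum hb)).trans_lt ?_
      simp only [Finset.sum_const, Finset.card_range, nsmul_eq_mul]
      calc (n : ℤ) * ((n : ℤ) ^ (2 * s + 2) * n) = ((n ^ (2 * s + 4) : ℕ) : ℤ) := by push_cast; ring
        _ < K := by exact_mod_cast hK
    · rw [← hF]
      simp only [weight, Finset.mul_sum, Nat.cast_sum]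
      rw [Finset.sum_comm]
      have e : ∀ i ∈ Finset.range n, ∑ l ∈ Finset.range (i + 1), ∑ j ∈ Finset.range (2 * s + 3),
          (c i - c' i) * (((l * K) ^ j : ℕ) : ℤ) = ∑ l ∈ Finset.range n,
          if l ≤ i then ∑ j ∈ Finset.range (2 * s + 3), (c i - c' i) * (((l * K) ^ j : ℕ) : ℤ)
          else 0 := by
        intro i hi
        rw [Finset.mem_range] at hi
        rw [← Finset.sum_filter]
        congr 1
        ext l; simp; omega
      rw [Finset.sum_congr rfl e]
      conv_rhs => rw [Finset.sum_comm]
      refine Finset.sum_congr rfl fun l _ => ?_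
      rw [← Finset.sum_filter]
      conv_rhs => rw [Finset.sum_comm]
      refine Finset.sum_congr rfl fun j _ => ?_
      have : (Finset.range n).filter (fun i => l ≤ i) = Finset.Ico l n := by ext; simp; omega
      rw [this, ← Finset.sum_mul]
      push_cast
      simp only [u]
      ring
  -- Away from substitutions `c' l = c (l + 1)` for `d < l < p`, hence `u l - c l` is constant
  -- there, while `u` itself is constant outside. As `c l` is `0` or `1`, `V l ≥ 0` gives `u l ≥ 0`,
  -- and `V l ≤ -1` gives `u l ≤ 0`.
  let V : ℕ → ℤ := fun l => u l - if d < l ∧ l ≤ p then c l else 0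
  have hu : ∀ l < n, u l = 0 := by
    -- `V` can change only at `d`, at `p` and at the at most `2 * s` substituted places, seen in the
    -- numbering of `c'`.
    refine eq_zero_of_moments n (2 * s + 2) u (fun l => 0 ≤ V l) (insert d (insert p (M.image (skip p))))
      ?_ (fun l hl => ?_) (fun l hl => ?_) (fun l hl => ?_) hmom
    · have e1 := Finset.card_insert_le d (insert p (M.image (skip p)))
      have e2 := Finset.card_insert_le p (M.image (skip p))
      have e3 := Finset.card_image_le (s := M) (f := skip p)
      omega
    · simp only [V] at hl
      have := h0 l
      split_ifs at hl <;> omega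
    · simp only [V] at hl
      have := h1 l
      split_ifs at hl <;> omega
    · suffices V l = V (l + 1) by rw [this]
      simp only [Finset.mem_insert, Finset.mem_image, not_or, not_exists, not_and] at hl
      obtain ⟨l1, l2, l3⟩ := hl
      simp only [V]
      rcases le_or_gt n l with hn | hn
      · rw [hend l hn, hend (l + 1) (by omega), if_neg (by omega), if_neg (by omega)]
      rw [hstep l hn]
      rcases lt_trichotomy l p with hlp | hlp | hlp
      · have hlM : l ∉ M := fun hm => l3 l hm (by simp [skip, hlp])
        have := h l (by omega) hlM
        rcases lt_trichotomy l d with hld | hld | hld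
        · simp only [skip, hlp, hld, if_true] at this
          rw [if_neg (by omega), if_neg (by omega), this]; ring
        · exact absurd hld l1
        · simp only [skip, hlp, if_true, if_neg (show ¬ l < d by omega)] at this
          rw [if_pos (by omega), if_pos (by omega), this]; ring
      · exact absurd hlp l2
      · obtain ⟨j, rfl⟩ : ∃ j, l = j + 1 := ⟨l - 1, by omega⟩
        have hlM : j ∉ M := fun hm => l3 j hm (by simp [skip]; omega)
        have := h j (by omega) hlM
        simp only [skip, if_neg (show ¬ j < p by omega), if_neg (show ¬ j < d by omega)] at this
        rw [if_neg (by omega), if_neg (by omega), this]; ring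
  intro i hi
  have e1 := hu i hi
  have e2 : u (i + 1) = 0 := by
    rcases lt_or_ge (i + 1) n with h | h
    · exact hu _ h
    · exact hend _ h
  have := hstep i hi
  omega

/-- Two words with the same checksum that agree, up to at most `2 * s` substitutions, after one
deletion each, are equal. -/
theorem eq_of_skip_of_checksum_eq (s n K : ℕ) (hK : n ^ (2 * s + 4) < K) (c c' : ℕ → ℕ)
    (h1 : ∀ i, c i ≤ 1) (h1' : ∀ i, c' i ≤ 1)
    (d p : ℕ) (hd : d < n) (hp : p < n) (M : Finset ℕ) (hM : M.card ≤ 2 * s)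
    (h : ∀ j, j + 1 < n → j ∉ M → c' (skip p j) = c (skip d j))
    (hF : checksum s K n c = checksum s K n c') : ∀ i < n, c i = c' i := by
  have hF' : ∑ i ∈ Finset.range n, (((c i : ℤ)) - c' i) * weight s K i = 0 := by
    simp only [sub_mul, Finset.sum_sub_distrib, sub_eq_zero]
    exact_mod_cast hF
  have hF'' : ∑ i ∈ Finset.range n, (((c' i : ℤ)) - c i) * weight s K i = 0 := by
    rw [← neg_eq_zero, ← Finset.sum_neg_distrib, ← hF']
    exact Finset.sum_congr rfl fun i _ => by ring
  intro i hi
  rcases le_total d p with hdp | hdp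
  · have := eq_of_skip_of_sum_eq_aux s n K hK (fun i => c i) (fun i => c' i) (by simp)
      (fun i => by simpa using h1 i) (by simp) (fun i => by simpa using h1' i) d p hdp hp M hM
      (fun j h2 h3 => by simpa using h j h2 h3) hF' i hi
    simpa using this
  · have := eq_of_skip_of_sum_eq_aux s n K hK (fun i => c' i) (fun i => c i) (by simp)
      (fun i => by simpa using h1' i) (by simp) (fun i => by simpa using h1 i) p d hdp hd M hM
      (fun j h2 h3 => by simpa using (h j h2 h3).symm) hF'' i hi
    simpa using this.symm

/-! ### Syndromes of the BCH code in binary arithmetic -/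

open WordRAM

/-- One step of the shift register that multiplies by `X` modulo the polynomial with code `g`. -/
def shiftStep (m g p : ℕ) : ℕ := if p + p < 2 ^ m then p + p else (p + p) ^^^ g

/-- The code of `X ^ i` modulo the polynomial with code `g`. -/
def powCode (m g i : ℕ) : ℕ := iter (fun _ p => shiftStep m g p) 1 i

/-- The code of column `i` of the parity check matrix. -/
def colCode (s m g i : ℕ) : ℕ :=
  iter (fun j x => x ^^^ (powCode m g (i * (j + 1)) <<< (m * j))) 0 (2 * s)

/-- The syndrome of the word `z`, with the columns `C`. -/
def syndrome (n : ℕ) (C z : ℕ → ℕ) : ℕ := iter (fun i x => if z i = 0 then x else x ^^^ C i) 0 n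

theorem testBit_sum_two_pow (f : ℕ → ℕ) (hf : ∀ i, f i ≤ 1) (N : ℕ) :
    ∑ i ∈ Finset.range N, f i * 2 ^ i < 2 ^ N ∧
      ∀ j, (∑ i ∈ Finset.range N, f i * 2 ^ i).testBit j = decide (j < N ∧ f j = 1) := by
  induction N with
  | zero => simp
  | succ N ih =>
    obtain ⟨h1, h2⟩ := ih
    rw [Finset.sum_range_succ]
    constructor
    · have := hf N
      have : f N * 2 ^ N ≤ 1 * 2 ^ N := Nat.mul_le_mul_right _ this
      rw [pow_succ]; omega
    · intro j
      rw [add_comm, mul_comm, Nat.testBit_two_pow_mul_add _ h1, h2]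
      by_cases hj : j < N
      · simp [hj, show j < N + 1 by omega]
      · have h3 := hf N
        rw [if_neg hj]
        obtain rfl | hj' := Nat.eq_or_lt_of_not_lt hj
        · have : f j = 0 ∨ f j = 1 := by omega
          rcases this with h | h <;> simp [h]
        · have h4 : f N < 2 ^ (j - N) :=
            lt_of_le_of_lt h3 (Nat.one_lt_two_pow (by omega))
          rw [Nat.testBit_lt_two_pow h4]
          simp; omega

theorem colCode_lt_of (s m g : ℕ) (hp : ∀ i, powCode m g i < 2 ^ m) (i : ℕ) :
    colCode s m g i < 2 ^ (m * (2 * s)) := by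
  have : ∀ k ≤ 2 * s, iter (fun j x => x ^^^ (powCode m g (i * (j + 1)) <<< (m * j))) 0 k
      < 2 ^ (m * (2 * s)) := by
    intro k
    induction k with
    | zero => intro _; simp [iter]
    | succ k ih =>
      intro hk
      refine Nat.xor_lt_two_pow (ih (by omega)) ?_
      rw [Nat.shiftLeft_eq]
      calc powCode m g (i * (k + 1)) * 2 ^ (m * k) < 2 ^ m * 2 ^ (m * k) :=
            Nat.mul_lt_mul_of_pos_right (hp _) (by positivity)
        _ = 2 ^ (m * (k + 1)) := by rw [← pow_add]; congr 1; ring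
        _ ≤ _ := Nat.pow_le_pow_right (by omega) (Nat.mul_le_mul_left _ hk)
  exact this _ le_rfl

section field

variable {m : ℕ} (α : GaloisField 2 m)

/-- The value at `α` of the bits of `a` from position `b` to position `b + N - 1`. -/
noncomputable def bitEval (N b a : ℕ) : GaloisField 2 m :=
  ∑ i ∈ Finset.range N, if a.testBit (b + i) then α ^ i else 0

theorem bitEval_zero (N b : ℕ) : bitEval α N b 0 = 0 := by simp [bitEval]

theorem bitEval_xor (N b x y : ℕ) :
    bitEval α N b (x ^^^ y) = bitEval α N b x + bitEval α N b y := by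
  simp only [bitEval, ← Finset.sum_add_distrib]
  refine Finset.sum_congr rfl fun i _ => ?_
  rw [Nat.testBit_xor]
  cases x.testBit (b + i) <;> cases y.testBit (b + i) <;> simp [CharTwo.add_self_eq_zero]

theorem bitEval_shiftLeft {N j j' x : ℕ} (hx : x < 2 ^ N) :
    bitEval α N (N * j) (x <<< (N * j')) = if j = j' then bitEval α N 0 x else 0 := by
  split_ifs with h
  · subst h
    simp only [bitEval, Nat.testBit_shiftLeft]
    simp
  · refine Finset.sum_eq_zero fun i hi => if_neg ?_
    rw [Finset.mem_range] at hi
    rw [Nat.testBit_shiftLeft]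
    rcases lt_or_gt_of_ne h with h | h
    · have : N * j + N ≤ N * j' := by
        rw [← Nat.mul_succ]; exact Nat.mul_le_mul_left _ h
      simp; omega
    · have : N * j' + N ≤ N * j := by
        rw [← Nat.mul_succ]; exact Nat.mul_le_mul_left _ h
      rw [Nat.testBit_lt_two_pow (hx.trans_le (Nat.pow_le_pow_right (by omega) (by omega)))]
      simp

variable (hm : 0 < m) (hα : orderOf α = 2 ^ m - 1)
include hm hα

theorem primitive_ne_zero : α ≠ 0 := by
  rintro rfl
  have : 2 ^ m - 1 = 0 := by rw [← hα]; simp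
  have := Nat.one_lt_two_pow hm.ne'
  omega

theorem exists_pow_of_primitive (x : GaloisField 2 m) (hx : x ≠ 0) : ∃ i : ℕ, α ^ i = x := by
  have : Finite (GaloisField 2 m) := inferInstance
  have hc := GaloisField.card 2 m hm.ne'
  let u := Units.mk0 α (primitive_ne_zero α hm hα)
  have hu : orderOf u = Nat.card (GaloisField 2 m)ˣ := by
    rw [Nat.card_units, hc, ← hα, ← orderOf_units]; rfl
  have hz : Units.mk0 x hx ∈ Submonoid.powers u := by
    rw [mem_powers_iff_mem_zpowers, Subgroup.eq_top_of_card_eq (Subgroup.zpowers u)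
      (by rw [Nat.card_zpowers, hu])]
    trivial
  obtain ⟨i, hi⟩ := hz
  exact ⟨i, by simpa [u] using congrArg Units.val hi⟩

/-- Every nonzero element is a power of `α`, so `α` generates the field over its prime field. -/
theorem natDegree_minpoly_of_primitive : (minpoly (ZMod 2) α).natDegree = m := by
  rw [(Field.primitive_element_iff_minpoly_natDegree_eq (ZMod 2) α).1, GaloisField.finrank 2 hm.ne']
  rw [eq_top_iff]
  intro x _
  by_cases hx : x = 0
  · rw [hx]; exact zero_mem _
  · obtain ⟨i, rfl⟩ := exists_pow_of_primitive α hm hα x hx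
    exact pow_mem (IntermediateField.mem_adjoin_simple_self _ _) _

/-- The code of the minimal polynomial. -/
theorem minpoly_code :
    (∑ i ∈ Finset.range (m + 1), ((minpoly (ZMod 2) α).coeff i).val * 2 ^ i) < 2 ^ (m + 1) ∧
    (∑ i ∈ Finset.range (m + 1), ((minpoly (ZMod 2) α).coeff i).val * 2 ^ i).testBit m = true ∧
    bitEval α (m + 1) 0 (∑ i ∈ Finset.range (m + 1), ((minpoly (ZMod 2) α).coeff i).val * 2 ^ i)
      = 0 := by
  have hf : ∀ i, ((minpoly (ZMod 2) α).coeff i).val ≤ 1 := fun i =>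
    Nat.lt_succ_iff.1 (ZMod.val_lt _)
  obtain ⟨h1, h2⟩ := testBit_sum_two_pow _ hf (m + 1)
  have hd := natDegree_minpoly_of_primitive α hm hα
  have hint : IsIntegral (ZMod 2) α := IsIntegral.of_finite _ _
  refine ⟨h1, ?_, ?_⟩
  · have : (minpoly (ZMod 2) α).coeff m = 1 := by
      have := minpoly.monic hint
      rwa [Polynomial.Monic, Polynomial.leadingCoeff, hd] at this
    rw [h2, this]
    simp
    rfl
  · have h3 := minpoly.aeval (ZMod 2) α
    rw [Polynomial.aeval_eq_sum_range, hd] at h3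
    rw [← h3, bitEval]
    refine Finset.sum_congr rfl fun i hi => ?_
    rw [zero_add, h2]
    have : ∀ a : ZMod 2, a = 0 ∨ a = 1 := by decide
    have e1 : (1 : ZMod 2).val = 1 := rfl
    rw [Finset.mem_range] at hi
    rcases this ((minpoly (ZMod 2) α).coeff i) with h | h <;> simp [h, hi, e1]

variable {g : ℕ} (hg : g < 2 ^ (m + 1)) (hgm : g.testBit m = true)
  (hg0 : bitEval α (m + 1) 0 g = 0)

-- Doubling a code multiplies the polynomial by `X`. If bit `m` appears, adding `g` removes it
-- without changing the value at `α`, where the polynomial of `g` vanishes.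
omit hm hα in
include hg hgm hg0 in
theorem shiftStep_spec {p : ℕ} (hp : p < 2 ^ m) :
    shiftStep m g p < 2 ^ m ∧ bitEval α m 0 (shiftStep m g p) = α * bitEval α m 0 p := by
  have hdouble : bitEval α (m + 1) 0 (p + p) = α * bitEval α m 0 p := by
    rw [bitEval, Finset.sum_range_succ', bitEval, Finset.mul_sum]
    have e : p + p = 2 * p := by ring
    have : (p + p).testBit 0 = false := by rw [e, Nat.testBit_zero]; simp
    simp only [zero_add, this]
    rw [add_eq_left.2 (by simp)]
    refine Finset.sum_congr rfl fun i _ => ?_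
    have : (p + p).testBit (i + 1) = p.testBit i := by
      rw [e, Nat.testBit_succ]; simp
    rw [this]
    split_ifs <;> ring
  have hrestrict : ∀ x, x < 2 ^ m → bitEval α (m + 1) 0 x = bitEval α m 0 x := by
    intro x hx
    rw [bitEval, Finset.sum_range_succ, bitEval, zero_add, Nat.testBit_lt_two_pow hx]
    simp
  unfold shiftStep
  split_ifs with h
  · exact ⟨h, by rw [← hrestrict _ h, hdouble]⟩
  · have h2 : p + p < 2 ^ (m + 1) := by rw [pow_succ]; omega
    have h3 : (p + p) ^^^ g < 2 ^ m := by
      refine Nat.lt_pow_two_of_testBit _ fun i hi => ?_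
      rw [Nat.testBit_xor]
      rcases Nat.eq_or_lt_of_le hi with rfl | hi
      · have : (p + p).testBit m = true := by
          obtain ⟨r, hr⟩ := Nat.exists_eq_add_of_le (not_lt.1 h)
          have hr' : r < 2 ^ m := by rw [pow_succ] at h2; omega
          have := Nat.testBit_two_pow_mul_add 1 hr' m
          rw [mul_one] at this
          rw [hr, this]; simp
        rw [this, hgm]; rfl
      · have : 2 ^ (m + 1) ≤ 2 ^ i := Nat.pow_le_pow_right (by omega) hi
        rw [Nat.testBit_lt_two_pow (h2.trans_le this), Nat.testBit_lt_two_pow (hg.trans_le this)]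
        rfl
    exact ⟨h3, by rw [← hrestrict _ h3, bitEval_xor, hdouble, hg0, add_zero]⟩

omit hα in
include hg hgm hg0 in
theorem powCode_spec (i : ℕ) :
    powCode m g i < 2 ^ m ∧ bitEval α m 0 (powCode m g i) = α ^ i := by
  induction i with
  | zero =>
    refine ⟨Nat.one_lt_two_pow hm.ne', ?_⟩
    obtain ⟨m', rfl⟩ : ∃ m', m = m' + 1 := ⟨m - 1, by omega⟩
    rw [powCode, iter, bitEval, Finset.sum_range_succ']
    simp [Nat.testBit_one_eq_true_iff_self_eq_zero]
  | succ i ih =>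
    obtain ⟨h1, h2⟩ := shiftStep_spec α hg hgm hg0 ih.1
    exact ⟨h1, by rw [pow_succ', ← ih.2, ← h2]; rfl⟩

-- Codes below `2 ^ m` reach every field element, as the nonzero ones are powers of `α`. Both sets
-- have `2 ^ m` elements, so evaluation at `α` is injective as well.
include hg hgm hg0 in
theorem bitEval_eq_zero {x : ℕ} (hx : x < 2 ^ m) (h : bitEval α m 0 x = 0) : x = 0 := by
  have : Finite (GaloisField 2 m) := inferInstance
  let f : Fin (2 ^ m) → GaloisField 2 m := fun x => bitEval α m 0 x
  have hs : Function.Surjective f := by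
    intro y
    by_cases hy : y = 0
    · exact ⟨⟨0, by positivity⟩, by simp [f, hy, bitEval_zero]⟩
    · obtain ⟨i, rfl⟩ := exists_pow_of_primitive α hm hα y hy
      obtain ⟨h1, h2⟩ := powCode_spec α hm hg hgm hg0 i
      exact ⟨⟨_, h1⟩, h2⟩
  have hb := (Nat.bijective_iff_surjective_and_card f).2 ⟨hs, by
    rw [GaloisField.card 2 m hm.ne', Nat.card_eq_fintype_card, Fintype.card_fin]⟩
  have := @hb.1 ⟨x, hx⟩ ⟨0, by positivity⟩ (by simp only [f, h, bitEval_zero])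
  simpa using this

omit hα in
include hg hgm hg0 in
theorem colCode_spec (s i : ℕ) :
    colCode s m g i < 2 ^ (m * (2 * s)) ∧
      ∀ j < 2 * s, bitEval α m (m * j) (colCode s m g i) = α ^ (i * (j + 1)) := by
  refine ⟨colCode_lt_of s m g (fun i => (powCode_spec α hm hg hgm hg0 i).1) i, ?_⟩
  have : ∀ k j, bitEval α m (m * j)
      (iter (fun j x => x ^^^ (powCode m g (i * (j + 1)) <<< (m * j))) 0 k) =
      if j < k then α ^ (i * (j + 1)) else 0 := by
    intro k
    induction k with
    | zero => intro j; simp [iter, bitEval_zero]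
    | succ k ih =>
      intro j
      obtain ⟨h1, h2⟩ := powCode_spec α hm hg hgm hg0 (i * (k + 1))
      rw [iter, bitEval_xor, ih, bitEval_shiftLeft α h1, h2]
      rcases lt_trichotomy j k with h | h | h
      · simp [h, h.ne, show j < k + 1 by omega]
      · simp [h]
      · simp [h.ne', show ¬ j < k by omega, show ¬ j < k + 1 by omega]
  intro j hj
  rw [colCode, this, if_pos hj]

-- Block `j` of `m` bits of the syndrome is the code of the `j`-th power sum. A number below `2 ^ (m
-- * (2 * s))` is zero if and only if all its blocks are, and `bitEval_eq_zero` decides this for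
-- each block.
include hg hgm hg0 in
theorem syndrome_eq_zero_iff (s n : ℕ) (C z : ℕ → ℕ) (hC : ∀ i < n, C i = colCode s m g i) :
    syndrome n C z = 0 ↔
      ∀ j < 2 * s, ∑ i ∈ Finset.range n, (if z i = 0 then 0 else α ^ (i * (j + 1))) = 0 := by
  have key : ∀ k ≤ n, iter (fun i x => if z i = 0 then x else x ^^^ C i) 0 k < 2 ^ (m * (2 * s)) ∧
      ∀ j < 2 * s, bitEval α m (m * j) (iter (fun i x => if z i = 0 then x else x ^^^ C i) 0 k) =
        ∑ i ∈ Finset.range k, (if z i = 0 then 0 else α ^ (i * (j + 1))) := by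
    intro k
    induction k with
    | zero => intro _; simp [iter, bitEval_zero]
    | succ k ih =>
      intro hk
      obtain ⟨h1, h2⟩ := ih (by omega)
      obtain ⟨h3, h4⟩ := colCode_spec α hm hg hgm hg0 s k
      rw [iter]
      split_ifs with h
      · refine ⟨h1, fun j hj => ?_⟩
        rw [Finset.sum_range_succ, if_pos h, add_zero, h2 j hj]
      · rw [hC k (by omega)]
        refine ⟨Nat.xor_lt_two_pow h1 h3, fun j hj => ?_⟩
        rw [Finset.sum_range_succ, if_neg h, bitEval_xor, h2 j hj, h4 j hj]
  obtain ⟨h1, h2⟩ := key n le_rfl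
  constructor
  · intro h j hj
    rw [← h2 j hj]
    change bitEval α m (m * j) (syndrome n C z) = 0
    rw [h, bitEval_zero]
  · intro h
    refine Nat.eq_of_testBit_eq fun b => ?_
    rw [Nat.zero_testBit]
    rcases lt_or_ge b (m * (2 * s)) with hb | hb
    · have hj : b / m < 2 * s := Nat.div_lt_of_lt_mul hb
      have h3 := (h2 _ hj).trans (h _ hj)
      have h4 : bitEval α m 0 ((syndrome n C z >>> (m * (b / m))) % 2 ^ m) = 0 := by
        rw [← h3, bitEval, bitEval]
        refine Finset.sum_congr rfl fun i hi => ?_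
        rw [Nat.testBit_mod_two_pow, Nat.testBit_shiftRight, zero_add]
        simp only [Finset.mem_range.1 hi, decide_true, Bool.true_and]
        rfl
      have h5 := bitEval_eq_zero α hm hα hg hgm hg0 (Nat.mod_lt _ (by positivity)) h4
      have h6 : ((syndrome n C z >>> (m * (b / m))) % 2 ^ m).testBit (b % m) = false := by
        rw [h5, Nat.zero_testBit]
      rw [Nat.testBit_mod_two_pow, Nat.testBit_shiftRight, Nat.div_add_mod] at h6
      simpa [Nat.mod_lt _ hm] using h6
    · exact Nat.testBit_lt_two_pow (h1.trans_le (Nat.pow_le_pow_right (by omega) hb))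

/-- The BCH bound. -/
theorem card_of_power_sums (s : ℕ) (P : Finset ℕ) (hP : P.card ≤ 2 * s)
    (hPn : ∀ i ∈ P, i < 2 ^ m - 1) (h : ∀ j < 2 * s, ∑ i ∈ P, α ^ (i * (j + 1)) = 0) : P = ∅ := by
  classical
  by_contra hne
  obtain ⟨i₀, hi₀⟩ := Finset.nonempty_iff_ne_empty.2 hne
  -- `q` vanishes at `α ^ i` for all `i ∈ P` but `i₀`. Its degree is below `2 * s`, so `∑ α ^ i * q
  -- (α ^ i)` is a combination of the given power sums and vanishes; yet its only remaining term is
  -- nonzero because the powers `α ^ i` are distinct.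
  let q : Polynomial (GaloisField 2 m) :=
    ∏ i ∈ P.erase i₀, (Polynomial.X - Polynomial.C (α ^ i))
  have hdeg : q.natDegree < 2 * s := by
    rw [Polynomial.natDegree_prod_of_monic _ _ fun i _ => Polynomial.monic_X_sub_C _]
    simp only [Polynomial.natDegree_X_sub_C, Finset.sum_const, smul_eq_mul, mul_one]
    have := Finset.card_erase_lt_of_mem hi₀
    omega
  have hsum : ∑ i ∈ P, α ^ i * q.eval (α ^ i) = 0 := by
    simp only [Polynomial.eval_eq_sum_range' hdeg, Finset.mul_sum]
    rw [Finset.sum_comm]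
    refine Finset.sum_eq_zero fun j hj => ?_
    have : ∀ i ∈ P, α ^ i * (q.coeff j * (α ^ i) ^ j) = q.coeff j * α ^ (i * (j + 1)) := by
      intro i _
      rw [mul_add, pow_add, pow_mul]; ring
    rw [Finset.sum_congr rfl this, ← Finset.mul_sum, h j (Finset.mem_range.1 hj), mul_zero]
  have hother : ∀ i ∈ P, i ≠ i₀ → α ^ i * q.eval (α ^ i) = 0 := by
    intro i hi hne
    rw [Polynomial.eval_prod, Finset.prod_eq_zero (Finset.mem_erase.2 ⟨hne, hi⟩) (by simp), mul_zero]
  rw [Finset.sum_eq_single i₀ hother (fun h => absurd hi₀ h)] at hsum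
  have hα0 := primitive_ne_zero α hm hα
  have h1 := (mul_eq_zero.1 hsum).resolve_left (pow_ne_zero _ hα0)
  rw [Polynomial.eval_prod, Finset.prod_eq_zero_iff] at h1
  obtain ⟨i, hi, h2⟩ := h1
  simp only [Polynomial.eval_sub, Polynomial.eval_X, Polynomial.eval_C, sub_eq_zero] at h2
  have h3 := pow_injOn_Iio_orderOf (x := α) (by simpa [hα] using hPn _ hi₀)
    (by simpa [hα] using hPn _ (Finset.mem_of_mem_erase hi)) h2
  exact (Finset.ne_of_mem_erase hi) h3.symm

end field

/-! ### Substitution patterns and the correction of an insertion -/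

/-- Digit `l` of `e` in base `n + 1`. -/
def digit (n e l : ℕ) : ℕ := e / (n + 1) ^ l % (n + 1)

/-- Whether the pattern with code `e` changes position `i`: the digits of `e` are the positions to
change, and `n` stands for no change. -/
def toggle (s n e i : ℕ) : ℕ := iter (fun l x => x ^^^ if digit n e l = i then 1 else 0) 0 s

/-- The syndrome of the pattern with code `e`. -/
def patSyndrome (s n : ℕ) (C : ℕ → ℕ) (e : ℕ) : ℕ := iter (fun l x => x ^^^ C (digit n e l)) 0 s

/-- Symbol `j` of `x` after the deletion of position `d` and the substitutions of `e`. -/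
def delBit (s n : ℕ) (x : ℕ → ℕ) (d e j : ℕ) : ℕ := x (skip d j) ^^^ toggle s n e j

/-- Symbol `i` of `y` after the insertion of `b` at position `p`. -/
def insBit (y : ℕ → ℕ) (p b i : ℕ) : ℕ := if i < p then y i else if i = p then b else y (i - 1)

/-- One more than the last `k < N` with `h k = S`, or `0`. -/
def lookup (h : ℕ → ℕ) (S : ℕ) : ℕ → ℕ
  | 0 => 0
  | N + 1 => if h N = S then N + 1 else lookup h S N

theorem lookup_spec (h : ℕ → ℕ) (S N : ℕ) (hN : lookup h S N ≠ 0) :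
    lookup h S N - 1 < N ∧ h (lookup h S N - 1) = S := by
  induction N with
  | zero => exact absurd rfl hN
  | succ N ih =>
    rw [lookup] at hN ⊢
    split_ifs at hN ⊢ with h1
    · exact ⟨by omega, h1⟩
    · have := ih hN
      exact ⟨by omega, this.2⟩

theorem lookup_ne_zero (h : ℕ → ℕ) (S N k : ℕ) (hk : k < N) (hS : h k = S) : lookup h S N ≠ 0 := by
  induction N with
  | zero => omega
  | succ N ih =>
    rw [lookup]
    split_ifs with h1
    · omega
    · refine ih ?_
      rcases Nat.lt_succ_iff_lt_or_eq.1 hk with h | h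
      · exact h
      · exact absurd (h ▸ hS) h1

theorem xor_le_one {a b : ℕ} (ha : a ≤ 1) (hb : b ≤ 1) : a ^^^ b ≤ 1 := by
  interval_cases a <;> interval_cases b <;> decide

theorem xor_one_of_ne {a b : ℕ} (ha : a ≤ 1) (hb : b ≤ 1) (h : a ≠ b) : a ^^^ 1 = b := by
  interval_cases a <;> interval_cases b <;> simp at h ⊢

theorem digit_le (n e l : ℕ) : digit n e l ≤ n := Nat.lt_succ_iff.1 (Nat.mod_lt _ (by omega))

theorem digit_zero (n a e : ℕ) (ha : a ≤ n) : digit n (a + (n + 1) * e) 0 = a := by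
  simp [digit]; omega

theorem digit_succ (n a e l : ℕ) (ha : a ≤ n) :
    digit n (a + (n + 1) * e) (l + 1) = digit n e l := by
  rw [digit, pow_succ', ← Nat.div_div_eq_div_mul, Nat.add_mul_div_left _ _ (by omega),
    Nat.div_eq_of_lt (show a < n + 1 by omega), zero_add, digit]

theorem exists_code (n s : ℕ) : ∀ d : ℕ → ℕ, (∀ l, d l ≤ n) →
    ∃ e < (n + 1) ^ s, ∀ l < s, digit n e l = d l := by
  induction s with
  | zero => intro d _; exact ⟨0, by simp, by simp⟩
  | succ s ih =>
    intro d hd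
    obtain ⟨e, he, h⟩ := ih (fun l => d (l + 1)) (fun l => hd _)
    refine ⟨d 0 + (n + 1) * e, ?_, fun l hl => ?_⟩
    · have := hd 0
      have := Nat.mul_le_mul_left (n + 1) (Nat.succ_le_of_lt he)
      rw [pow_succ', Nat.succ_eq_add_one, mul_add] at *
      omega
    · cases l with
      | zero => exact digit_zero n _ _ (hd 0)
      | succ l => rw [digit_succ _ _ _ _ (hd 0), h l (by omega)]

/-- This is a code of the empty pattern; with it the decoder treats the received word as a special
case of `delBit`. -/
theorem digit_pred_pow (n s l : ℕ) (hl : l < s) : digit n ((n + 1) ^ s - 1) l = n := by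
  induction s generalizing l with
  | zero => omega
  | succ s ih =>
    have e : (n + 1) ^ (s + 1) - 1 = n + (n + 1) * ((n + 1) ^ s - 1) := by
      have : 0 < (n + 1) ^ s := by positivity
      rw [pow_succ', Nat.mul_sub, mul_one]
      have := Nat.mul_le_mul_left (n + 1) this
      omega
    rw [e]
    cases l with
    | zero => exact digit_zero n _ _ le_rfl
    | succ l => rw [digit_succ _ _ _ _ le_rfl, ih l (by omega)]

theorem iter_xor_le_one (f : ℕ → ℕ) (hf : ∀ l, f l ≤ 1) (s : ℕ) :
    iter (fun l x => x ^^^ f l) 0 s ≤ 1 := by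
  induction s with
  | zero => simp [iter]
  | succ s ih => exact xor_le_one ih (hf _)

theorem toggle_le_one (s n e i : ℕ) : toggle s n e i ≤ 1 :=
  iter_xor_le_one _ (fun l => by split_ifs <;> simp) s

theorem iter_xor_eq_zero (f : ℕ → ℕ) (s : ℕ) (hf : ∀ l < s, f l = 0) :
    iter (fun l x => x ^^^ f l) 0 s = 0 := by
  induction s with
  | zero => rfl
  | succ s ih => rw [iter, ih fun l hl => hf l (by omega), hf s (by omega)]; rfl

theorem toggle_pred_pow (s n i : ℕ) (hi : i < n) : toggle s n ((n + 1) ^ s - 1) i = 0 :=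
  iter_xor_eq_zero _ _ fun l hl => by rw [digit_pred_pow n s l hl, if_neg (by omega)]

theorem exists_of_toggle_ne_zero {s n e i : ℕ} (h : toggle s n e i ≠ 0) :
    i ∈ (Finset.range s).image (digit n e) := by
  by_contra hne
  simp only [Finset.mem_image, Finset.mem_range, not_exists, not_and] at hne
  exact h (iter_xor_eq_zero _ _ fun l hl => by rw [if_neg (hne l hl)])

theorem card_digits_le (s n e : ℕ) : ((Finset.range s).image (digit n e)).card ≤ s := by
  simpa using Finset.card_image_le (s := Finset.range s) (f := digit n e)

theorem iter_congr {α : Type*} {f g : ℕ → α → α} {a : α} {N : ℕ}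
    (h : ∀ i < N, ∀ x, f i x = g i x) : iter f a N = iter g a N := by
  induction N with
  | zero => rfl
  | succ N ih => rw [iter, iter, ih fun i hi => h i (by omega), h N (by omega)]

/-- Equal digits below `n` cancel in pairs, so each position of `P` is listed once and spare digits
are set to `n`, the mark of no change. -/
theorem exists_toggle (s n : ℕ) (P : Finset ℕ) (hP : P.card ≤ s) :
    ∃ e < (n + 1) ^ s, ∀ i < n, toggle s n e i = if i ∈ P then 1 else 0 := by
  suffices H : ∀ k, ∀ P : Finset ℕ, P.card ≤ k → (∀ i ∈ P, i < n) → ∃ d : ℕ → ℕ, (∀ l, d l ≤ n) ∧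
      ∀ i < n, iter (fun l x => x ^^^ if d l = i then 1 else 0) 0 k = if i ∈ P then 1 else 0 by
    obtain ⟨d, hd, h⟩ := H s (P.filter (· < n)) ((Finset.card_filter_le _ _).trans hP) (by simp)
    obtain ⟨e, he, h'⟩ := exists_code n s d hd
    refine ⟨e, he, fun i hi => ?_⟩
    rw [toggle, iter_congr (g := fun l x => x ^^^ if d l = i then 1 else 0)
      fun l hl x => by rw [h' l hl], h i hi]
    simp [hi]
  intro k
  induction k with
  | zero =>
    intro P hP _
    refine ⟨fun _ => 0, by simp, fun i _ => ?_⟩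
    simp [Finset.card_eq_zero.1 (Nat.le_zero.1 hP), iter]
  | succ k ih =>
    intro P hP hPn
    rcases P.eq_empty_or_nonempty with rfl | ⟨a, ha⟩
    · refine ⟨fun _ => n, by simp, fun i hi => ?_⟩
      rw [iter_xor_eq_zero _ _ fun l _ => if_neg (show ¬ n = i by omega)]
      simp
    · obtain ⟨d, hd, h⟩ := ih (P.erase a) (by rw [Finset.card_erase_of_mem ha]; omega)
        (fun i hi => hPn i (Finset.mem_of_mem_erase hi))
      refine ⟨Function.update d k a, fun l => ?_, fun i hi => ?_⟩
      · rw [Function.update_apply]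
        split_ifs
        · exact (hPn a ha).le
        · exact hd l
      · rw [iter, iter_congr (g := fun l x => x ^^^ if d l = i then 1 else 0), h i hi]
        · by_cases hia : i = a
          · subst hia; simp [ha]
          · simp [hia, Ne.symm hia]
        · intro l hl x
          rw [Function.update_of_ne (by omega)]

theorem syndrome_xor (n : ℕ) (C z t : ℕ → ℕ) (hz : ∀ i, z i ≤ 1) (ht : ∀ i, t i ≤ 1) :
    syndrome n C (fun i => z i ^^^ t i) = syndrome n C z ^^^ syndrome n C t := by
  unfold syndrome
  induction n with
  | zero => simp [iter]
  | succ n ih =>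
    rw [iter, iter, iter, ih]
    beta_reduce
    have h1 := hz n
    have h2 := ht n
    generalize iter (fun i x => if z i = 0 then x else x ^^^ C i) 0 n = a
    generalize iter (fun i x => if t i = 0 then x else x ^^^ C i) 0 n = b
    have e1 : a ^^^ C n ^^^ b = a ^^^ b ^^^ C n := by
      rw [Nat.xor_assoc, Nat.xor_comm (C n), ← Nat.xor_assoc]
    generalize z n = u at *
    generalize t n = v at *
    have e2 : a ^^^ C n ^^^ (b ^^^ C n) = a ^^^ b := by
      rw [← Nat.xor_assoc, e1, Nat.xor_assoc (a ^^^ b)]; simp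
    interval_cases u <;> interval_cases v
    · simp
    · simp [Nat.xor_assoc]
    · simp [e1]
    · simp [e2]

theorem syndrome_congr {n : ℕ} {C z z' : ℕ → ℕ} (h : ∀ i < n, z i = z' i) :
    syndrome n C z = syndrome n C z' :=
  iter_congr fun i hi x => by rw [h i hi]

theorem syndrome_single (n : ℕ) (C : ℕ → ℕ) (hC : C n = 0) (a : ℕ) (ha : a ≤ n) :
    syndrome n C (fun i => if a = i then 1 else 0) = C a := by
  have key : ∀ k ≤ n, iter (fun i x => if (if a = i then 1 else 0) = 0 then x else x ^^^ C i) 0 k =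
      if a < k then C a else 0 := by
    intro k
    induction k with
    | zero => intro _; simp [iter]
    | succ k ih =>
      intro hk
      rw [iter, ih (by omega)]
      rcases lt_trichotomy a k with h | h | h
      · simp [h, h.ne, show a < k + 1 by omega]
      · simp [h]
      · simp [h.ne', show ¬ a < k by omega, show ¬ a < k + 1 by omega]
  rw [syndrome, key n le_rfl]
  rcases Nat.eq_or_lt_of_le ha with h | h
  · simp [h, hC]
  · simp [h]

/-- The syndrome of a pattern needs only `s` columns. The convention `C n = 0` makes the digit `n`
contribute nothing. -/
theorem patSyndrome_eq (s n : ℕ) (C : ℕ → ℕ) (hC : C n = 0) (e : ℕ) :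
    patSyndrome s n C e = syndrome n C (toggle s n e) := by
  unfold patSyndrome
  induction s with
  | zero =>
    refine (iter_xor_eq_zero (fun _ => 0) n (by simp)).symm.trans (iter_congr fun i _ x => ?_)
    simp [toggle, iter]
  | succ s ih =>
    have : toggle (s + 1) n e = fun i => toggle s n e i ^^^ if digit n e s = i then 1 else 0 := rfl
    rw [this, syndrome_xor _ _ _ _ (toggle_le_one s n e) (fun i => by split_ifs <;> simp), iter, ih,
      syndrome_single n C hC _ (digit_le n e s)]

theorem insBit_le_one {y : ℕ → ℕ} (hy : ∀ j, y j ≤ 1) {b : ℕ} (hb : b ≤ 1) (p i : ℕ) :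
    insBit y p b i ≤ 1 := by
  unfold insBit
  split_ifs
  · exact hy _
  · exact hb
  · exact hy _

theorem delBit_le_one {x : ℕ → ℕ} (hx : ∀ j, x j ≤ 1) (s n d e j : ℕ) : delBit s n x d e j ≤ 1 :=
  xor_le_one (hx _) (toggle_le_one _ _ _ _)

theorem insBit_skip (y : ℕ → ℕ) (p b j : ℕ) : insBit y p b (skip p j) = y j := by
  unfold insBit skip
  split_ifs <;> first | rfl | omega

theorem insBit_congr {y y' : ℕ → ℕ} {n p : ℕ} (hp : p < n) (h : ∀ j, j + 1 < n → y j = y' j)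
    (b : ℕ) : ∀ i < n, insBit y p b i = insBit y' p b i := by
  intro i hi
  unfold insBit
  split_ifs
  · exact h _ (by omega)
  · rfl
  · exact h _ (by omega)

/-- The word that the insertion of `b` at position `p` and the substitutions of pattern `e` make
from `y`. -/
def patched (s n : ℕ) (y : ℕ → ℕ) (p b e i : ℕ) : ℕ := insBit y p b i ^^^ toggle s n e i

/-- One more than the code of a pattern that makes the word from `y` a codeword, or `0`. -/
def findPattern (s n : ℕ) (C y : ℕ → ℕ) (p b : ℕ) : ℕ :=
  lookup (patSyndrome s n C) (syndrome n C (insBit y p b)) ((n + 1) ^ s)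

theorem findPattern_congr {s n : ℕ} {C y y' : ℕ → ℕ} {p : ℕ} (hp : p < n)
    (h : ∀ j, j + 1 < n → y j = y' j) (b : ℕ) :
    findPattern s n C y p b = findPattern s n C y' p b := by
  rw [findPattern, findPattern, syndrome_congr (insBit_congr hp h b)]

theorem patched_congr {s n : ℕ} {y y' : ℕ → ℕ} {p : ℕ} (hp : p < n)
    (h : ∀ j, j + 1 < n → y j = y' j) (b e : ℕ) :
    ∀ i < n, patched s n y p b e i = patched s n y' p b e i := by
  intro i hi
  rw [patched, patched, insBit_congr hp h b i hi]

/-- A codeword is found from the result of a deletion and at most `s` substitutions. -/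
theorem findPattern_complete {s n : ℕ} {C c y : ℕ → ℕ} (hC : C n = 0)
    (hdist : ∀ v : ℕ → ℕ, (∀ i, v i ≤ 1) → ∀ P : Finset ℕ, P.card ≤ 2 * s → (∀ i, v i ≠ 0 → i ∈ P) →
      syndrome n C v = 0 → ∀ i < n, v i = 0)
    (hc : ∀ i, c i ≤ 1) (hc0 : syndrome n C c = 0) (hy : ∀ j, y j ≤ 1) {d : ℕ} (hd : d < n)
    (M : Finset ℕ) (hM : M.card ≤ s) (h : ∀ j, j + 1 < n → j ∉ M → y j = c (skip d j)) :
    findPattern s n C y d (c d) ≠ 0 ∧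
      ∀ i < n, patched s n y d (c d) (findPattern s n C y d (c d) - 1) i = c i := by
  classical
  set z := insBit y d (c d) with hz
  have hz1 : ∀ i, z i ≤ 1 := insBit_le_one hy (hc d) d
  -- `e₀` marks the symbols that are wrong after the deleted symbol is put back; they come from `M`
  -- through `skip d`.
  obtain ⟨e₀, he₀, ht⟩ := exists_toggle s n (((Finset.range n).filter fun i => z i ≠ c i)) (by
    refine le_trans (Finset.card_le_card (t := M.image (skip d)) fun i hi => ?_)
      (Finset.card_image_le.trans hM)
    simp only [Finset.mem_filter, Finset.mem_range, hz, insBit] at hi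
    obtain ⟨hin, hi⟩ := hi
    rw [Finset.mem_image]
    split_ifs at hi with h1 h2
    · refine ⟨i, ?_, by simp [skip, h1]⟩
      by_contra hiM
      exact hi (by rw [h i (by omega) hiM]; simp [skip, h1])
    · exact absurd (by rw [h2]) hi
    · refine ⟨i - 1, ?_, by unfold skip; split_ifs <;> omega⟩
      by_contra hiM
      refine hi ?_
      rw [h (i - 1) (by omega) hiM]
      congr 1
      unfold skip; split_ifs <;> omega)
  have hcz : ∀ i < n, z i ^^^ toggle s n e₀ i = c i := by
    intro i hi
    rw [ht i hi]
    have h1 := hz1 i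
    have h2 := hc i
    by_cases hzc : z i = c i
    · simp [hzc]
    · simp only [Finset.mem_filter, Finset.mem_range, hi, hzc, ne_eq, not_false_eq_true, and_self,
        if_true]
      exact xor_one_of_ne h1 h2 hzc
  have hs : patSyndrome s n C e₀ = syndrome n C z := by
    rw [patSyndrome_eq _ _ _ hC]
    have : syndrome n C z ^^^ syndrome n C (toggle s n e₀) = 0 := by
      rw [← syndrome_xor _ _ _ _ hz1 (toggle_le_one s n e₀), syndrome_congr hcz, hc0]
    exact (Nat.xor_eq_zero_iff.1 this).symm
  have hne : findPattern s n C y d (c d) ≠ 0 := lookup_ne_zero _ _ _ e₀ he₀ hs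
  refine ⟨hne, fun i hi => ?_⟩
  obtain ⟨h1, h2⟩ := lookup_spec _ _ _ hne
  set e₁ := lookup (patSyndrome s n C) (syndrome n C (insBit y d (c d))) ((n + 1) ^ s) - 1
  -- The code `e₁` that the search returns need not be `e₀`. But both patterns have the same
  -- syndrome, and their sum is supported on at most `2 * s` places, so by the minimum distance they
  -- change the same positions.
  have h3 : syndrome n C (fun i => toggle s n e₀ i ^^^ toggle s n e₁ i) = 0 := by
    rw [syndrome_xor _ _ _ _ (toggle_le_one s n e₀) (toggle_le_one s n e₁),
      ← patSyndrome_eq _ _ _ hC, ← patSyndrome_eq _ _ _ hC, hs, h2, hz, Nat.xor_self]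
  have h4 := hdist _ (fun i => xor_le_one (toggle_le_one s n e₀ i) (toggle_le_one s n e₁ i))
    ((Finset.range s).image (digit n e₀) ∪ (Finset.range s).image (digit n e₁))
    ((Finset.card_union_le _ _).trans (by
      have := card_digits_le s n e₀
      have := card_digits_le s n e₁
      omega))
    (fun i hi => by
      rw [Finset.mem_union]
      by_contra hcon
      rw [not_or] at hcon
      have e1 : toggle s n e₀ i = 0 := by
        by_contra h; exact hcon.1 (exists_of_toggle_ne_zero h)
      have e2 : toggle s n e₁ i = 0 := by
        by_contra h; exact hcon.2 (exists_of_toggle_ne_zero h)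
      exact hi (by simp [e1, e2])) h3 i hi
  change z i ^^^ toggle s n e₁ i = c i
  rw [← hcz i hi, Nat.xor_eq_zero_iff.1 h4]

/-- What is found and has the right checksum is the right word. -/
theorem eq_of_checksum_patched {s n K : ℕ} (hK : n ^ (2 * s + 4) < K) {c : ℕ → ℕ}
    (hc : ∀ i, c i ≤ 1) {d e p b f : ℕ} (hd : d < n) (hp : p < n) (hb : b ≤ 1)
    (hF : checksum s K n (patched s n (delBit s n c d e) p b f) = checksum s K n c) :
    ∀ i < n, patched s n (delBit s n c d e) p b f i = c i := by
  classical
  have hu : ∀ i, patched s n (delBit s n c d e) p b f i ≤ 1 := fun i => (xor_le_one (insBit_le_one (delBit_le_one hc s n d e) hb p i)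
    (toggle_le_one s n f i))
  -- After `p` is deleted from the corrected word and `d` from `c`, the two can differ only where
  -- `e` or `f` acts; the positions of `f` are renumbered for the removal of `p`.
  let M := (Finset.range s).image (digit n e) ∪
    ((Finset.range s).image (digit n f)).image (fun i => if i < p then i else i - 1)
  intro i hi
  refine (eq_of_skip_of_checksum_eq s n K hK c _ hc hu d p hd hp M ?_ (fun j hj hjM => ?_) hF.symm
    i hi).symm
  · refine (Finset.card_union_le _ _).trans ?_
    have h1 := card_digits_le s n e
    have h2 := card_digits_le s n f
    have h3 := Finset.card_image_le (s := (Finset.range s).image (digit n f))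
      (f := fun i => if i < p then i else i - 1)
    omega
  · simp only [M, Finset.mem_union, not_or] at hjM
    have e1 : toggle s n e j = 0 := by
      by_contra h; exact hjM.1 (exists_of_toggle_ne_zero h)
    have e2 : toggle s n f (skip p j) = 0 := by
      by_contra h
      refine hjM.2 (Finset.mem_image.2 ⟨_, exists_of_toggle_ne_zero h, ?_⟩)
      unfold skip; split_ifs <;> omega
    rw [patched, insBit_skip, delBit, e1, e2]
    simp

/-- The difference of the checksums of the word that is found and of a word with checksum `F`,
or `0`. -/
def checkDiff (s n K : ℕ) (C y : ℕ → ℕ) (p b F : ℕ) : ℕ :=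
  if findPattern s n C y p b = 0 then 0 else
    (checksum s K n (patched s n y p b (findPattern s n C y p b - 1)) - F) +
    (F - checksum s K n (patched s n y p b (findPattern s n C y p b - 1)))

/-- An order embedding is determined by its range, and this range misses exactly one point. -/
theorem exists_skip_of_orderEmbedding {n : ℕ} (hn : 0 < n) (f : Fin (n - 1) ↪o Fin n) :
    ∃ d < n, ∀ j, (f j : ℕ) = skip d j := by
  obtain ⟨k, rfl⟩ : ∃ k, n = k + 1 := ⟨n - 1, by omega⟩
  change Fin k ↪o Fin (k + 1) at f
  obtain ⟨d, hd⟩ : ∃ d, d ∉ Set.range f := by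
    by_contra h
    push Not at h
    have := Fintype.card_le_of_surjective f h
    simp at this
  refine ⟨d, d.2, fun j => ?_⟩
  have : f = Fin.succAboveOrderEmb d := by
    apply OrderEmbedding.range_inj.1
    have h1 : Set.range (Fin.succAboveOrderEmb d) = {d}ᶜ := Fin.range_succAbove d
    rw [h1]
    refine Set.eq_of_subset_of_ncard_le (fun x hx => ?_) ?_ (Set.toFinite _)
    · rintro rfl; exact hd hx
    · rw [Set.ncard_compl, Set.ncard_singleton, ← Set.image_univ,
        Set.ncard_image_of_injective _ f.injective]
      simp
  change ((f j : Fin (k + 1)) : ℕ) = _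
  rw [this]
  simp only [Fin.succAboveOrderEmb_apply, Fin.succAbove, skip]
  split_ifs with h1 h2 h2
  · rfl
  · exact absurd h1 h2
  · exact absurd h2 h1
  · rfl

/-! ### A modulus that avoids all collisions -/

/-- The number of nonzero multiples of `a` among `D 0, …, D (N - 1)`. -/
def countMultiples (D : ℕ → ℕ) (N a : ℕ) : ℕ :=
  iter (fun l x => if D l = 0 then x else if D l % a = 0 then x + 1 else x) 0 N

/-- A factor below `2 ^ b` that divides the number of nonzero multiples of `a` by `2 ^ r`. -/
def nextFactor (D : ℕ → ℕ) (N b r a : ℕ) : ℕ :=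
  iter (fun q x => if q = 0 then x else
    if countMultiples D N a < countMultiples D N (a * q) <<< r then x else q) 1 (2 ^ b)

/-- The modulus after `t` factors. -/
def modulus (D : ℕ → ℕ) (N b r t : ℕ) : ℕ := iter (fun _ a => a * nextFactor D N b r a) 1 t

theorem countMultiples_eq_card (D : ℕ → ℕ) (N a : ℕ) :
    countMultiples D N a = ((Finset.range N).filter fun l => D l ≠ 0 ∧ a ∣ D l).card := by
  unfold countMultiples
  induction N with
  | zero => simp [iter]
  | succ N ih =>
    rw [iter, ih, Finset.range_add_one, Finset.filter_insert]
    by_cases h1 : D N = 0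
    · simp [h1]
    · by_cases h2 : a ∣ D N
      · rw [if_neg h1, if_pos (Nat.mod_eq_zero_of_dvd h2), if_pos ⟨h1, h2⟩,
          Finset.card_insert_of_notMem (by simp)]
      · rw [if_neg h1, if_neg (fun h => h2 (Nat.dvd_of_mod_eq_zero h)), if_neg (fun h => h2 h.2)]

theorem countMultiples_le (D : ℕ → ℕ) (N a : ℕ) : countMultiples D N a ≤ N := by
  rw [countMultiples_eq_card]
  exact (Finset.card_filter_le _ _).trans (by simp)

-- Let `A` be the set of indices of nonzero multiples of `a`. Summed over `q < 2 ^ b` with weight `Λ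
-- q`, the numbers of multiples of `a * q` give at most `A.card * (E * log 2)`, because `Λ` summed
-- over the divisors of `D l / a` is its logarithm. If every `q` kept more than the fraction `2 ^
-- (-r)` of `A`, then `ψ (2 ^ b - 1) ≤ 2 ^ r * E * log 2`, which contradicts Chebyshev's bound.
open ArithmeticFunction Chebyshev in
theorem exists_factor (D : ℕ → ℕ) (N E b r a : ℕ) (ha : 0 < a) (hD : ∀ l < N, D l ≤ 2 ^ E)
    (h : 2 ^ r * E + b + 1 < 2 ^ b) :
    ∃ q, 0 < q ∧ q < 2 ^ b ∧ countMultiples D N (a * q) * 2 ^ r ≤ countMultiples D N a := by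
  by_contra hcon
  push Not at hcon
  set A := (Finset.range N).filter fun l => D l ≠ 0 ∧ a ∣ D l with hA
  have hcA : countMultiples D N a = A.card := countMultiples_eq_card D N a
  -- If nothing is left to remove, `q = 1` is a witness.
  have hApos : 0 < A.card := by
    rw [← hcA]
    rcases Nat.eq_zero_or_pos (countMultiples D N a) with h0 | h0
    · have := hcon 1 one_pos (by omega)
      rw [mul_one, h0] at this
      omega
    · exact h0
  have h2 : (0 : ℝ) < Real.log 2 := Real.log_pos (by norm_num)
  have hswap : ∑ q ∈ Finset.Ioc 0 (2 ^ b - 1), vonMangoldt q * (countMultiples D N (a * q) : ℝ) ≤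
      A.card * (E * Real.log 2) := by
    have e1 : ∀ q ∈ Finset.Ioc 0 (2 ^ b - 1), vonMangoldt q * (countMultiples D N (a * q) : ℝ) =
        ∑ l ∈ A, if q ∣ D l / a then vonMangoldt q else 0 := by
      intro q _
      rw [← Finset.sum_filter, Finset.sum_const, nsmul_eq_mul, mul_comm, countMultiples_eq_card]
      congr 2
      congr 1
      ext l
      simp only [hA, Finset.mem_filter, Finset.mem_range]
      constructor
      · rintro ⟨h1, h3, h4⟩
        have := (dvd_mul_right a q).trans h4
        exact ⟨⟨h1, h3, this⟩, (Nat.dvd_div_iff_mul_dvd this).2 h4⟩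
      · rintro ⟨⟨h1, h3, h4⟩, h5⟩
        exact ⟨h1, h3, (Nat.dvd_div_iff_mul_dvd h4).1 h5⟩
    rw [Finset.sum_congr rfl e1, Finset.sum_comm, ← nsmul_eq_mul]
    refine Finset.sum_le_card_nsmul _ _ _ fun l hl => ?_
    simp only [hA, Finset.mem_filter, Finset.mem_range] at hl
    obtain ⟨h1, h3, h4⟩ := hl
    have hpos : 0 < D l / a := Nat.div_pos (Nat.le_of_dvd (by omega) h4) ha
    rw [← Finset.sum_filter]
    calc _ ≤ ∑ q ∈ (D l / a).divisors, vonMangoldt q := by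
          refine Finset.sum_le_sum_of_subset_of_nonneg (fun q hq => ?_)
            fun _ _ _ => vonMangoldt_nonneg
          rw [Nat.mem_divisors]
          exact ⟨(Finset.mem_filter.1 hq).2, by omega⟩
      _ = Real.log ((D l / a : ℕ) : ℝ) := vonMangoldt_sum
      _ ≤ Real.log ((2 : ℝ) ^ E) := by
          refine Real.log_le_log (by exact_mod_cast hpos) ?_
          exact_mod_cast (Nat.div_le_self _ _).trans (hD l h1)
      _ = E * Real.log 2 := Real.log_pow _ _
  have hpsi : (A.card : ℝ) * ψ ((2 ^ b - 1 : ℕ) : ℝ) ≤ 2 ^ r *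
      ∑ q ∈ Finset.Ioc 0 (2 ^ b - 1), vonMangoldt q * (countMultiples D N (a * q) : ℝ) := by
    rw [psi, Nat.floor_natCast, Finset.mul_sum, Finset.mul_sum]
    refine Finset.sum_le_sum fun q hq => ?_
    rw [Finset.mem_Ioc] at hq
    have h1 := hcon q hq.1 (by omega)
    rw [hcA] at h1
    have h3 : (A.card : ℝ) ≤ (countMultiples D N (a * q) : ℝ) * 2 ^ r := by exact_mod_cast h1.le
    have h4 : 0 ≤ vonMangoldt q := vonMangoldt_nonneg
    nlinarith
  have hlow := psi_ge (2 ^ b - 1)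
  have hb : ((2 ^ b - 1 : ℕ) : ℝ) + 1 = 2 ^ b := by
    have : 1 ≤ 2 ^ b := Nat.one_le_two_pow
    push_cast [Nat.cast_sub this]; ring
  rw [hb, Real.log_pow] at hlow
  have hA0 : (0 : ℝ) < A.card := by exact_mod_cast hApos
  have h5 : (A.card : ℝ) * ψ ((2 ^ b - 1 : ℕ) : ℝ) ≤ A.card * (2 ^ r * (E * Real.log 2)) := by
    refine hpsi.trans ?_
    calc _ ≤ (2 : ℝ) ^ r * (A.card * (E * Real.log 2)) := by gcongr
      _ = _ := by ring
  have h6 := le_of_mul_le_mul_left h5 hA0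
  have h7 : (((2 ^ b - 1 : ℕ) : ℝ) - b) * Real.log 2 ≤ (2 ^ r * E) * Real.log 2 := by
    linarith
  have h8 := le_of_mul_le_mul_right h7 h2
  have h9 : (2 : ℝ) ^ r * E + b + 1 < 2 ^ b := by exact_mod_cast h
  linarith

theorem nextFactor_pos_lt (D : ℕ → ℕ) (N b r a : ℕ) (hb : 0 < b) :
    0 < nextFactor D N b r a ∧ nextFactor D N b r a < 2 ^ b := by
  have h1 := Nat.one_lt_two_pow hb.ne'
  have : ∀ k ≤ 2 ^ b, 0 < iter (fun q x => if q = 0 then x else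
    if countMultiples D N a < countMultiples D N (a * q) <<< r then x else q) 1 k ∧
    iter (fun q x => if q = 0 then x else
    if countMultiples D N a < countMultiples D N (a * q) <<< r then x else q) 1 k < 2 ^ b := by
    intro k
    induction k with
    | zero => intro _; exact ⟨one_pos, h1⟩
    | succ k ih =>
      intro hk
      rw [iter]
      split_ifs
      · exact ih (by omega)
      · exact ih (by omega)
      · omega
  exact this _ le_rfl

/-- The search keeps the last `q` that passes the test. The initial value `1` need not pass, but it
is replaced at the latest when a witness is met. -/
theorem nextFactor_spec (D : ℕ → ℕ) (N b r a : ℕ) (h : ∃ q, 0 < q ∧ q < 2 ^ b ∧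
    countMultiples D N (a * q) * 2 ^ r ≤ countMultiples D N a) :
    countMultiples D N (a * nextFactor D N b r a) * 2 ^ r ≤ countMultiples D N a := by
  obtain ⟨q, h1, h2, h3⟩ := h
  have : ∀ k, q < k → countMultiples D N (a * iter (fun q x => if q = 0 then x else
    if countMultiples D N a < countMultiples D N (a * q) <<< r then x else q) 1 k) * 2 ^ r
      ≤ countMultiples D N a := by
    intro k
    induction k with
    | zero => intro h; omega
    | succ k ih =>
      intro hk
      rw [iter]
      rcases Nat.lt_succ_iff_lt_or_eq.1 hk with h | h
      · split_ifs with h4 h5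
        · exact ih h
        · exact ih h
        · rw [Nat.shiftLeft_eq] at h5; omega
      · subst h
        rw [if_neg (by omega), if_neg]
        · exact h3
        · rw [Nat.shiftLeft_eq]; omega
  exact this _ h2

theorem modulus_pos (D : ℕ → ℕ) (N b r t : ℕ) (hb : 0 < b) : 0 < modulus D N b r t := by
  induction t with
  | zero => exact one_pos
  | succ t ih => exact Nat.mul_pos ih (nextFactor_pos_lt D N b r _ hb).1

theorem modulus_le (D : ℕ → ℕ) (N b r t : ℕ) (hb : 0 < b) :
    modulus D N b r t ≤ (2 ^ b - 1) ^ t := by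
  induction t with
  | zero => exact le_rfl
  | succ t ih =>
    rw [pow_succ]
    exact Nat.mul_le_mul ih (Nat.le_sub_one_of_lt (nextFactor_pos_lt D N b r _ hb).2)

theorem modulus_lt (D : ℕ → ℕ) (N b r t : ℕ) (hb : 0 < b) (ht : 0 < t) :
    modulus D N b r t < 2 ^ (t * b) := by
  refine (modulus_le D N b r t hb).trans_lt ?_
  rw [mul_comm, pow_mul]
  exact Nat.pow_lt_pow_left (by have := Nat.one_le_two_pow (n := b); omega) ht.ne'

/-- The modulus divides none of the numbers. -/
theorem modulus_not_dvd (D : ℕ → ℕ) (N E b r t : ℕ) (hD : ∀ l < N, D l ≤ 2 ^ E)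
    (h : 2 ^ r * E + b + 1 < 2 ^ b) (hN : N < 2 ^ (r * t)) :
    ∀ l < N, modulus D N b r t ∣ D l → D l = 0 := by
  have hb : 0 < b := by
    rcases Nat.eq_zero_or_pos b with rfl | h'
    · simp at h
    · exact h'
  -- Each factor divides the count by `2 ^ r`; after `t` of them less than one nonzero multiple is
  -- left.
  have key : ∀ t, countMultiples D N (modulus D N b r t) * 2 ^ (r * t) ≤ N := by
    intro t
    induction t with
    | zero => simpa using countMultiples_le D N _
    | succ t ih =>
      refine le_trans ?_ ih
      have := nextFactor_spec D N b r (modulus D N b r t)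
        (exists_factor D N E b r _ (modulus_pos D N b r t hb) hD h)
      rw [mul_add, mul_one, pow_add, mul_comm (2 ^ (r * t)), ← mul_assoc]
      exact Nat.mul_le_mul_right _ this
  intro l hl hdvd
  by_contra h0
  have h1 : 0 < countMultiples D N (modulus D N b r t) := by
    rw [countMultiples_eq_card]
    exact Finset.card_pos.2 ⟨l, by simp [hl, h0, hdvd]⟩
  have h2 := Nat.mul_le_mul_right (2 ^ (r * t)) h1
  have := key t
  omega

/-! ### The lengths of the factors -/

/-- The number of binary digits of `n`. -/
def bitLen (n : ℕ) : ℕ := Nat.log 2 n + 1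

/-- The length of each factor of the modulus. -/
def factorLen (c n : ℕ) : ℕ := (bitLen n + 1) / 2 + Nat.log 2 (bitLen n) + (c + 5)

/-- The factor by which each step reduces the number of collisions is `2` to this power. -/
def gainLen (n : ℕ) : ℕ := (bitLen n + 1) / 2 + 1

theorem lt_two_pow_bitLen (n : ℕ) : n < 2 ^ bitLen n := Nat.lt_pow_succ_log_self (by norm_num) n

theorem two_pow_bitLen_le (n : ℕ) (hn : 0 < n) : 2 ^ bitLen n ≤ 2 * n := by
  rw [bitLen, pow_succ]
  have := Nat.pow_log_le_self 2 hn.ne'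
  omega

/-- This is the hypothesis of `exists_factor` for numbers of at most `c * bitLen n` bits. The excess
of `factorLen` over `gainLen` is `Nat.log 2 (bitLen n) + c + 4`, which pays for `bitLen n`, for `c`,
and leaves a factor `8` to absorb the summand `factorLen c n + 1`. -/
theorem factorLen_gainLen (c n : ℕ) :
    2 ^ gainLen n * (c * bitLen n) + factorLen c n + 1 < 2 ^ factorLen c n := by
  have h1 : ∀ b, 5 ≤ b → 2 * (b + 2) < 2 ^ b := by
    intro b hb
    induction b, hb using Nat.le_induction with
    | base => norm_num
    | succ b hb ih => rw [pow_succ]; omega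
  have h2 := h1 (factorLen c n) (by unfold factorLen; omega)
  have h3 : 2 ^ factorLen c n = 2 ^ gainLen n * (2 ^ (Nat.log 2 (bitLen n) + 1) * (2 ^ c * 2 ^ 3)) := by
    rw [← pow_add, ← pow_add, ← pow_add]
    congr 1
    unfold factorLen gainLen
    omega
  have h4 : bitLen n < 2 ^ (Nat.log 2 (bitLen n) + 1) := Nat.lt_pow_succ_log_self (by norm_num) _
  have h5 : c < 2 ^ c := Nat.lt_two_pow_self
  have h6 : c * bitLen n ≤ 2 ^ c * 2 ^ (Nat.log 2 (bitLen n) + 1) := Nat.mul_le_mul h5.le h4.le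
  have h7 := Nat.mul_le_mul_left (2 ^ gainLen n) h6
  have h8 : 2 ^ factorLen c n =
      8 * (2 ^ gainLen n * (2 ^ c * 2 ^ (Nat.log 2 (bitLen n) + 1))) := by
    rw [h3]; ring
  omega

/-- Two factors gain more than `n + 1`, since `2 * gainLen n ≥ bitLen n + 2`; so `2 * (s + 2)` of
them exceed the number of competitors. -/
theorem collisions_lt (s n : ℕ) :
    2 * n ^ 2 * (n + 1) ^ s < 2 ^ (gainLen n * (2 * (s + 2))) := by
  have h1 : n + 1 ≤ 2 ^ bitLen n := lt_two_pow_bitLen n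
  have h2 : 2 * n ^ 2 * (n + 1) ^ s ≤ 2 * (n + 1) ^ (s + 2) := by
    rw [pow_add, mul_comm ((n + 1) ^ s), ← mul_assoc]
    gcongr
    omega
  have h3 : (n + 1) ^ (s + 2) ≤ 2 ^ (bitLen n * (s + 2)) := by
    rw [pow_mul]; exact Nat.pow_le_pow_left h1 _
  have h4 : 2 ^ (bitLen n * (s + 2) + 2) ≤ 2 ^ (gainLen n * (2 * (s + 2))) := by
    apply Nat.pow_le_pow_right (by omega)
    have : bitLen n + 2 ≤ 2 * gainLen n := by unfold gainLen; omega
    have := Nat.mul_le_mul_right (s + 2) this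
    nlinarith
  have h5 : 0 < 2 ^ (bitLen n * (s + 2)) := by positivity
  rw [pow_add] at h4
  omega

/-! ### The algorithms as terms, and their values -/

namespace WordRAM

namespace Term

instance : Add Term := ⟨bin .add⟩
instance : Sub Term := ⟨bin .sub⟩
instance : Mul Term := ⟨bin .mul⟩
instance : Div Term := ⟨bin .div⟩
instance : Mod Term := ⟨bin .mod⟩
instance : XorOp Term := ⟨bin .xor⟩
instance : ShiftLeft Term := ⟨bin .shl⟩
instance : ShiftRight Term := ⟨bin .shr⟩

variable (μ : ℕ → ℕ) (W : ℕ) (E : List ℕ) (a b c : Term)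

@[simp] theorem eval_var (i : ℕ) : (var i).eval μ E = E.getD i 0 := rfl
@[simp] theorem eval_lit (i : ℕ) : (lit i).eval μ E = i := rfl
@[simp] theorem eval_add : (a + b).eval μ E = a.eval μ E + b.eval μ E := rfl
@[simp] theorem eval_sub : (a - b).eval μ E = a.eval μ E - b.eval μ E := rfl
@[simp] theorem eval_mul : (a * b).eval μ E = a.eval μ E * b.eval μ E := rfl
@[simp] theorem eval_div : (a / b).eval μ E = a.eval μ E / b.eval μ E := rfl
@[simp] theorem eval_mod : (a % b).eval μ E = a.eval μ E % b.eval μ E := rfl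
@[simp] theorem eval_xor : (a ^^^ b).eval μ E = a.eval μ E ^^^ b.eval μ E := rfl
@[simp] theorem eval_shl : (a <<< b).eval μ E = a.eval μ E <<< b.eval μ E := rfl
@[simp] theorem eval_shr : (a >>> b).eval μ E = a.eval μ E >>> b.eval μ E := rfl
@[simp] theorem eval_lt : (bin .lt a b).eval μ E = if a.eval μ E < b.eval μ E then 1 else 0 := rfl
@[simp] theorem eval_eq : (bin .eq a b).eval μ E = if a.eval μ E = b.eval μ E then 1 else 0 := rfl
@[simp] theorem eval_get : (get a).eval μ E = μ (a.eval μ E) := rfl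
@[simp] theorem eval_ite : (ite c a b).eval μ E =
    if c.eval μ E = 0 then b.eval μ E else a.eval μ E := rfl
@[simp] theorem eval_bind : (bind a b).eval μ E = b.eval μ (E ++ [a.eval μ E]) := rfl
@[simp] theorem eval_fold : (fold a b c).eval μ E =
    iter (fun i x => c.eval μ (E ++ [i, x])) (b.eval μ E) (a.eval μ E) := rfl

@[simp] theorem ok_var (i : ℕ) : (var i).ok W μ E ↔ i < E.length := Iff.rfl
@[simp] theorem ok_lit (i : ℕ) : (lit i).ok W μ E ↔ i < W := Iff.rfl
@[simp] theorem ok_add : (a + b).ok W μ E ↔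
    a.ok W μ E ∧ b.ok W μ E ∧ a.eval μ E + b.eval μ E < W := Iff.rfl
@[simp] theorem ok_mul : (a * b).ok W μ E ↔
    a.ok W μ E ∧ b.ok W μ E ∧ a.eval μ E * b.eval μ E < W := Iff.rfl
@[simp] theorem ok_shl : (a <<< b).ok W μ E ↔
    a.ok W μ E ∧ b.ok W μ E ∧ a.eval μ E <<< b.eval μ E < W := Iff.rfl
@[simp] theorem ok_sub : (a - b).ok W μ E ↔ a.ok W μ E ∧ b.ok W μ E :=
  (Iff.rfl : _ ↔ _ ∧ _ ∧ True).trans (by simp)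
@[simp] theorem ok_div : (a / b).ok W μ E ↔ a.ok W μ E ∧ b.ok W μ E :=
  (Iff.rfl : _ ↔ _ ∧ _ ∧ True).trans (by simp)
@[simp] theorem ok_mod : (a % b).ok W μ E ↔ a.ok W μ E ∧ b.ok W μ E :=
  (Iff.rfl : _ ↔ _ ∧ _ ∧ True).trans (by simp)
@[simp] theorem ok_xor : (a ^^^ b).ok W μ E ↔ a.ok W μ E ∧ b.ok W μ E :=
  (Iff.rfl : _ ↔ _ ∧ _ ∧ True).trans (by simp)
@[simp] theorem ok_shr : (a >>> b).ok W μ E ↔ a.ok W μ E ∧ b.ok W μ E :=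
  (Iff.rfl : _ ↔ _ ∧ _ ∧ True).trans (by simp)
@[simp] theorem ok_lt : (bin .lt a b).ok W μ E ↔ a.ok W μ E ∧ b.ok W μ E :=
  (Iff.rfl : _ ↔ _ ∧ _ ∧ True).trans (by simp)
@[simp] theorem ok_eq : (bin .eq a b).ok W μ E ↔ a.ok W μ E ∧ b.ok W μ E :=
  (Iff.rfl : _ ↔ _ ∧ _ ∧ True).trans (by simp)
@[simp] theorem ok_get : (get a).ok W μ E ↔ a.ok W μ E := Iff.rfl
@[simp] theorem ok_ite : (ite c a b).ok W μ E ↔ c.ok W μ E ∧ (c.eval μ E ≠ 0 → a.ok W μ E) ∧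
    (c.eval μ E = 0 → b.ok W μ E) := Iff.rfl
@[simp] theorem ok_bind : (bind a b).ok W μ E ↔ a.ok W μ E ∧ b.ok W μ (E ++ [a.eval μ E]) := Iff.rfl
@[simp] theorem ok_fold : (fold a b c).ok W μ E ↔ a.ok W μ E ∧ b.ok W μ E ∧ ∀ i < a.eval μ E,
    c.ok W μ (E ++ [i, iter (fun i x => c.eval μ (E ++ [i, x])) (b.eval μ E) i]) := Iff.rfl

@[simp] theorem cost_var (i : ℕ) : (var i).cost μ E = 1 := rfl
@[simp] theorem cost_lit (i : ℕ) : (lit i).cost μ E = 1 := rfl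
@[simp] theorem cost_bin (o : BinOp) : (bin o a b).cost μ E = a.cost μ E + b.cost μ E + 1 := rfl
@[simp] theorem cost_add : (a + b).cost μ E = a.cost μ E + b.cost μ E + 1 := rfl
@[simp] theorem cost_sub : (a - b).cost μ E = a.cost μ E + b.cost μ E + 1 := rfl
@[simp] theorem cost_mul : (a * b).cost μ E = a.cost μ E + b.cost μ E + 1 := rfl
@[simp] theorem cost_div : (a / b).cost μ E = a.cost μ E + b.cost μ E + 1 := rfl
@[simp] theorem cost_mod : (a % b).cost μ E = a.cost μ E + b.cost μ E + 1 := rfl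
@[simp] theorem cost_xor : (a ^^^ b).cost μ E = a.cost μ E + b.cost μ E + 1 := rfl
@[simp] theorem cost_shl : (a <<< b).cost μ E = a.cost μ E + b.cost μ E + 1 := rfl
@[simp] theorem cost_shr : (a >>> b).cost μ E = a.cost μ E + b.cost μ E + 1 := rfl
@[simp] theorem cost_get : (get a).cost μ E = a.cost μ E + 1 := rfl
@[simp] theorem cost_bind : (bind a b).cost μ E =
    a.cost μ E + b.cost μ (E ++ [a.eval μ E]) + 1 := rfl

/-- Both branches are charged, so that cost bounds do not depend on the outcome of tests. -/
theorem cost_ite_le : (ite c a b).cost μ E ≤ c.cost μ E + (a.cost μ E + b.cost μ E) + 1 := by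
  rw [cost]
  split_ifs <;> omega

/-- The bound for a round is asked for every accumulator `x`, so the values that occur need not be
known. -/
theorem cost_fold_le {T N : ℕ} (hN : a.eval μ E ≤ N)
    (h : ∀ i < a.eval μ E, ∀ x, c.cost μ (E ++ [i, x]) ≤ T) :
    (fold a b c).cost μ E ≤ a.cost μ E + b.cost μ E + N * (T + 5) + 5 := by
  rw [cost]
  have := Finset.sum_le_card_nsmul (Finset.range (a.eval μ E)) (fun i => c.cost μ (E ++ [i,
    iter (fun i x => c.eval μ (E ++ [i, x])) (b.eval μ E) i]) + 5) (T + 5)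
    (fun i hi => by have := h i (Finset.mem_range.1 hi); simp only [Nat.add_le_add_iff_right]; exact this _)
  rw [Finset.card_range, smul_eq_mul] at this
  have h2 := Nat.mul_le_mul_right (T + 5) hN
  omega

attribute [simp] eval_call ok_call cost_call evalArgs okArgs costArgs

/-- `b ^ k`, for the variables `b`, `k`. -/
def powT : Term := fold (var 1) (lit 1) (var 3 * var 0)

/-- `Nat.log 2 n`, for the variable `n`. -/
def logT : Term := fold (var 0) (lit 0) (ite (var 0 >>> (var 1 + lit 1)) (var 2 + lit 1) (var 2))

/-- `gainLen n`, for the variable `n`. -/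
def gainT : Term := (call logT [var 0] + lit 2) / lit 2 + lit 1

/-- `factorLen c n`, for the variable `n`. -/
def factorT (c : ℕ) : Term :=
  bind (call logT [var 0] + lit 1) ((var 1 + lit 1) / lit 2 + call logT [var 1] + lit (c + 5))

/-- `shiftStep m g p`, for the variables `2 ^ m`, `g`, `p`. -/
def shiftStepT : Term :=
  bind (var 2 + var 2) (ite (bin .lt (var 3) (var 0)) (var 3) (var 3 ^^^ var 1))

/-- `powCode m g i`, for the variables `2 ^ m`, `g`, `i`. -/
def powCodeT : Term := fold (var 2) (lit 1) (call shiftStepT [var 0, var 1, var 4])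

/-- `colCode s m g i`, for the variables `m`, `2 ^ m`, `g`, `i`. -/
def colT (s : ℕ) : Term := fold (lit (2 * s)) (lit 0)
  (var 5 ^^^ (call powCodeT [var 1, var 2, var 3 * (var 4 + lit 1)] <<< (var 0 * var 4)))

/-- `∑ j < 2 * s + 3, x ^ j`, for the variable `x`. -/
def hornerT (s : ℕ) : Term := fold (lit (2 * s + 3)) (lit 0) (var 2 * var 0 + lit 1)

/-- `weight s K i`, for the variables `K`, `i`. -/
def weightT (s : ℕ) : Term :=
  fold (var 1 + lit 1) (lit 0) (var 3 + call (hornerT s) [var 2 * var 0])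

/-- `digit n e l`, for the variables `n`, `e`, `l`. -/
def digitT : Term := var 1 / call powT [var 0 + lit 1, var 2] % (var 0 + lit 1)

/-- `toggle s n e i`, for the variables `n`, `e`, `i`. -/
def toggleT (s : ℕ) : Term :=
  fold (lit s) (lit 0) (var 4 ^^^ bin .eq (call digitT [var 0, var 1, var 3]) (var 2))

/-- The syndrome of a pattern, for the variables `n`, `C`, `e`. -/
def patT (s : ℕ) : Term :=
  fold (lit s) (lit 0) (var 4 ^^^ get (var 1 + call digitT [var 0, var 2, var 3]))

/-- The result of a deletion and substitutions, for the variables `n`, `X`, `d`, `e`, `j`. -/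
def delT (s : ℕ) : Term :=
  get (var 1 + ite (bin .lt (var 4) (var 2)) (var 4) (var 4 + lit 1)) ^^^
    call (toggleT s) [var 0, var 3, var 4]

/-- The result of an insertion, for the variables `n`, `X`, `d`, `e`, `p`, `b`, `i`. -/
def insT (s : ℕ) : Term :=
  ite (bin .lt (var 6) (var 4)) (call (delT s) [var 0, var 1, var 2, var 3, var 6])
    (ite (bin .eq (var 6) (var 4)) (var 5)
      (call (delT s) [var 0, var 1, var 2, var 3, var 6 - lit 1]))

/-- The table entry for the syndrome, for the variables `n`, `X`, `d`, `e`, `p`, `b`, `C`, `T`. -/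
def findT (s : ℕ) : Term :=
  get (var 7 + fold (var 0) (lit 0)
    (ite (call (insT s) [var 0, var 1, var 2, var 3, var 4, var 5, var 8])
      (var 9 ^^^ get (var 6 + var 8)) (var 9)))

/-- The patched word, for the variables `n`, `X`, `d`, `e`, `p`, `b`, `f`, `i`. -/
def patchT (s : ℕ) : Term :=
  call (insT s) [var 0, var 1, var 2, var 3, var 4, var 5, var 7] ^^^
    call (toggleT s) [var 0, var 6, var 7]

/-- The checksum of the patched word, for the variables `n`, `X`, `d`, `e`, `p`, `b`, `f`, `V`. -/
def patchSumT (s : ℕ) : Term := fold (var 0) (lit 0)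
  (ite (call (patchT s) [var 0, var 1, var 2, var 3, var 4, var 5, var 6, var 8])
    (var 9 + get (var 7 + var 8)) (var 9))

/-- The checksum of a word, for the variables `n`, `X`, `V`. -/
def sumT : Term := fold (var 0) (lit 0)
  (ite (get (var 1 + var 3)) (var 4 + get (var 2 + var 3)) (var 4))

/-- The difference of checksums, for the variables `n`, `X`, `d`, `e`, `p`, `b`, `C`, `T`, `V`, `F`. -/
def diffT (s : ℕ) : Term :=
  bind (call (findT s) [var 0, var 1, var 2, var 3, var 4, var 5, var 6, var 7])
    (ite (var 10)
      (bind (call (patchSumT s) [var 0, var 1, var 2, var 3, var 4, var 5, var 10 - lit 1, var 8])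
        ((var 11 - var 9) + (var 9 - var 11)))
      (lit 0))

/-- The number of multiples of `a`, for the variables `L`, `N`, `a`. -/
def countT : Term := fold (var 1) (lit 0)
  (ite (get (var 0 + var 3)) (ite (get (var 0 + var 3) % var 2) (var 4) (var 4 + lit 1)) (var 4))

/-- The next factor, for the variables `L`, `N`, `b`, `r`, `a`. -/
def nextT : Term := bind (call countT [var 0, var 1, var 4])
  (fold (lit 1 <<< var 2) (lit 1) (ite (var 6)
    (ite (bin .lt (var 5) (call countT [var 0, var 1, var 4 * var 6] <<< var 3)) (var 7) (var 6))
    (var 7)))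

/-- The modulus, for the variables `L`, `N`, `b`, `r`. -/
def modulusT (t : ℕ) : Term := fold (lit t) (lit 1)
  (var 5 * call nextT [var 0, var 1, var 2, var 3, var 5])

/-- The number with the binary digits from the cell `X` on, for the variables `X`, `k`. -/
def numberT : Term := fold (var 1) (lit 0) (var 3 + (get (var 0 + var 2) <<< var 2))

/-- Whether the word that is found has checksum `r` modulo `a`, for the variables `n`, `X`, `d`,
`e`, `p`, `b`, `C`, `T`, `V`, `a`, `r`. -/
def testT (s : ℕ) : Term :=
  bind (call (findT s) [var 0, var 1, var 2, var 3, var 4, var 5, var 6, var 7])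
    (ite (var 11)
      (bin .eq (call (patchSumT s) [var 0, var 1, var 2, var 3, var 4, var 5, var 11 - lit 1, var 8]
        % var 9) (var 10))
      (lit 0))

section eval

variable {μ : ℕ → ℕ}

@[simp] theorem eval_powT (b k : ℕ) : powT.eval μ [b, k] = b ^ k := by
  simp [powT]
  induction k with
  | zero => rfl
  | succ k ih => rw [iter, ih, pow_succ]

@[simp] theorem eval_logT (n : ℕ) : logT.eval μ [n] = Nat.log 2 n := by
  have key : ∀ k, iter (fun i x => if n >>> (i + 1) = 0 then x else x + 1) 0 k =
      min k (Nat.log 2 n) := by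
    intro k
    induction k with
    | zero => simp [iter]
    | succ k ih =>
      rw [iter, ih, Nat.shiftRight_eq_div_pow]
      split_ifs with h
      · rw [Nat.div_eq_zero_iff] at h
        have h' : n < 2 ^ (k + 1) := by simpa using h
        have : Nat.log 2 n < k + 1 := Nat.log_lt_of_lt_pow' (by omega) h'
        omega
      · have h' : 2 ^ (k + 1) ≤ n := by
          by_contra h2
          exact h (Nat.div_eq_of_lt (by omega))
        have : k + 1 ≤ Nat.log 2 n := Nat.le_log_of_pow_le (by norm_num) h'
        omega
  simp [logT, key]
  exact Nat.log_le_self 2 n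

@[simp] theorem eval_gainT (n : ℕ) : gainT.eval μ [n] = gainLen n := by
  simp [gainT, gainLen, bitLen]
  omega

@[simp] theorem eval_factorT (c n : ℕ) : (factorT c).eval μ [n] = factorLen c n := by
  simp [factorT, factorLen, bitLen]

@[simp] theorem eval_shiftStepT (m g p : ℕ) :
    shiftStepT.eval μ [2 ^ m, g, p] = shiftStep m g p := by
  simp [shiftStepT, shiftStep]
  split_ifs <;> first | rfl | omega

@[simp] theorem eval_powCodeT (m g i : ℕ) : powCodeT.eval μ [2 ^ m, g, i] = powCode m g i := by
  simp [powCodeT, powCode]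

@[simp] theorem eval_colT (s m g i : ℕ) :
    (colT s).eval μ [m, 2 ^ m, g, i] = colCode s m g i := by
  simp [colT, colCode]

@[simp] theorem eval_hornerT (s x : ℕ) :
    (hornerT s).eval μ [x] = ∑ j ∈ Finset.range (2 * s + 3), x ^ j := by
  have key : ∀ k, iter (fun _ y => y * x + 1) 0 k = ∑ j ∈ Finset.range k, x ^ j := by
    intro k
    induction k with
    | zero => rfl
    | succ k ih =>
      rw [iter, ih, Finset.sum_range_succ', Finset.sum_mul]
      simp [pow_succ]
  simp [hornerT, key]

@[simp] theorem eval_weightT (s K i : ℕ) : (weightT s).eval μ [K, i] = weight s K i := by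
  have key : ∀ k, iter (fun l x => x + ∑ j ∈ Finset.range (2 * s + 3), (l * K) ^ j) 0 k =
      ∑ l ∈ Finset.range k, ∑ j ∈ Finset.range (2 * s + 3), (l * K) ^ j := by
    intro k
    induction k with
    | zero => rfl
    | succ k ih => rw [iter, ih]; exact (Finset.sum_range_succ _ _).symm
  simp [weightT, weight, key]

@[simp] theorem eval_digitT (n e l : ℕ) : digitT.eval μ [n, e, l] = digit n e l := by
  simp [digitT, digit]

@[simp] theorem eval_toggleT (s n e i : ℕ) : (toggleT s).eval μ [n, e, i] = toggle s n e i := by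
  simp [toggleT, toggle]

@[simp] theorem eval_patT (s n A e : ℕ) :
    (patT s).eval μ [n, A, e] = patSyndrome s n (fun i => μ (A + i)) e := by
  simp [patT, patSyndrome]

@[simp] theorem eval_delT (s n X d e j : ℕ) :
    (delT s).eval μ [n, X, d, e, j] = delBit s n (fun i => μ (X + i)) d e j := by
  simp [delT, delBit, skip]
  split_ifs <;> first | rfl | omega

@[simp] theorem eval_insT (s n X d e p b i : ℕ) : (insT s).eval μ [n, X, d, e, p, b, i] =
    insBit (delBit s n (fun i => μ (X + i)) d e) p b i := by
  simp [insT, insBit]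
  split_ifs <;> first | rfl | omega

@[simp] theorem eval_findT (s n X d e p b A T : ℕ) :
    (findT s).eval μ [n, X, d, e, p, b, A, T] = μ (T + syndrome n (fun i => μ (A + i))
      (insBit (delBit s n (fun i => μ (X + i)) d e) p b)) := by
  simp [findT, syndrome]

@[simp] theorem eval_patchT (s n X d e p b f i : ℕ) :
    (patchT s).eval μ [n, X, d, e, p, b, f, i] =
      patched s n (delBit s n (fun i => μ (X + i)) d e) p b f i := by
  simp [patchT, patched]

theorem iter_eq_sum (z V : ℕ → ℕ) (n : ℕ) (hz : ∀ i < n, z i ≤ 1) :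
    iter (fun i x => if z i = 0 then x else x + V i) 0 n = ∑ i ∈ Finset.range n, z i * V i := by
  induction n with
  | zero => rfl
  | succ n ih =>
    rw [iter, ih fun i hi => hz i (by omega), Finset.sum_range_succ]
    have := hz n (by omega)
    split_ifs with h
    · simp [h]
    · simp [show z n = 1 by omega]

@[simp] theorem eval_patchSumT (s n X d e p b f V : ℕ) :
    (patchSumT s).eval μ [n, X, d, e, p, b, f, V] =
      iter (fun i x => if patched s n (delBit s n (fun i => μ (X + i)) d e) p b f i = 0 then x
        else x + μ (V + i)) 0 n := by
  simp [patchSumT]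

@[simp] theorem eval_sumT (n X V : ℕ) :
    sumT.eval μ [n, X, V] = iter (fun i x => if μ (X + i) = 0 then x else x + μ (V + i)) 0 n := by
  simp [sumT]

@[simp] theorem eval_countT (L N a : ℕ) :
    countT.eval μ [L, N, a] = countMultiples (fun l => μ (L + l)) N a := by
  simp [countT, countMultiples]

@[simp] theorem eval_nextT (L N b r a : ℕ) :
    nextT.eval μ [L, N, b, r, a] = nextFactor (fun l => μ (L + l)) N b r a := by
  simp [nextT, nextFactor, Nat.one_shiftLeft]
  refine iter_congr fun l _ x => ?_
  split_ifs <;> first | rfl | omega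

@[simp] theorem eval_modulusT (t L N b r : ℕ) :
    (modulusT t).eval μ [L, N, b, r] = modulus (fun l => μ (L + l)) N b r t := by
  simp [modulusT, modulus]

@[simp] theorem eval_numberT (X k : ℕ) :
    numberT.eval μ [X, k] = iter (fun i x => x + μ (X + i) <<< i) 0 k := by
  simp [numberT]

end eval

end Term
end WordRAM

/-! ### Absence of overflow -/

namespace WordRAM
namespace Term

variable {μ : ℕ → ℕ} {W : ℕ}

theorem iter_mul (b k : ℕ) : iter (fun _ x => x * b) 1 k = b ^ k := by
  induction k with
  | zero => rfl
  | succ k ih => rw [iter, ih, pow_succ]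

theorem iter_count_le (P : ℕ → ℕ → ℕ) (hP : ∀ i x, P i x ≤ x + 1) (k : ℕ) : iter P 0 k ≤ k := by
  induction k with
  | zero => exact le_rfl
  | succ k ih => exact (hP _ _).trans (by omega)

theorem iter_le_sum (z V : ℕ → ℕ) (n : ℕ) :
    iter (fun i x => if z i = 0 then x else x + V i) 0 n ≤ ∑ i ∈ Finset.range n, V i := by
  induction n with
  | zero => exact le_rfl
  | succ n ih =>
    rw [iter, Finset.sum_range_succ]
    split_ifs <;> omega

theorem sum_range_mono (V : ℕ → ℕ) {i n : ℕ} (h : i ≤ n) :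
    ∑ j ∈ Finset.range i, V j ≤ ∑ j ∈ Finset.range n, V j :=
  Finset.sum_le_sum_of_subset (by simpa using h)

theorem ok_powT {b k : ℕ} (hb : 0 < b) (h : b ^ k < W) : powT.ok W μ [b, k] := by
  have h1 : 0 < b ^ k := by positivity
  simp [powT, iter_mul]
  refine ⟨by omega, fun i hi => ?_⟩
  rw [← pow_succ]
  exact (Nat.pow_le_pow_right hb hi).trans_lt h

theorem ok_logT {n : ℕ} (hn : n < W) : logT.ok W μ [n] := by
  simp [logT]
  refine ⟨by omega, fun i hi => ⟨⟨by omega, by omega⟩, fun _ => ⟨by omega, ?_⟩⟩⟩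
  have := iter_count_le (fun i x => if n >>> (i + 1) = 0 then x else x + 1)
    (fun i x => by split_ifs <;> omega) i
  omega

theorem ok_gainT {n : ℕ} (hn : n + 2 < W) : gainT.ok W μ [n] := by
  have := Nat.log_le_self 2 n
  simp [gainT, ok_logT (show n < W by omega)]
  omega

theorem ok_factorT {c n : ℕ} (hn : 2 * n + c + 10 < W) : (factorT c).ok W μ [n] := by
  have := Nat.log_le_self 2 n
  have := Nat.log_le_self 2 (Nat.log 2 n + 1)
  simp [factorT, ok_logT (show n < W by omega), ok_logT (show Nat.log 2 n + 1 < W by omega)]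
  omega

theorem ok_shiftStepT {m g p : ℕ} (h : p + p < W) : shiftStepT.ok W μ [2 ^ m, g, p] := by
  simp [shiftStepT, h]

theorem ok_powCodeT {m g i : ℕ} (h : ∀ j, powCode m g j < 2 ^ m) (hW : 2 ^ (m + 1) < W) :
    powCodeT.ok W μ [2 ^ m, g, i] := by
  rw [pow_succ] at hW
  have : 0 < 2 ^ m := by positivity
  simp [powCodeT]
  refine ⟨by omega, fun j _ => ok_shiftStepT ?_⟩
  have := h j
  unfold powCode at this
  omega

theorem ok_colT {s m g i : ℕ} (h : ∀ j, powCode m g j < 2 ^ m) (hW : 2 ^ (m + 1) < W)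
    (h1 : i * (2 * s) < W) (h2 : m * (2 * s) < W) (h3 : 2 ^ (m * (2 * s)) < W)
    (h4 : 2 * s < W) : (colT s).ok W μ [m, 2 ^ m, g, i] := by
  have : 0 < 2 ^ m := by positivity
  simp [colT, ok_powCodeT h hW]
  refine ⟨h4, by omega, fun j hj => ⟨⟨⟨by omega, by omega⟩, ?_⟩, ?_, ?_⟩⟩
  · exact (Nat.mul_le_mul_left i hj).trans_lt h1
  · exact (Nat.mul_le_mul_left m hj.le).trans_lt h2
  · refine lt_of_lt_of_le ?_ h3.le
    rw [Nat.shiftLeft_eq]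
    calc powCode m g (i * (j + 1)) * 2 ^ (m * j) < 2 ^ m * 2 ^ (m * j) :=
          Nat.mul_lt_mul_of_pos_right (h _) (by positivity)
      _ = 2 ^ (m * (j + 1)) := by rw [← pow_add]; congr 1; ring
      _ ≤ _ := Nat.pow_le_pow_right (by omega) (Nat.mul_le_mul_left _ hj)

theorem ok_hornerT {s x : ℕ} (h : ∑ j ∈ Finset.range (2 * s + 3), x ^ j < W)
    (hs : 2 * s + 3 < W) : (hornerT s).ok W μ [x] := by
  have key : ∀ k, iter (fun _ y => y * x + 1) 0 k * x + 1 = ∑ j ∈ Finset.range (k + 1), x ^ j := by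
    intro k
    induction k with
    | zero => simp [iter]
    | succ k ih =>
      rw [iter, ih, Finset.sum_range_succ' _ (k + 1), Finset.sum_mul]
      simp [pow_succ]
  simp [hornerT]
  refine ⟨by omega, by omega, fun i hi => ?_⟩
  have h1 := key i
  have h2 := sum_range_mono (fun j => x ^ j) (show i + 1 ≤ 2 * s + 3 by omega)
  omega

theorem ok_weightT {s K i : ℕ} (h : weight s K i < W) (hs : 2 * s + 3 < W) (hi : i + 1 < W) :
    (weightT s).ok W μ [K, i] := by
  have key : ∀ k, iter (fun l x => x + ∑ j ∈ Finset.range (2 * s + 3), (l * K) ^ j) 0 k =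
      ∑ l ∈ Finset.range k, ∑ j ∈ Finset.range (2 * s + 3), (l * K) ^ j := by
    intro k
    induction k with
    | zero => rfl
    | succ k ih => rw [iter, ih]; exact (Finset.sum_range_succ _ _).symm
  have hterm : ∀ l < i + 1, ∑ j ∈ Finset.range (2 * s + 3), (l * K) ^ j ≤ weight s K i := fun l hl =>
    Finset.single_le_sum (f := fun l => ∑ j ∈ Finset.range (2 * s + 3), (l * K) ^ j)
      (fun _ _ => Nat.zero_le _) (Finset.mem_range.2 hl)
  simp only [weightT, ok_fold, ok_add, ok_var, ok_lit, ok_call, okArgs, ok_mul, eval_add, eval_var,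
    eval_lit, eval_call, evalArgs, eval_mul, List.cons_append, List.nil_append,
    List.getD_cons_succ, List.getD_cons_zero, eval_hornerT, key, List.length_cons, List.length_nil]
  refine ⟨⟨by omega, by omega, hi⟩, by omega, fun l hl => ⟨by omega, ⟨⟨⟨by omega, by omega, ?_⟩, trivial⟩,
    ok_hornerT ((hterm l hl).trans_lt h) hs⟩, ?_⟩⟩
  · have : (l * K) ^ 1 ≤ ∑ j ∈ Finset.range (2 * s + 3), (l * K) ^ j :=
      Finset.single_le_sum (f := fun j => (l * K) ^ j) (fun _ _ => Nat.zero_le _)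
        (Finset.mem_range.2 (by omega))
    have := hterm l hl
    rw [pow_one] at *
    omega
  · have h2 := sum_range_mono (fun l => ∑ j ∈ Finset.range (2 * s + 3), (l * K) ^ j)
      (show l + 1 ≤ i + 1 from hl)
    rw [Finset.sum_range_succ] at h2
    exact h2.trans_lt h

theorem ok_digitT {n e l : ℕ} (h : (n + 1) ^ l < W) (hn : n + 1 < W) :
    digitT.ok W μ [n, e, l] := by
  simp [digitT, ok_powT (show 0 < n + 1 by omega) h]
  omega

theorem ok_toggleT {s n e i : ℕ} (h : (n + 1) ^ s < W) (hn : n + 1 < W) (hs : s < W) :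
    (toggleT s).ok W μ [n, e, i] := by
  simp [toggleT]
  refine ⟨hs, by omega, fun l hl => ok_digitT ?_ hn⟩
  exact (Nat.pow_le_pow_right (by omega) hl.le).trans_lt h

theorem ok_patT {s n A e : ℕ} (h : (n + 1) ^ s < W) (hn : n + 1 < W) (hs : s < W)
    (hA : A + n < W) : (patT s).ok W μ [n, A, e] := by
  simp [patT]
  refine ⟨hs, by omega, fun l hl => ⟨ok_digitT ?_ hn, ?_⟩⟩
  · exact (Nat.pow_le_pow_right (by omega) hl.le).trans_lt h
  · have := digit_le n e l
    omega

theorem ok_delT {s n X d e j : ℕ} (h : (n + 1) ^ s < W) (hn : n + 1 < W) (hs : s < W)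
    (hj : X + j + 1 < W) : (delT s).ok W μ [n, X, d, e, j] := by
  simp [delT, ok_toggleT h hn hs]
  refine ⟨fun _ => ⟨by omega, by omega⟩, ?_⟩
  split_ifs <;> omega

theorem ok_insT {s n X d e p b i : ℕ} (h : (n + 1) ^ s < W) (hn : n + 1 < W) (hs : s < W)
    (hi : X + i + 1 < W) : (insT s).ok W μ [n, X, d, e, p, b, i] := by
  simp [insT, ok_delT h hn hs hi, ok_delT h hn hs (show X + (i - 1) + 1 < W by omega)]
  omega

theorem ok_findT {s n X d e p b A T : ℕ} (h : (n + 1) ^ s < W) (hn : n + 1 < W) (hs : s < W)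
    (hX : X + n < W) (hA : A + n < W)
    (hT : T + syndrome n (fun i => μ (A + i))
      (insBit (delBit s n (fun i => μ (X + i)) d e) p b) < W) :
    (findT s).ok W μ [n, X, d, e, p, b, A, T] := by
  have := fun i => ok_insT (μ := μ) (d := d) (e := e) (p := p) (b := b) (i := i) h hn hs (X := X)
  unfold syndrome at hT
  simp [findT, hT]
  exact ⟨by omega, fun i hi => ⟨this i (by omega), fun _ => by omega⟩⟩

theorem ok_patchT {s n X d e p b f i : ℕ} (h : (n + 1) ^ s < W) (hn : n + 1 < W) (hs : s < W)
    (hi : X + i + 1 < W) : (patchT s).ok W μ [n, X, d, e, p, b, f, i] := by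
  simp [patchT, ok_toggleT h hn hs, ok_insT h hn hs hi]

theorem ok_patchSumT {s n X d e p b f V : ℕ} (h : (n + 1) ^ s < W) (hn : n + 1 < W) (hs : s < W)
    (hX : X + n < W) (hV : V + n < W) (hsum : ∑ i ∈ Finset.range n, μ (V + i) < W) :
    (patchSumT s).ok W μ [n, X, d, e, p, b, f, V] := by
  have h1 := fun i => ok_patchT (μ := μ) (d := d) (e := e) (p := p) (b := b) (f := f) (i := i) h hn hs (X := X)
  simp [patchSumT]
  refine ⟨by omega, fun i hi => ⟨h1 i (by omega), fun _ => ⟨by omega, ?_⟩⟩⟩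
  have h2 := iter_le_sum (patched s n (delBit s n (fun i => μ (X + i)) d e) p b f)
    (fun i => μ (V + i)) i
  have h3 := sum_range_mono (fun i => μ (V + i)) (show i + 1 ≤ n from hi)
  rw [Finset.sum_range_succ] at h3
  omega

theorem ok_sumT {n X V : ℕ} (hX : X + n < W) (hV : V + n < W)
    (hsum : ∑ i ∈ Finset.range n, μ (V + i) < W) : sumT.ok W μ [n, X, V] := by
  simp [sumT]
  refine ⟨by omega, fun i hi => ⟨by omega, fun _ => ⟨by omega, ?_⟩⟩⟩
  have h2 := iter_le_sum (fun i => μ (X + i)) (fun i => μ (V + i)) i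
  have h3 := sum_range_mono (fun i => μ (V + i)) (show i + 1 ≤ n from hi)
  rw [Finset.sum_range_succ] at h3
  omega

theorem ok_diffT {s n X d e p b A T V F : ℕ} (h : (n + 1) ^ s < W) (hn : n + 1 < W) (hs : s < W)
    (hX : X + n < W) (hA : A + n < W)
    (hT : T + syndrome n (fun i => μ (A + i))
      (insBit (delBit s n (fun i => μ (X + i)) d e) p b) < W)
    (hV : V + n < W) (hsum : ∑ i ∈ Finset.range n, μ (V + i) < W) (hF : F < W) :
    (diffT s).ok W μ [n, X, d, e, p, b, A, T, V, F] := by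
  have h1 := fun f => ok_patchSumT (μ := μ) (d := d) (e := e) (p := p) (b := b) (f := f) h hn hs hX hV hsum
  simp [diffT, ok_findT h hn hs hX hA hT, h1]
  refine ⟨fun _ => ⟨by omega, ?_⟩, fun _ => by omega⟩
  have h2 := fun f => iter_le_sum (patched s n (delBit s n (fun i => μ (X + i)) d e) p b f)
    (fun i => μ (V + i)) n
  generalize μ (T + syndrome n (fun i => μ (A + i))
      (insBit (delBit s n (fun i => μ (X + i)) d e) p b)) - 1 = f
  have h3 := h2 f
  omega

theorem ok_testT {s n X d e p b A T V a r : ℕ} (h : (n + 1) ^ s < W) (hn : n + 1 < W) (hs : s < W)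
    (hX : X + n < W) (hA : A + n < W)
    (hT : T + syndrome n (fun i => μ (A + i))
      (insBit (delBit s n (fun i => μ (X + i)) d e) p b) < W)
    (hV : V + n < W) (hsum : ∑ i ∈ Finset.range n, μ (V + i) < W) :
    (testT s).ok W μ [n, X, d, e, p, b, A, T, V, a, r] := by
  have h1 := fun f => ok_patchSumT (μ := μ) (d := d) (e := e) (p := p) (b := b) (f := f) h hn hs hX hV hsum
  simp [testT, ok_findT h hn hs hX hA hT, h1]
  exact ⟨fun _ => by omega, fun _ => by omega⟩

theorem ok_countT {L N a : ℕ} (h : L + N < W) (h1 : N + 1 < W) : countT.ok W μ [L, N, a] := by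
  simp [countT]
  refine ⟨by omega, fun i hi => ⟨by omega, fun _ => ⟨by omega, fun _ => ⟨by omega, ?_⟩⟩⟩⟩
  refine lt_of_le_of_lt (Nat.succ_le_succ (countMultiples_le (fun l => μ (L + l)) i a)) ?_
  omega

theorem ok_nextT {L N b r a : ℕ} (h : L + N < W) (h1 : N + 1 < W) (hb : 2 ^ b < W)
    (ha : a * 2 ^ b < W) (hr : N * 2 ^ r < W) : nextT.ok W μ [L, N, b, r, a] := by
  have : 0 < 2 ^ b := by positivity
  simp [nextT, ok_countT h h1, Nat.one_shiftLeft]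
  refine ⟨⟨by omega, hb⟩, by omega, fun q hq _ => ⟨?_, ?_⟩⟩
  · exact (Nat.mul_le_mul_left a hq.le).trans_lt ha
  · rw [Nat.shiftLeft_eq]
    exact (Nat.mul_le_mul_right _ (countMultiples_le _ _ _)).trans_lt hr

/-- The largest number formed in round `i` is the current modulus times a trial factor, at most `2 ^
((i + 1) * b)`. -/
theorem ok_modulusT {t L N b r : ℕ} (h : L + N < W) (h1 : N + 1 < W) (ht : t < W) (hb : 0 < b)
    (hbt : 2 ^ (t * b) < W) (hr : N * 2 ^ r < W) : (modulusT t).ok W μ [L, N, b, r] := by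
  simp [modulusT]
  refine ⟨ht, by omega, fun i hi => ?_⟩
  have h2 := modulus_le (fun l => μ (L + l)) N b r i hb
  have h3 : (2 ^ b - 1) ^ i ≤ (2 ^ b) ^ i := Nat.pow_le_pow_left (Nat.sub_le _ _) _
  have h4 : modulus (fun l => μ (L + l)) N b r i * 2 ^ b < W := by
    calc _ ≤ (2 ^ b) ^ i * 2 ^ b := Nat.mul_le_mul_right _ (h2.trans h3)
      _ = 2 ^ ((i + 1) * b) := by rw [← pow_succ, ← pow_mul, mul_comm]
      _ ≤ 2 ^ (t * b) := Nat.pow_le_pow_right (by omega) (Nat.mul_le_mul_right _ hi)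
      _ < W := hbt
  unfold modulus at h4
  refine ⟨ok_nextT h h1 ?_ h4 hr, ?_⟩
  · refine lt_of_le_of_lt (Nat.pow_le_pow_right (by omega) ?_) hbt
    exact Nat.le_mul_of_pos_left b (by omega)
  · refine lt_of_le_of_lt (Nat.mul_le_mul_left _ ?_) h4
    exact (nextFactor_pos_lt _ _ _ _ _ hb).2.le

theorem ok_numberT {X k : ℕ} (hX : X + k < W) (hk : 2 ^ k < W) (h : ∀ i < k, μ (X + i) ≤ 1) :
    numberT.ok W μ [X, k] := by
  have key : ∀ i ≤ k, iter (fun i x => x + μ (X + i) <<< i) 0 i < 2 ^ i := by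
    intro i
    induction i with
    | zero => intro _; simp [iter]
    | succ i ih =>
      intro hi
      rw [iter, pow_succ, Nat.shiftLeft_eq]
      have h1 := ih (by omega)
      have h2 := Nat.mul_le_mul_right (2 ^ i) (h i (by omega))
      omega
  simp [numberT]
  refine ⟨by omega, fun i hi => ⟨⟨by omega, ?_⟩, ?_⟩⟩
  · rw [Nat.shiftLeft_eq]
    refine lt_of_le_of_lt (Nat.mul_le_mul_right _ (h i hi)) ?_
    rw [one_mul]
    exact (Nat.pow_le_pow_right (by omega) hi.le).trans_lt hk
  · have := key (i + 1) hi
    rw [iter] at this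
    exact this.trans (lt_of_le_of_lt (Nat.pow_le_pow_right (by omega) hi) hk)

end Term
end WordRAM

/-! ### Costs of the terms -/

namespace WordRAM
namespace Term

variable (μ : ℕ → ℕ)

theorem cost_powT (b k : ℕ) : powT.cost μ [b, k] ≤ 8 * k + 7 := by
  refine (cost_fold_le μ _ _ _ _ (N := k) (T := 3) (by simp) (fun i _ x => by simp)).trans ?_
  simp
  omega

theorem cost_logT (n : ℕ) : logT.cost μ [n] ≤ 20 * n + 10 := by
  refine (cost_fold_le μ _ _ _ _ (N := n) (T := 15) (by simp)
    (fun i _ x => (cost_ite_le _ _ _ _ _).trans (by simp))).trans ?_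
  simp
  omega

theorem cost_gainT (n : ℕ) : gainT.cost μ [n] ≤ 20 * n + 20 := by
  have := cost_logT μ n
  simp [gainT]
  omega

theorem cost_factorT (c n : ℕ) : (factorT c).cost μ [n] ≤ 40 * n + 80 := by
  have h1 := cost_logT μ n
  have h2 := cost_logT μ (Nat.log 2 n + 1)
  have h3 := Nat.log_le_self 2 n
  simp [factorT]
  omega

theorem cost_shiftStepT (M g p : ℕ) : shiftStepT.cost μ [M, g, p] ≤ 15 := by
  rw [shiftStepT, cost_bind]
  refine (Nat.add_le_add_right (Nat.add_le_add_left (cost_ite_le _ _ _ _ _) _) _).trans ?_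
  simp

theorem cost_powCodeT (M g i : ℕ) : powCodeT.cost μ [M, g, i] ≤ 30 * i + 10 := by
  refine (cost_fold_le μ _ _ _ _ (N := i) (T := 25) (by simp) (fun j _ x => ?_)).trans ?_
  · have := cost_shiftStepT μ M g x
    simp
    omega
  · simp
    omega

/-- A bound for the cost of `colT`, up to a linear factor. -/
def colCost (s : ℕ) : ℕ := 2 * s * (60 * s + 60) + 10

/-- The powers of `X` come from repeated shifts, one per exponent step, so a column costs time
linear in its index. -/
theorem cost_colT (s m M g i : ℕ) : (colT s).cost μ [m, M, g, i] ≤ colCost s * (i + 1) := by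
  refine (cost_fold_le μ _ _ _ _ (N := 2 * s) (T := 60 * s * i + 40) (by simp)
    (fun j hj x => ?_)).trans ?_
  · have h1 := cost_powCodeT μ M g (i * (j + 1))
    simp at hj
    have h2 : i * (j + 1) ≤ i * (2 * s) := Nat.mul_le_mul_left _ hj
    simp
    nlinarith
  · simp [colCost]
    nlinarith

theorem cost_hornerT (s x : ℕ) : (hornerT s).cost μ [x] ≤ 20 * s + 50 := by
  refine (cost_fold_le μ _ _ _ _ (N := 2 * s + 3) (T := 5) (by simp)
    (fun j hj x => by simp)).trans ?_
  simp
  omega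

theorem cost_weightT (s K i : ℕ) : (weightT s).cost μ [K, i] ≤ (20 * s + 80) * (i + 1) := by
  refine (cost_fold_le μ _ _ _ _ (N := i + 1) (T := 20 * s + 60) (by simp)
    (fun j hj x => ?_)).trans ?_
  · have := cost_hornerT μ s (j * K)
    simp
    omega
  · simp
    nlinarith

theorem cost_digitT (n e l : ℕ) : digitT.cost μ [n, e, l] ≤ 8 * l + 30 := by
  have := cost_powT μ (n + 1) l
  simp [digitT]
  omega

/-- A bound for the cost of `toggleT` and `patT`. -/
def toggleCost (s : ℕ) : ℕ := s * (8 * s + 60) + 10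

theorem cost_toggleT (s n e i : ℕ) : (toggleT s).cost μ [n, e, i] ≤ toggleCost s := by
  refine (cost_fold_le μ _ _ _ _ (N := s) (T := 8 * s + 50) (by simp)
    (fun j hj x => ?_)).trans ?_
  · have := cost_digitT μ n e j
    simp at hj
    simp
    omega
  · simp [toggleCost]
    nlinarith

theorem cost_patT (s n A e : ℕ) : (patT s).cost μ [n, A, e] ≤ toggleCost s := by
  refine (cost_fold_le μ _ _ _ _ (N := s) (T := 8 * s + 50) (by simp)
    (fun j hj x => ?_)).trans ?_
  · have := cost_digitT μ n e j
    simp at hj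
    simp
    omega
  · simp [toggleCost]
    nlinarith

theorem cost_delT (s n X d e j : ℕ) : (delT s).cost μ [n, X, d, e, j] ≤ toggleCost s + 25 := by
  have h1 := cost_toggleT μ s n e j
  have h2 := cost_ite_le μ [n, X, d, e, j] (var 4) (var 4 + lit 1) (bin .lt (var 4) (var 2))
  simp at h2
  simp [delT]
  omega

theorem cost_insT (s n X d e p b i : ℕ) :
    (insT s).cost μ [n, X, d, e, p, b, i] ≤ 2 * toggleCost s + 100 := by
  have h1 := cost_delT μ s n X d e i
  have h2 := cost_delT μ s n X d e (i - 1)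
  refine (cost_ite_le _ _ _ _ _).trans ?_
  have h3 := cost_ite_le μ [n, X, d, e, p, b, i] (var 5)
      (call (delT s) [var 0, var 1, var 2, var 3, var 6 - lit 1]) (bin .eq (var 6) (var 4))
  simp at h3
  simp
  omega

theorem cost_findT (s n X d e p b A T : ℕ) :
    (findT s).cost μ [n, X, d, e, p, b, A, T] ≤ (2 * toggleCost s + 200) * (n + 1) := by
  rw [findT, cost_get, cost_add]
  have := cost_fold_le μ [n, X, d, e, p, b, A, T] (var 0) (lit 0)
    (ite (call (insT s) [var 0, var 1, var 2, var 3, var 4, var 5, var 8])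
      (var 9 ^^^ get (var 6 + var 8)) (var 9)) (N := n) (T := 2 * toggleCost s + 150) (by simp)
    (fun i _ x => (cost_ite_le _ _ _ _ _).trans (by
      have h1 := cost_insT μ s n X d e p b i
      simp
      omega))
  simp only [cost_var, cost_lit] at this ⊢
  nlinarith

theorem cost_patchT (s n X d e p b f i : ℕ) :
    (patchT s).cost μ [n, X, d, e, p, b, f, i] ≤ 3 * toggleCost s + 150 := by
  have h1 := cost_insT μ s n X d e p b i
  have h2 := cost_toggleT μ s n f i
  simp [patchT]
  omega

theorem cost_patchSumT (s n X d e p b f V : ℕ) :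
    (patchSumT s).cost μ [n, X, d, e, p, b, f, V] ≤ (3 * toggleCost s + 250) * (n + 1) := by
  refine (cost_fold_le μ _ _ _ _ (N := n) (T := 3 * toggleCost s + 200) (by simp)
    (fun i _ x => (cost_ite_le _ _ _ _ _).trans (by
      have h1 := cost_patchT μ s n X d e p b f i
      simp
      omega))).trans ?_
  simp
  nlinarith

theorem cost_sumT (n X V : ℕ) : sumT.cost μ [n, X, V] ≤ 30 * (n + 1) := by
  refine (cost_fold_le μ _ _ _ _ (N := n) (T := 25) (by simp)
    (fun i _ x => (cost_ite_le _ _ _ _ _).trans (by simp))).trans ?_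
  simp
  omega

theorem cost_diffT (s n X d e p b A T V F : ℕ) :
    (diffT s).cost μ [n, X, d, e, p, b, A, T, V, F] ≤ (5 * toggleCost s + 600) * (n + 1) := by
  have h1 := cost_findT μ s n X d e p b A T
  have h2 := fun f => cost_patchSumT μ s n X d e p b f V
  rw [diffT, cost_bind]
  refine (Nat.add_le_add_right (Nat.add_le_add_left (cost_ite_le _ _ _ _ _) _) _).trans ?_
  simp
  generalize μ (T + syndrome n (fun i => μ (A + i))
      (insBit (delBit s n (fun i => μ (X + i)) d e) p b)) - 1 = f
  have h3 := h2 f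
  nlinarith

theorem cost_testT (s n X d e p b A T V a r : ℕ) :
    (testT s).cost μ [n, X, d, e, p, b, A, T, V, a, r] ≤ (5 * toggleCost s + 600) * (n + 1) := by
  have h1 := cost_findT μ s n X d e p b A T
  have h2 := fun f => cost_patchSumT μ s n X d e p b f V
  rw [testT, cost_bind]
  refine (Nat.add_le_add_right (Nat.add_le_add_left (cost_ite_le _ _ _ _ _) _) _).trans ?_
  simp
  generalize μ (T + syndrome n (fun i => μ (A + i))
      (insBit (delBit s n (fun i => μ (X + i)) d e) p b)) - 1 = f
  have h3 := h2 f
  nlinarith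

theorem cost_countT (L N a : ℕ) : countT.cost μ [L, N, a] ≤ 40 * (N + 1) := by
  refine (cost_fold_le μ _ _ _ _ (N := N) (T := 30) (by simp)
    (fun i _ x => (cost_ite_le _ _ _ _ _).trans ?_)).trans ?_
  · have := cost_ite_le μ ([L, N, a] ++ [i, x]) (var 4) (var 4 + lit 1) (get (var 0 + var 3) % var 2)
    simp at this
    simp
    omega
  · simp
    omega

theorem cost_nextT (L N b r a : ℕ) :
    nextT.cost μ [L, N, b, r, a] ≤ 200 * ((N + 1) * (2 ^ b + 1)) := by
  have h0 := cost_countT μ L N a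
  have h1 := cost_fold_le μ [L, N, b, r, a, countMultiples (fun l => μ (L + l)) N a]
    (lit 1 <<< var 2) (lit 1) (ite (var 6)
    (ite (bin .lt (var 5) (call countT [var 0, var 1, var 4 * var 6] <<< var 3)) (var 7) (var 6))
    (var 7)) (N := 2 ^ b) (T := 40 * (N + 1) + 50) (by simp [Nat.one_shiftLeft])
    (fun i _ x => (cost_ite_le _ _ _ _ _).trans (by
      have h2 := cost_countT μ L N (a * i)
      have h3 := cost_ite_le μ ([L, N, b, r, a, countMultiples (fun l => μ (L + l)) N a] ++ [i, x])
        (var 7) (var 6) (bin .lt (var 5) (call countT [var 0, var 1, var 4 * var 6] <<< var 3))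
      simp at h3
      simp
      omega))
  rw [nextT, cost_bind]
  simp at h1 ⊢
  nlinarith [Nat.zero_le (N * 2 ^ b), Nat.zero_le (2 ^ b)]

theorem cost_modulusT (t L N b r : ℕ) :
    (modulusT t).cost μ [L, N, b, r] ≤ 300 * (t + 1) * ((N + 1) * (2 ^ b + 1)) := by
  refine (cost_fold_le μ _ _ _ _ (N := t) (T := 200 * ((N + 1) * (2 ^ b + 1)) + 20) (by simp)
    (fun i _ x => ?_)).trans ?_
  · have := cost_nextT μ L N b r x
    simp
    omega
  · have : 1 ≤ (N + 1) * (2 ^ b + 1) := Nat.one_le_iff_ne_zero.2 (by positivity)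
    simp
    nlinarith

theorem cost_numberT (X k : ℕ) : numberT.cost μ [X, k] ≤ 20 * (k + 1) := by
  refine (cost_fold_le μ _ _ _ _ (N := k) (T := 10) (by simp) (fun i _ x => by simp)).trans ?_
  simp
  omega

end Term
end WordRAM

/-! ### Tables in memory -/

namespace WordRAM

/-- Store `val i` at `addr i`, for `i < N`. -/
def scatter (addr val : ℕ → ℕ) (N : ℕ) (μ : ℕ → ℕ) : ℕ → ℕ :=
  iter (fun i ν => Function.update ν (addr i) (val i)) μ N

theorem scatter_of_ne {addr val : ℕ → ℕ} {N : ℕ} {μ : ℕ → ℕ} {x : ℕ} (h : ∀ i < N, x ≠ addr i) :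
    scatter addr val N μ x = μ x := by
  unfold scatter
  induction N with
  | zero => rfl
  | succ N ih => rw [iter, Function.update_of_ne (h N (by omega)), ih fun i hi => h i (by omega)]

theorem scatter_add {val : ℕ → ℕ} {N lo : ℕ} {μ : ℕ → ℕ} {i : ℕ} (hi : i < N) :
    scatter (fun i => lo + i) val N μ (lo + i) = val i := by
  unfold scatter
  induction N with
  | zero => omega
  | succ N ih =>
    rw [iter]
    beta_reduce
    rcases Nat.lt_succ_iff_lt_or_eq.1 hi with h | h
    · rw [Function.update_of_ne (by omega), ih h]
    · subst h; simp

theorem scatter_id {val : ℕ → ℕ} {N : ℕ} {μ : ℕ → ℕ} {i : ℕ} (hi : i < N) :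
    scatter (fun i => i) val N μ i = val i := by
  have := scatter_add (lo := 0) (val := val) (μ := μ) hi
  simpa using this

/-- Later writes win, just as `lookup` returns the last index. The shift by one makes `0` mean an
empty cell, so a table in untouched memory needs no initialization, although its index range is far
larger than the number of patterns. -/
theorem scatter_lookup {h : ℕ → ℕ} {N lo S : ℕ} {μ : ℕ → ℕ} (h0 : μ (lo + S) = 0) :
    scatter (fun e => lo + h e) (fun e => e + 1) N μ (lo + S) = lookup h S N := by
  unfold scatter
  induction N with
  | zero => exact h0
  | succ N ih =>
    rw [iter, lookup]
    beta_reduce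
    split_ifs with h1
    · rw [h1]; simp
    · rw [Function.update_of_ne (by omega), ih]

namespace Cmd

/-- Without overflow and within `T` steps the command changes the memory from `μ` to `ν`. -/
structure Does (W : ℕ) (c : Cmd) (E : List ℕ) (μ ν : ℕ → ℕ) (T : ℕ) : Prop where
  ok : c.ok W E μ
  run : c.run E μ = ν
  cost : c.cost E μ ≤ T

variable {W : ℕ} {E : List ℕ} {μ ν ξ : ℕ → ℕ}

theorem Does.seq {p q : Cmd} {T U : ℕ} (hp : p.Does W E μ ν T) (hq : q.Does W E ν ξ U) :
    (p.seq q).Does W E μ ξ (T + U) :=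
  ⟨⟨hp.ok, by rw [hp.run]; exact hq.ok⟩, by rw [Cmd.run, hp.run, hq.run],
    by rw [Cmd.cost, hp.run]; exact Nat.add_le_add hp.cost hq.cost⟩

theorem Does.bind {a : Term} {p : Cmd} {v T U : ℕ} (ho : a.ok W μ E) (hv : a.eval μ E = v)
    (hT : a.cost μ E ≤ T) (hp : p.Does W (E ++ [v]) μ ν U) :
    (p.bind a).Does W E μ ν (T + U + 1) := by
  subst hv
  exact ⟨⟨ho, hp.ok⟩, hp.run, by rw [Cmd.cost]; exact Nat.succ_le_succ (Nat.add_le_add hT hp.cost)⟩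

theorem Does.mono {p : Cmd} {T U : ℕ} (hp : p.Does W E μ ν T) (h : T ≤ U) : p.Does W E μ ν U :=
  ⟨hp.ok, hp.run, hp.cost.trans h⟩

/-- The loop writes only between `lo` and `hi`. If the address and the value computed in each round
are the same in every memory that agrees with `μ` outside this interval, no invariant is needed. -/
theorem Does.loop_put {n a v : Term} {N T₀ T : ℕ} (addr val : ℕ → ℕ) (lo hi : ℕ)
    (hno : n.ok W μ E) (hn : n.eval μ E = N) (hnc : n.cost μ E ≤ T₀)
    (haddr : ∀ i < N, lo ≤ addr i ∧ addr i < hi)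
    (h : ∀ i < N, ∀ ν : ℕ → ℕ, (∀ x, x < lo ∨ hi ≤ x → ν x = μ x) →
      a.ok W ν (E ++ [i]) ∧ v.ok W ν (E ++ [i]) ∧ a.eval ν (E ++ [i]) = addr i ∧
      v.eval ν (E ++ [i]) = val i ∧ a.cost ν (E ++ [i]) + v.cost ν (E ++ [i]) ≤ T) :
    (loop n (put a v)).Does W E μ (scatter addr val N μ) (T₀ + N * (T + 5) + 3) := by
  subst hn
  have hsc : ∀ k ≤ n.eval μ E, iter (fun i => Cmd.run (put a v) (E ++ [i])) μ k =
      scatter addr val k μ ∧ ∀ x, x < lo ∨ hi ≤ x → scatter addr val k μ x = μ x := by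
    intro k
    induction k with
    | zero => intro _; exact ⟨rfl, fun _ _ => rfl⟩
    | succ k ih =>
      intro hk
      obtain ⟨h1, h2⟩ := ih (by omega)
      obtain ⟨-, -, h3, h4, -⟩ := h k (by omega) _ h2
      have e : scatter addr val (k + 1) μ =
        Function.update (scatter addr val k μ) (addr k) (val k) := rfl
      refine ⟨?_, fun x hx => ?_⟩
      · rw [iter, h1, Cmd.run, h3, h4, e]
      · have := haddr k (by omega)
        rw [e, Function.update_of_ne (by omega), h2 x hx]
  refine ⟨⟨hno, fun i hi => ?_⟩, ?_, ?_⟩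
  · obtain ⟨h1, h2⟩ := hsc i hi.le
    rw [h1]
    obtain ⟨h3, h4, -⟩ := h i hi _ h2
    exact ⟨h3, h4⟩
  · rw [Cmd.run, (hsc _ le_rfl).1]
  · rw [Cmd.cost]
    have : ∀ i ∈ Finset.range (n.eval μ E), Cmd.cost (put a v) (E ++ [i])
        (iter (fun i => Cmd.run (put a v) (E ++ [i])) μ i) + 4 ≤ T + 5 := by
      intro i hi
      rw [Finset.mem_range] at hi
      obtain ⟨h1, h2⟩ := hsc i hi.le
      obtain ⟨-, -, -, -, h3⟩ := h i hi _ h2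
      rw [h1, Cmd.cost]
      omega
    have := Finset.sum_le_card_nsmul _ _ _ this
    rw [Finset.card_range, smul_eq_mul] at this
    omega

end Cmd

open Term Cmd

/-- The columns of the parity check matrix, followed by zeros. -/
def columns (s m g n i : ℕ) : ℕ := if i < n then colCode s m g i else 0

/-- The base in which the moments are the digits of the checksum. -/
def momentBase (s n : ℕ) : ℕ := (n + 1) ^ (2 * s + 4)

/-- The number of factors of the modulus. -/
def stages (s : ℕ) : ℕ := 2 * (s + 2)

/-- The memory after the preparation, where `μ₀` is the memory before, and the regions of the
memory have length `U`. -/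
structure Prepared (s m g n U : ℕ) (μ₀ μ : ℕ → ℕ) : Prop where
  input : ∀ x < U, μ x = μ₀ x
  col : ∀ i ≤ n, μ (U + i) = columns s m g n i
  weight : ∀ i < n, μ (2 * U + i) = weight s (momentBase s n) i
  table : ∀ S, μ (5 * U + S) = lookup (patSyndrome s n (columns s m g n)) S ((n + 1) ^ s)

/-- The words of the machine, below `W`, are large enough. -/
structure Room (s c m g n U W : ℕ) : Prop where
  pos : 0 < n
  code : ∀ j, powCode m g j < 2 ^ m
  lit : 2 * s + 10 < W
  field : 2 ^ (m + 1) < W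
  index : n * (2 * s) < W
  shift : m * (2 * s) < W
  region : 6 * U + 2 ^ (m * (2 * s)) + 10 ≤ W
  base : momentBase s n < W
  sum : ∑ i ∈ Finset.range n, weight s (momentBase s n) i < W
  patterns : (n + 1) ^ s < U
  pow : (n + 1) ^ (s + 2) ≤ U
  candidates : 2 * n ^ 2 * (n + 1) ^ s + 2 < U
  small : 2 * n + c + 10 < U
  input : 4 + 2 * stages s * factorLen c n + n < U
  hash : 2 ^ (2 * stages s * factorLen c n) < W
  gain : 2 * n ^ 2 * (n + 1) ^ s * 2 ^ gainLen n < W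

theorem iter_xor_lt {K : ℕ} (f : ℕ → ℕ) (N : ℕ) (hf : ∀ i < N, f i < 2 ^ K) :
    iter (fun i x => x ^^^ f i) 0 N < 2 ^ K := by
  induction N with
  | zero => exact Nat.two_pow_pos K
  | succ N ih => exact Nat.xor_lt_two_pow (ih fun i hi => hf i (by omega)) (hf N (by omega))

theorem syndrome_lt {K n : ℕ} (C z : ℕ → ℕ) (hC : ∀ i < n, C i < 2 ^ K) :
    syndrome n C z < 2 ^ K := by
  unfold syndrome
  induction n with
  | zero => exact Nat.two_pow_pos K
  | succ N ih =>
    rw [iter]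
    split_ifs
    · exact ih fun i hi => hC i (by omega)
    · exact Nat.xor_lt_two_pow (ih fun i hi => hC i (by omega)) (hC N (by omega))

theorem syndrome_congr_columns {n : ℕ} {C C' z : ℕ → ℕ} (h : ∀ i < n, C i = C' i) :
    syndrome n C z = syndrome n C' z :=
  iter_congr fun i hi x => by rw [h i hi]

theorem patSyndrome_congr {s n : ℕ} {C C' : ℕ → ℕ} (h : ∀ i ≤ n, C i = C' i) (e : ℕ) :
    patSyndrome s n C e = patSyndrome s n C' e :=
  iter_congr fun i _ x => by rw [h _ (digit_le n e i)]

theorem columns_lt {s m g n : ℕ} (h : ∀ j, powCode m g j < 2 ^ m) (i : ℕ) :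
    columns s m g n i < 2 ^ (m * (2 * s)) := by
  unfold columns
  split_ifs
  · exact colCode_lt_of s m g h i
  · positivity

/-- Reads the parameters, fills the tables, and goes on with `k`. The variables of `k` are `n`, `m`,
`2 ^ m`, the polynomial, the base of the moments, and the length of the regions. -/
def prepare (s κ : ℕ) (k : Cmd) : Cmd :=
  .bind (get (lit 2)) (.bind (lit 1 <<< var 1) (.bind (get (lit 3))
  (.bind (call powT [var 0 + lit 1, lit (2 * s + 4)])
  (.bind (lit κ * call powT [var 0 + lit 1, lit (s + 2)])
  (.seq (.loop (var 0) (.put (var 5 + var 6) (call (colT s) [var 1, var 2, var 3, var 6])))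
  (.seq (.loop (var 0) (.put (lit 2 * var 5 + var 6) (call (weightT s) [var 4, var 6])))
  (.seq (.loop (call powT [var 0 + lit 1, lit s])
    (.put (lit 5 * var 5 + call (patT s) [var 0, var 5, var 6]) (var 6 + lit 1)))
  k)))))))

/-- The length of the regions of the memory. -/
def regionLen (s κ n : ℕ) : ℕ := κ * (n + 1) ^ (s + 2)

/-- A bound for the cost of the preparation. -/
def prepareCost (s : ℕ) : ℕ := colCost s + toggleCost s + 200 * s + 1000

/-- The memory consists of regions of length `U`: input, columns, weights, differences of checksums,
decoded word. The syndrome table starts at `5 * U` and comes last because its addresses extend over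
`2 ^ (m * (2 * s))` cells. The rest of the program is passed as `k` because the parameters are bound
only inside. -/
theorem prepare_does {s κ c m g n W T : ℕ} {k : Cmd} {μ : ℕ → ℕ} {Q : (ℕ → ℕ) → Prop}
    (R : Room s c m g n (regionLen s κ n) W) (hκ : κ < W) (hm : μ 2 = m) (hg : μ 3 = g)
    (h0 : ∀ x, regionLen s κ n ≤ x → μ x = 0)
    (hk : ∀ ν, Prepared s m g n (regionLen s κ n) μ ν →
      ∃ ξ, k.Does W [n, m, 2 ^ m, g, momentBase s n, regionLen s κ n] ν ξ T ∧ Q ξ) :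
    ∃ ξ, (prepare s κ k).Does W [n] μ ξ (prepareCost s * ((n + 1) ^ 2 + (n + 1) ^ s) + T) ∧ Q ξ := by
  set U := regionLen s κ n with hU
  obtain ⟨r1, r2, r3, r4, r5, r6, r7, r8, r9, r10, r11, r12, r13, r14, r15, r16⟩ := R
  have p1 : 0 < 2 ^ (m * (2 * s)) := by positivity
  have p2 : 2 ^ m < W := lt_of_le_of_lt (Nat.pow_le_pow_right (by omega) (by omega)) r4
  have q1 := cost_powT μ (n + 1) (2 * s + 4)
  have q2 := cost_powT μ (n + 1) (s + 2)
  let μ₁ := scatter (fun i => U + i) (fun i => colCode s m g i) n μ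
  let μ₂ := scatter (fun i => 2 * U + i) (fun i => weight s (momentBase s n) i) n μ₁
  let μ₃ := scatter (fun e => 5 * U + patSyndrome s n (columns s m g n) e) (fun e => e + 1)
    ((n + 1) ^ s) μ₂
  have hμ₁ : ∀ i ≤ n, μ₁ (U + i) = columns s m g n i := by
    intro i hi
    rcases Nat.eq_or_lt_of_le hi with h | h
    -- Column `n` belongs to the digit for no change; its cell is never written and keeps the
    -- initial zero.
    · subst h
      simp only [μ₁]
      rw [scatter_of_ne (fun j hj => by omega), h0 _ (by omega), columns, if_neg (by omega)]
    · simp only [μ₁]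
      rw [scatter_add h, columns, if_pos h]
  have hμ₂ : ∀ i ≤ n, μ₂ (U + i) = columns s m g n i := by
    intro i hi
    rw [← hμ₁ i hi]
    exact scatter_of_ne (fun j hj => by omega)
  have hprep : Prepared s m g n U μ μ₃ := by
    refine ⟨fun x hx => ?_, fun i hi => ?_, fun i hi => ?_, fun S => ?_⟩
    · simp only [μ₃, μ₂, μ₁]
      rw [scatter_of_ne (fun j hj => by omega), scatter_of_ne (fun j hj => by omega),
        scatter_of_ne (fun j hj => by omega)]
    · rw [← hμ₂ i hi]
      exact scatter_of_ne (fun j hj => by omega)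
    · simp only [μ₃, μ₂]
      rw [scatter_of_ne (fun j hj => by omega), scatter_add hi]
    · refine scatter_lookup ?_
      simp only [μ₂, μ₁]
      rw [scatter_of_ne (fun j hj => by omega), scatter_of_ne (fun j hj => by omega),
        h0 _ (by omega)]
  obtain ⟨ξ, hk, hQ⟩ := hk μ₃ hprep
  refine ⟨ξ, ?_, hQ⟩
  have hUκ : κ * (n + 1) ^ (s + 2) = U := rfl
  refine Does.mono (T := 2 + (3 + (2 + ((16 * s + 60) + ((8 * s + 60) + ((1 + n * ((colCost s * n + 20) + 5) + 3) +
      ((1 + n * (((20 * s + 80) * n + 20) + 5) + 3) + ((8 * s + 20 + (n + 1) ^ s *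
      ((toggleCost s + 40) + 5) + 3) + T))) + 1) + 1) + 1) + 1) + 1) ?_ ?_
  · refine .bind (by simp; omega) (by simpa using hm) (by simp) ?_
    refine .bind (by simp [Nat.one_shiftLeft]; omega) (v := 2 ^ m) (by simp [Nat.one_shiftLeft])
      (by simp) ?_
    refine .bind (by simp; omega) (by simpa using hg) (by simp) ?_
    refine .bind ?_ (v := momentBase s n) (by simp [momentBase]) (by simp; omega) ?_
    · have := ok_powT (μ := μ) (show 0 < n + 1 by omega) (show (n + 1) ^ (2 * s + 4) < W from r8)
      simp [this]
      omega
    refine .bind ?_ (v := U) (by simp [hUκ]) (by simp; omega) ?_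
    · have := ok_powT (μ := μ) (show 0 < n + 1 by omega)
        (show (n + 1) ^ (s + 2) < W from lt_of_le_of_lt r11 (by omega))
      simp [this, hUκ]
      omega
    refine .seq (ν := μ₁) (.loop_put _ _ U (U + n) (by simp) (by simp) (by simp)
      (fun i hi => by omega) (fun i hi ν hν => ?_)) ?_
    · have h1 := ok_colT (μ := ν) (i := i) r2 r4
        (lt_of_le_of_lt (Nat.mul_le_mul_right _ hi.le) r5) r6 (by omega) (by omega)
      have h2 := cost_colT ν s m (2 ^ m) g i
      have h3 : colCost s * (i + 1) ≤ colCost s * n := Nat.mul_le_mul_left _ hi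
      refine ⟨by simp; omega, by simpa using h1, by simp, by simp, by simp; omega⟩
    refine .seq (ν := μ₂) (.loop_put _ _ (2 * U) (2 * U + n) (by simp) (by simp) (by simp)
      (fun i hi => by omega) (fun i hi ν hν => ?_)) ?_
    · have h1 := ok_weightT (μ := ν) (s := s) (K := momentBase s n) (i := i) (W := W)
        (lt_of_le_of_lt (Finset.single_le_sum (f := fun i => weight s (momentBase s n) i)
          (fun _ _ => Nat.zero_le _) (Finset.mem_range.2 hi)) r9) (by omega) (by omega)
      have h2 := cost_weightT ν s (momentBase s n) i
      have h3 : (20 * s + 80) * (i + 1) ≤ (20 * s + 80) * n := Nat.mul_le_mul_left _ hi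
      refine ⟨by simp; omega, by simpa using h1, by simp, by simp, by simp; omega⟩
    refine .seq (ν := μ₃) (.loop_put _ _ (5 * U) (5 * U + 2 ^ (m * (2 * s))) ?_ (by simp) ?_
      (fun i hi => ⟨by omega, ?_⟩) (fun i hi ν hν => ?_)) hk
    · have := ok_powT (μ := μ₂) (W := W) (show 0 < n + 1 by omega)
        (show (n + 1) ^ s < W from by omega)
      simp [this]
      omega
    · have := cost_powT μ₂ (n + 1) s
      simp
      omega
    · have := iter_xor_lt (fun l => columns s m g n (digit n i l)) s
        (fun l _ => columns_lt (s := s) (n := n) r2 _)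
      have h2 : patSyndrome s n (columns s m g n) i < 2 ^ (m * (2 * s)) := this
      omega
    · have hp : patSyndrome s n (fun i => ν (U + i)) i = patSyndrome s n (columns s m g n) i :=
        patSyndrome_congr (fun j hj => by rw [hν _ (by omega), hμ₂ j hj]) i
      have := iter_xor_lt (fun l => columns s m g n (digit n i l)) s
        (fun l _ => columns_lt (s := s) (n := n) r2 _)
      have h2 : patSyndrome s n (columns s m g n) i < 2 ^ (m * (2 * s)) := this
      have h3 := ok_patT (μ := ν) (s := s) (n := n) (A := U) (e := i) (W := W) (by omega) (by omega)
        (by omega) (by omega)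
      have h4 := cost_patT ν s n U i
      refine ⟨by simp [h3, hp]; omega, by simp; omega, by simp [hp], by simp, by simp; omega⟩
  · have e1 : n * n ≤ (n + 1) ^ 2 := by nlinarith
    have e2 : n ≤ (n + 1) ^ 2 := by nlinarith
    have e3 : 1 ≤ (n + 1) ^ s := Nat.one_le_pow _ _ (by omega)
    have e4 : 1 ≤ (n + 1) ^ 2 := Nat.one_le_pow _ _ (by omega)
    generalize (n + 1) ^ s = Q at *
    generalize (n + 1) ^ 2 = P at *
    unfold prepareCost
    have f1 : n * (colCost s * n) ≤ colCost s * P := by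
      calc _ = colCost s * (n * n) := by ring
        _ ≤ _ := Nat.mul_le_mul_left _ e1
    have f2 : n * ((20 * s + 80) * n) ≤ (20 * s + 80) * P := by
      calc _ = (20 * s + 80) * (n * n) := by ring
        _ ≤ _ := Nat.mul_le_mul_left _ e1
    have f3 : s * 1 ≤ s * P := Nat.mul_le_mul_left _ e4
    have f4 : 0 ≤ colCost s * Q := Nat.zero_le _
    have f5 : 0 ≤ toggleCost s * P := Nat.zero_le _
    have f6 : 0 ≤ s * Q := Nat.zero_le _
    linarith

end WordRAM

/-! ### The hash and the correctness of decoding -/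

theorem countMultiples_congr {D D' : ℕ → ℕ} {N : ℕ} (h : ∀ l < N, D l = D' l) :
    countMultiples D N = countMultiples D' N :=
  funext fun _ => iter_congr fun l hl x => by rw [h l hl]

theorem modulus_congr {D D' : ℕ → ℕ} {N : ℕ} (h : ∀ l < N, D l = D' l) (b r t : ℕ) :
    modulus D N b r t = modulus D' N b r t := by
  unfold modulus nextFactor
  rw [countMultiples_congr h]

/-- The number of pairs of a result of a deletion and substitutions and a place for an insertion. -/
def candidates (s n : ℕ) : ℕ := 2 * n ^ 2 * (n + 1) ^ s

/-- The difference of checksums for candidate `ν`. -/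
def collision (s n : ℕ) (C x : ℕ → ℕ) (ν : ℕ) : ℕ :=
  checkDiff s n (momentBase s n) C (delBit s n x (ν / (2 * n) % n) (ν / (2 * (n * n)))) (ν % n)
    (ν / n % 2) (checksum s (momentBase s n) n x)

/-- A modulus that tells the checksum of `x` from those of all confusable words. -/
def hashModulus (c s n : ℕ) (C x : ℕ → ℕ) : ℕ :=
  modulus (collision s n C x) (candidates s n) (factorLen c n) (gainLen n) (stages s)

/-- The modulus and the residue of the checksum in one number. -/
def hashWord (c s n : ℕ) (C x : ℕ → ℕ) : ℕ := hashModulus c s n C x +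
  (checksum s (momentBase s n) n x % hashModulus c s n C x) <<< (stages s * factorLen c n)

/-- Whether the insertion `ν` leads to a word with checksum `r` modulo `a`. -/
def accepts (s n : ℕ) (C y : ℕ → ℕ) (a r ν : ℕ) : ℕ :=
  if findPattern s n C y (ν % n) (ν / n) = 0 then 0 else
    if checksum s (momentBase s n) n
      (patched s n y (ν % n) (ν / n) (findPattern s n C y (ν % n) (ν / n) - 1)) % a = r then 1 else 0

/-- The last accepted insertion. -/
def accepted (s n : ℕ) (C y : ℕ → ℕ) (a r : ℕ) : ℕ := lookup (accepts s n C y a r) 1 (2 * n) - 1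

/-- The word that is decoded from `y`. -/
def decoded (s n : ℕ) (C y : ℕ → ℕ) (a r : ℕ) : ℕ → ℕ :=
  patched s n y (accepted s n C y a r % n) (accepted s n C y a r / n)
    (findPattern s n C y (accepted s n C y a r % n) (accepted s n C y a r / n) - 1)

theorem factorLen_pos (c n : ℕ) : 0 < factorLen c n := by unfold factorLen; omega

theorem stages_pos (s : ℕ) : 0 < stages s := by unfold stages; omega

theorem hashModulus_pos (c s n : ℕ) (C x : ℕ → ℕ) : 0 < hashModulus c s n C x :=
  modulus_pos _ _ _ _ _ (factorLen_pos c n)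

theorem hashModulus_lt (c s n : ℕ) (C x : ℕ → ℕ) :
    hashModulus c s n C x < 2 ^ (stages s * factorLen c n) :=
  modulus_lt _ _ _ _ _ (factorLen_pos c n) (stages_pos s)

theorem hashWord_mod (c s n : ℕ) (C x : ℕ → ℕ) :
    hashWord c s n C x % 2 ^ (stages s * factorLen c n) = hashModulus c s n C x := by
  rw [hashWord, Nat.shiftLeft_eq, Nat.add_mul_mod_self_right, Nat.mod_eq_of_lt (hashModulus_lt ..)]

theorem hashWord_shiftRight (c s n : ℕ) (C x : ℕ → ℕ) : hashWord c s n C x >>> (stages s * factorLen c n) =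
    checksum s (momentBase s n) n x % hashModulus c s n C x := by
  rw [hashWord, Nat.shiftLeft_eq, Nat.shiftRight_eq_div_pow, Nat.add_mul_div_right _ _ (by positivity),
    Nat.div_eq_of_lt (hashModulus_lt ..), zero_add]

theorem hashWord_lt (c s n : ℕ) (C x : ℕ → ℕ) :
    hashWord c s n C x < 2 ^ (2 * (stages s * factorLen c n)) := by
  have h1 := hashModulus_lt c s n C x
  have h2 := Nat.mod_lt (checksum s (momentBase s n) n x) (hashModulus_pos c s n C x)
  rw [hashWord, Nat.shiftLeft_eq, two_mul, pow_add]
  generalize checksum s (momentBase s n) n x % hashModulus c s n C x = r at *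
  have h3 := Nat.mul_le_mul_right (2 ^ (stages s * factorLen c n))
    (show r + 1 ≤ 2 ^ (stages s * factorLen c n) by omega)
  rw [add_mul] at h3
  omega

theorem checksum_le {s K n : ℕ} {x : ℕ → ℕ} (hx : ∀ i, x i ≤ 1) :
    checksum s K n x ≤ ∑ i ∈ Finset.range n, weight s K i :=
  Finset.sum_le_sum fun i _ => (Nat.mul_le_mul_right _ (hx i)).trans (by rw [one_mul])

theorem patched_le_one {s n : ℕ} {y : ℕ → ℕ} (hy : ∀ j, y j ≤ 1) {b : ℕ} (hb : b ≤ 1) (p f i : ℕ) :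
    patched s n y p b f i ≤ 1 :=
  xor_le_one (insBit_le_one hy hb p i) (toggle_le_one s n f i)

theorem checkDiff_le {s K n p b F B : ℕ} {C y : ℕ → ℕ} (hy : ∀ j, y j ≤ 1) (hb : b ≤ 1)
    (hB : ∑ i ∈ Finset.range n, weight s K i ≤ B) (hF : F ≤ B) : checkDiff s n K C y p b F ≤ B := by
  unfold checkDiff
  split_ifs
  · omega
  · have := checksum_le (s := s) (K := K) (n := n) (x := patched s n y p b (findPattern s n C y p b - 1))
      (patched_le_one hy hb p _)
    omega

theorem checksum_congr {s K n : ℕ} {x x' : ℕ → ℕ} (h : ∀ i < n, x i = x' i) :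
    checksum s K n x = checksum s K n x' :=
  Finset.sum_congr rfl fun i hi => by rw [h i (Finset.mem_range.1 hi)]

/-- Decoding undoes a deletion and at most `s` substitutions. -/
theorem decoded_eq {c₀ s n : ℕ} {C c y : ℕ → ℕ} (hC : C n = 0)
    (hdist : ∀ v : ℕ → ℕ, (∀ i, v i ≤ 1) → ∀ P : Finset ℕ, P.card ≤ 2 * s → (∀ i, v i ≠ 0 → i ∈ P) →
      syndrome n C v = 0 → ∀ i < n, v i = 0)
    (hsum : ∑ i ∈ Finset.range n, weight s (momentBase s n) i ≤ 2 ^ (c₀ * bitLen n))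
    (hc : ∀ i, c i ≤ 1) (hc0 : syndrome n C c = 0) (hy : ∀ j, y j ≤ 1) {d : ℕ} (hd : d < n)
    (M : Finset ℕ) (hM : M.card ≤ s) (h : ∀ j, j + 1 < n → j ∉ M → y j = c (skip d j)) :
    ∀ i < n, decoded s n C y (hashModulus c₀ s n C c)
      (checksum s (momentBase s n) n c % hashModulus c₀ s n C c) i = c i := by
  classical
  have hK : n ^ (2 * s + 4) < momentBase s n := Nat.pow_lt_pow_left (by omega) (by omega)
  -- The substitutions in `y` receive a code `e`, so that `y` agrees with one of the words `delBit s
  -- n c d e` that the encoder enumerated.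
  obtain ⟨e, he, ht⟩ := exists_toggle s n
    ((Finset.range n).filter fun j => j + 1 < n ∧ y j ≠ c (skip d j)) (by
      refine (Finset.card_le_card fun j hj => ?_).trans hM
      simp only [Finset.mem_filter] at hj
      by_contra hjM
      exact hj.2.2 (h j hj.2.1 hjM))
  have hye : ∀ j, j + 1 < n → y j = delBit s n c d e j := by
    intro j hj
    rw [delBit, ht j (by omega)]
    by_cases hjc : y j = c (skip d j)
    · simp [hjc]
    · rw [if_pos (by simp [hjc, hj]; omega)]
      exact (xor_one_of_ne (hc _) (hy j) (Ne.symm hjc)).symm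
  set a := hashModulus c₀ s n C c with ha
  set F := checksum s (momentBase s n) n c with hF
  obtain ⟨f1, f2⟩ := findPattern_complete hC hdist hc hc0 hy hd M hM h
  have hcd := hc d
  have hcdn : n * c d ≤ n := by simpa using Nat.mul_le_mul_left n hcd
  have e1 : (d + n * c d) % n = d := by rw [Nat.add_mul_mod_self_left, Nat.mod_eq_of_lt hd]
  have e2 : (d + n * c d) / n = c d := by
    rw [Nat.add_mul_div_left _ _ (by omega), Nat.div_eq_of_lt hd, zero_add]
  -- The true insertion, of `c d` at position `d`, has the code `d + n * c d`.
  have hacc : accepts s n C y a (F % a) (d + n * c d) = 1 := by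
    rw [accepts, e1, e2, if_neg f1, if_pos]
    rw [checksum_congr f2]
  obtain ⟨g1, g2⟩ := lookup_spec _ _ _ (lookup_ne_zero _ 1 (2 * n) _ (by omega) hacc)
  change accepted s n C y a (F % a) < 2 * n at g1
  change accepts s n C y a (F % a) (accepted s n C y a (F % a)) = 1 at g2
  unfold decoded
  generalize accepted s n C y a (F % a) = ν at g1 g2 ⊢
  have hp : ν % n < n := Nat.mod_lt _ (by omega)
  have hb : ν / n ≤ 1 := Nat.lt_succ_iff.1 ((Nat.div_lt_iff_lt_mul (by omega)).2 g1)
  unfold accepts at g2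
  generalize ν % n = p at *
  generalize ν / n = b at *
  have k1 : findPattern s n C y p b ≠ 0 := by
    intro h0
    simp [h0] at g2
  have k2 : checksum s (momentBase s n) n (patched s n y p b (findPattern s n C y p b - 1)) % a
      = F % a := by
    by_contra h0
    simp [h0, k1] at g2
  have hfc := findPattern_congr (s := s) (C := C) hp hye b
  have hpc := patched_congr (s := s) hp hye b (findPattern s n C y p b - 1)
  -- The accepted pair `(p, b)` together with `(d, e)` is candidate number `p + n * (b + 2 * (d + n
  -- * e))` of the encoder. The modulus divides its difference of checksums, which must therefore be
  -- zero.
  have hz : checkDiff s n (momentBase s n) C (delBit s n c d e) p b F = 0 := by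
    have l1 : (p + n * (b + 2 * (d + n * e))) % n = p := by
      rw [Nat.add_mul_mod_self_left, Nat.mod_eq_of_lt hp]
    have l2 : (p + n * (b + 2 * (d + n * e))) / n = b + 2 * (d + n * e) := by
      rw [Nat.add_mul_div_left _ _ (by omega), Nat.div_eq_of_lt hp, zero_add]
    have l3 : (p + n * (b + 2 * (d + n * e))) / (2 * n) = d + n * e := by
      rw [mul_comm 2 n, ← Nat.div_div_eq_div_mul, l2]; omega
    have l4 : (p + n * (b + 2 * (d + n * e))) / (2 * (n * n)) = e := by
      rw [← mul_assoc, ← Nat.div_div_eq_div_mul, l3, Nat.add_mul_div_left _ _ (by omega),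
        Nat.div_eq_of_lt hd, zero_add]
    have l5 : collision s n C c (p + n * (b + 2 * (d + n * e))) =
        checkDiff s n (momentBase s n) C (delBit s n c d e) p b F := by
      rw [collision, l1, l2, l3, l4, Nat.add_mul_mod_self_left, Nat.add_mul_mod_self_left,
        Nat.mod_eq_of_lt hd, Nat.mod_eq_of_lt (by omega : b < 2)]
    rw [← l5]
    refine modulus_not_dvd (collision s n C c) (candidates s n) (c₀ * bitLen n) (factorLen c₀ n)
      (gainLen n) (stages s) (fun l _ => ?_) (factorLen_gainLen c₀ n) (collisions_lt s n) _ ?_ ?_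
    · exact checkDiff_le (delBit_le_one hc _ _ _ _) (by omega) hsum ((checksum_le hc).trans hsum)
    · have m1 : b + 2 * (d + n * e) + 1 ≤ 2 * (n * (e + 1)) := by
        have : n * (e + 1) = n * e + n := by ring
        omega
      calc p + n * (b + 2 * (d + n * e)) < n * (b + 2 * (d + n * e) + 1) := by
            rw [mul_add n _ 1]; omega
        _ ≤ n * (2 * (n * (e + 1))) := Nat.mul_le_mul_left _ m1
        _ ≤ n * (2 * (n * (n + 1) ^ s)) := by gcongr; exact he
        _ = candidates s n := by rw [candidates]; ring
    · change a ∣ _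
      rw [l5, checkDiff, ← hfc, if_neg k1, ← checksum_congr hpc]
      -- The difference is the sum of the two truncated subtractions; equal residues make both
      -- divisible by `a`.
      exact dvd_add (Nat.dvd_of_mod_eq_zero (Nat.sub_mod_eq_zero_of_mod_eq k2))
        (Nat.dvd_of_mod_eq_zero (Nat.sub_mod_eq_zero_of_mod_eq k2.symm))
  rw [checkDiff, ← hfc, if_neg k1, ← checksum_congr hpc] at hz
  intro i hi
  rw [hpc i hi]
  refine eq_of_checksum_patched hK hc hd hp (by omega) ?_ i hi
  rw [← checksum_congr hpc]
  omega

/-! ### The commands of the encoder and of the decoder -/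

namespace WordRAM

open Term Cmd

/-- The memory holds the word `x` from the cell `X` on, and the tables. -/
structure Layout (s n U : ℕ) (C : ℕ → ℕ) (X : ℕ) (x μ : ℕ → ℕ) : Prop where
  word : ∀ i < n, μ (X + i) = x i
  col : ∀ i < n, μ (U + i) = C i
  weight : ∀ i < n, μ (2 * U + i) = weight s (momentBase s n) i
  table : ∀ S, μ (5 * U + S) = lookup (patSyndrome s n C) S ((n + 1) ^ s)

namespace Layout

variable {s n U X d e p b : ℕ} {C x μ ν : ℕ → ℕ} (L : Layout s n U C X x μ)
include L

theorem delBit_eq : ∀ j, j + 1 < n →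
    delBit s n (fun i => μ (X + i)) d e j = delBit s n x d e j := by
  intro j hj
  rw [delBit, delBit, L.word _ (by unfold skip; split_ifs <;> omega)]

theorem syndrome_eq (hp : p < n) : syndrome n (fun i => μ (U + i))
    (insBit (delBit s n (fun i => μ (X + i)) d e) p b) =
    syndrome n C (insBit (delBit s n x d e) p b) := by
  rw [syndrome_congr_columns L.col, syndrome_congr (insBit_congr hp L.delBit_eq b)]

theorem eval_findT (hp : p < n) : (findT s).eval μ [n, X, d, e, p, b, U, 5 * U] =
    findPattern s n C (delBit s n x d e) p b := by
  rw [Term.eval_findT, L.table, L.syndrome_eq hp, findPattern]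

theorem eval_patchSumT (hx : ∀ i, x i ≤ 1) (hp : p < n) (hb : b ≤ 1) (f : ℕ) :
    (patchSumT s).eval μ [n, X, d, e, p, b, f, 2 * U] =
      checksum s (momentBase s n) n (patched s n (delBit s n x d e) p b f) := by
  rw [Term.eval_patchSumT, checksum, ← iter_eq_sum _ _ _
    (fun i _ => patched_le_one (delBit_le_one hx s n d e) hb p f i)]
  refine iter_congr fun i hi y => ?_
  rw [patched_congr hp L.delBit_eq b f i hi, L.weight i hi]

theorem eval_sumT (hx : ∀ i, x i ≤ 1) :
    sumT.eval μ [n, X, 2 * U] = checksum s (momentBase s n) n x := by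
  rw [Term.eval_sumT, checksum, ← iter_eq_sum _ _ _ (fun i _ => hx i)]
  refine iter_congr fun i hi y => ?_
  rw [L.word i hi, L.weight i hi]

theorem eval_diffT (hx : ∀ i, x i ≤ 1) (hp : p < n) (hb : b ≤ 1) (F : ℕ) :
    (diffT s).eval μ [n, X, d, e, p, b, U, 5 * U, 2 * U, F] =
      checkDiff s n (momentBase s n) C (delBit s n x d e) p b F := by
  simp only [diffT, eval_bind, eval_ite, eval_call, evalArgs, eval_var, eval_lit, eval_sub,
    List.cons_append, List.nil_append, List.getD_cons_succ, List.getD_cons_zero,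
    L.eval_findT hp, L.eval_patchSumT hx hp hb, eval_add, checkDiff]

theorem eval_testT (hx : ∀ i, x i ≤ 1) (hp : p < n) (hb : b ≤ 1) (a r : ℕ) :
    (testT s).eval μ [n, X, d, e, p, b, U, 5 * U, 2 * U, a, r] =
      if findPattern s n C (delBit s n x d e) p b = 0 then 0 else
    if checksum s (momentBase s n) n
      (patched s n (delBit s n x d e) p b (findPattern s n C (delBit s n x d e) p b - 1)) % a = r
      then 1 else 0 := by
  simp only [testT, eval_bind, eval_ite, eval_call, evalArgs, eval_var, eval_lit, eval_sub, eval_eq,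
    eval_mod, List.cons_append, List.nil_append, List.getD_cons_succ, List.getD_cons_zero,
    L.eval_findT hp, L.eval_patchSumT hx hp hb]

theorem sum_eq : ∑ i ∈ Finset.range n, μ (2 * U + i) =
    ∑ i ∈ Finset.range n, _root_.weight s (momentBase s n) i :=
  Finset.sum_congr rfl fun i hi => L.weight i (Finset.mem_range.1 hi)

end Layout

section

variable {s c m g n U W X d e p b : ℕ} {x μ : ℕ → ℕ}

theorem Room.table (R : Room s c m g n U W) (z : ℕ → ℕ) :
    5 * U + syndrome n (columns s m g n) z < W := by
  have := syndrome_lt (n := n) (columns s m g n) z fun i _ => columns_lt (s := s) (n := n) R.code i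
  have := R.region
  omega

theorem Layout.ok_findT (L : Layout s n U (columns s m g n) X x μ) (R : Room s c m g n U W)
    (hX : X + n < W) (hp : p < n) : (findT s).ok W μ [n, X, d, e, p, b, U, 5 * U] := by
  have h1 := R.region
  have h2 := R.patterns
  have h3 := R.small
  have h4 := R.lit
  have h5 := Nat.two_pow_pos (m * (2 * s))
  refine Term.ok_findT (by omega) (by omega) (by omega) hX (by omega) ?_
  rw [L.syndrome_eq hp]
  exact R.table _

theorem Layout.ok_diffT (L : Layout s n U (columns s m g n) X x μ) (R : Room s c m g n U W)
    (hX : X + n < W) (hp : p < n) {F : ℕ} (hF : F < W) :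
    (diffT s).ok W μ [n, X, d, e, p, b, U, 5 * U, 2 * U, F] := by
  have h1 := R.region
  have h2 := R.patterns
  have h3 := R.small
  have h4 := R.lit
  have h5 := Nat.two_pow_pos (m * (2 * s))
  refine Term.ok_diffT (by omega) (by omega) (by omega) hX (by omega) ?_ (by omega) ?_ hF
  · rw [L.syndrome_eq hp]
    exact R.table _
  · rw [L.sum_eq]
    exact R.sum

theorem Layout.ok_testT (L : Layout s n U (columns s m g n) X x μ) (R : Room s c m g n U W)
    (hX : X + n < W) (hp : p < n) {a r : ℕ} :
    (testT s).ok W μ [n, X, d, e, p, b, U, 5 * U, 2 * U, a, r] := by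
  have h1 := R.region
  have h2 := R.patterns
  have h3 := R.small
  have h4 := R.lit
  have h5 := Nat.two_pow_pos (m * (2 * s))
  refine Term.ok_testT (by omega) (by omega) (by omega) hX (by omega) ?_ (by omega) ?_
  · rw [L.syndrome_eq hp]
    exact R.table _
  · rw [L.sum_eq]
    exact R.sum

end

/-- Computes the binary digits of `hashWord`, after the preparation. -/
def encode (s c : ℕ) : Cmd :=
  .bind (call sumT [var 0, lit 4, lit 2 * var 5])
  (.bind (lit 2 * (var 0 * var 0) * call powT [var 0 + lit 1, lit s])
  (.seq (.loop (var 7) (.put (lit 3 * var 5 + var 8) (call (diffT s) [var 0, lit 4,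
    var 8 / (lit 2 * var 0) % var 0, var 8 / (lit 2 * (var 0 * var 0)), var 8 % var 0,
    var 8 / var 0 % lit 2, var 5, lit 5 * var 5, lit 2 * var 5, var 6])))
  (.bind (call (factorT c) [var 0])
  (.bind (call gainT [var 0])
  (.bind (call (modulusT (stages s)) [lit 3 * var 5, var 7, var 8, var 9])
  (.bind (var 10 + ((var 6 % var 10) <<< (lit (stages s) * var 8)))
  (.loop (lit 2 * (lit (stages s) * var 8)) (.put (var 12) ((var 11 >>> var 12) % lit 2)))))))))

/-- The time is dominated by two terms: `O(n)` steps for each candidate's difference of checksums,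
and a count over all candidates for each trial factor. -/
theorem encode_does {s c m g n U W : ℕ} {x μ : ℕ → ℕ} (R : Room s c m g n U W)
    (L : Layout s n U (columns s m g n) 4 x μ) (hx : ∀ i, x i ≤ 1) :
    ∃ ξ, (encode s c).Does W [n, m, 2 ^ m, g, momentBase s n, U] μ ξ
      ((30 * n + 80) + ((8 * s + 80) + ((1 + candidates s n *
        ((5 * toggleCost s + 600) * (n + 1) + 100 + 5) + 3) + ((40 * n + 100) + ((20 * n + 50) +
        ((300 * (stages s + 1) * ((candidates s n + 1) * (2 ^ factorLen c n + 1)) + 20) + (20 +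
        (10 + 2 * (stages s * factorLen c n) * (10 + 5) + 3) + 1) + 1) + 1) + 1)) + 1) + 1) ∧
      ∀ i < 2 * (stages s * factorLen c n),
        ξ i = hashWord c s n (columns s m g n) x >>> i % 2 := by
  obtain ⟨r1, r2, r3, r4, r5, r6, r7, r8, r9, r10, r11, r12, r13, r14, r15, r16⟩ := id R
  rw [mul_assoc] at r14 r15
  set C := columns s m g n with hC
  set t := stages s with ht
  set β := factorLen c n with hβ
  set F := checksum s (momentBase s n) n x with hF
  have hFW : F < W := (checksum_le hx).trans_lt r9
  have hN : candidates s n = 2 * (n * n) * (n + 1) ^ s := by rw [candidates]; ring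
  change candidates s n + 2 < U at r12
  change candidates s n * 2 ^ gainLen n < W at r16
  have hpos : 0 < (n + 1) ^ s := by positivity
  have hm := Nat.two_pow_pos (m * (2 * s))
  have hnn : 2 * (n * n) ≤ candidates s n := by rw [hN]; exact Nat.le_mul_of_pos_right _ hpos
  have hnn' : n ≤ n * n := Nat.le_mul_self n
  have htW : t < W := by rw [ht, stages]; omega
  have htβ : β ≤ t * β := Nat.le_mul_of_pos_left _ (stages_pos s)
  have hβ0 : 0 < β := factorLen_pos c n
  let μ₁ := scatter (fun ν => 3 * U + ν) (collision s n C x) (candidates s n) μ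
  have hμ₁ : ∀ l < candidates s n, μ₁ (3 * U + l) = collision s n C x l := fun l hl => scatter_add hl
  have ha : modulus (fun l => μ₁ (3 * U + l)) (candidates s n) β (gainLen n) t =
    hashModulus c s n C x := modulus_congr hμ₁ _ _ _
  have h1 : hashModulus c s n C x < 2 ^ (t * β) := hashModulus_lt c s n C x
  have h2 : hashWord c s n C x < 2 ^ (2 * (t * β)) := hashWord_lt c s n C x
  have h3 : 2 ^ (t * β) ≤ 2 ^ (2 * (t * β)) := Nat.pow_le_pow_right (by omega) (by omega)
  have h4 : (F % hashModulus c s n C x) <<< (t * β) ≤ hashWord c s n C x := Nat.le_add_left _ _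
  have hG : hashModulus c s n C x + (F % hashModulus c s n C x) <<< (t * β) =
    hashWord c s n C x := rfl
  refine ⟨scatter (fun i => i) (fun i => hashWord c s n C x >>> i % 2) (2 * (t * β)) μ₁, ?_,
    fun i hi => scatter_id hi⟩
  unfold encode
  rw [← ht]
  refine .bind ?_ (v := F) (by simp [L.eval_sumT hx, hF]) ?_ ?_
  · have := Term.ok_sumT (W := W) (μ := μ) (n := n) (X := 4) (V := 2 * U) (by omega) (by omega)
      (by rw [L.sum_eq]; exact r9)
    simp [this]
    omega
  · have := cost_sumT μ n 4 (2 * U)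
    simp
    omega
  refine .bind ?_ (v := candidates s n) (by simp [hN]) ?_ ?_
  · have := ok_powT (μ := μ) (show 0 < n + 1 by omega) (show (n + 1) ^ s < W from by omega)
    simp [this, ← hN]
    omega
  · have := cost_powT μ (n + 1) s
    simp
    omega
  refine .seq (ν := μ₁) (.loop_put _ _ (3 * U) (4 * U) (by simp) (by simp) (by simp)
    (fun i hi => by omega) (fun i hi ν hν => ?_)) ?_
  · have L' : Layout s n U C 4 x ν :=
      ⟨fun j hj => (hν _ (by omega)).trans (L.word j hj),
        fun j hj => (hν _ (by omega)).trans (L.col j hj),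
        fun j hj => (hν _ (by omega)).trans (L.weight j hj),
        fun S => (hν _ (by omega)).trans (L.table S)⟩
    have hp : i % n < n := Nat.mod_lt _ (by omega)
    have k1 := L'.ok_diffT R (X := 4) (d := i / (2 * n) % n) (e := i / (2 * (n * n)))
      (b := i / n % 2) (by omega) hp hFW
    have k2 := L'.eval_diffT (d := i / (2 * n) % n) (e := i / (2 * (n * n))) (b := i / n % 2)
      hx hp (by omega) F
    have k3 := cost_diffT ν s n 4 (i / (2 * n) % n) (i / (2 * (n * n))) (i % n) (i / n % 2)
      U (5 * U) (2 * U) F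
    refine ⟨by simp; omega, by simp [k1]; omega, by simp, by simp [k2, collision, ← hF],
      by simp; omega⟩
  refine .bind ?_ (v := β) (by simp [hβ]) ?_ ?_
  · have := ok_factorT (μ := μ₁) (show 2 * n + c + 10 < W by omega)
    simp [this]
  · have := cost_factorT μ₁ c n
    simp
    omega
  refine .bind ?_ (v := gainLen n) (by simp) ?_ ?_
  · have := ok_gainT (μ := μ₁) (show n + 2 < W by omega)
    simp [this]
  · have := cost_gainT μ₁ n
    simp
    omega
  refine .bind ?_ (v := hashModulus c s n C x) (by simp [ha]) ?_ ?_
  · have := ok_modulusT (μ := μ₁) (t := t) (L := 3 * U) (N := candidates s n) (b := β)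
      (r := gainLen n) (W := W) (by omega) (by omega) htW hβ0 (by omega) r16
    simp [this]
    omega
  · have := cost_modulusT μ₁ t (3 * U) (candidates s n) β (gainLen n)
    simp
    omega
  refine .bind ?_ (v := hashWord c s n C x) (by simp [hG]) (by simp) ?_
  · simp [hG]
    refine ⟨⟨⟨htW, by omega⟩, by omega⟩, by omega⟩
  -- The digits overwrite the input, which is no longer needed: the hash is in a variable.
  refine .loop_put _ _ 0 (2 * (t * β)) ?_ (by simp) (by simp) (fun i hi => by omega)
    (fun i hi ν hν => ⟨by simp, by simp; omega, by simp, by simp, by simp⟩)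
  simp
  omega

/-- Computes `decoded`, after the preparation. -/
def decode (s c : ℕ) : Cmd :=
  .bind (lit (stages s) * call (factorT c) [var 0])
  (.bind (call numberT [lit 4, lit 2 * var 6])
  (.bind (var 7 % (lit 1 <<< var 6))
  (.bind (var 7 >>> var 6)
  (.bind (lit 4 + lit 2 * var 6)
  (.bind (call powT [var 0 + lit 1, lit s] - lit 1)
  (.bind (fold (lit 2 * var 0) (lit 0) (ite (call (testT s) [var 0, var 10, var 0, var 11,
      var 12 % var 0, var 12 / var 0, var 5, lit 5 * var 5, lit 2 * var 5, var 8, var 9])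
      (var 12 + lit 1) (var 13)) - lit 1)
  (.bind (call (findT s) [var 0, var 10, var 0, var 11, var 12 % var 0, var 12 / var 0, var 5,
      lit 5 * var 5] - lit 1)
  (.seq (.loop (var 0) (.put (lit 4 * var 5 + var 14) (call (patchT s) [var 0, var 10, var 0,
      var 11, var 12 % var 0, var 12 / var 0, var 13, var 14])))
  (.loop (var 0) (.put (var 14) (get (lit 4 * var 5 + var 14))))))))))))

theorem number_digits (G k : ℕ) : iter (fun i x => x + (G >>> i % 2) <<< i) 0 k = G % 2 ^ k := by
  induction k with
  | zero => simp [iter, Nat.mod_one]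
  | succ k ih =>
    rw [iter, ih, Nat.shiftLeft_eq, Nat.shiftRight_eq_div_pow, pow_succ, Nat.mod_mul, mul_comm]

theorem lookup_one (h : ℕ → ℕ) (hh : ∀ i, h i ≤ 1) (N : ℕ) :
    iter (fun i x => if h i = 0 then x else i + 1) 0 N = lookup h 1 N := by
  induction N with
  | zero => rfl
  | succ N ih =>
    rw [iter, lookup, ih]
    have := hh N
    split_ifs <;> first | rfl | omega

theorem accepts_le_one (s n : ℕ) (C y : ℕ → ℕ) (a r ν : ℕ) : accepts s n C y a r ν ≤ 1 := by
  unfold accepts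
  split_ifs <;> omega

/-- Deleting position `n` and applying the empty pattern, of code `(n + 1) ^ s - 1`, leaves all
symbols before `n` unchanged. So the terms written for the encoder serve for the received word. -/
theorem decode_does {s c m g n U W G : ℕ} {y μ : ℕ → ℕ} (R : Room s c m g n U W)
    (L : Layout s n U (columns s m g n) (4 + 2 * (stages s * factorLen c n)) y μ)
    (hy : ∀ i, y i ≤ 1) (hG : ∀ i < 2 * (stages s * factorLen c n), μ (4 + i) = G >>> i % 2)
    (hGW : G < 2 ^ (2 * (stages s * factorLen c n))) :
    ∃ ξ, (decode s c).Does W [n, m, 2 ^ m, g, momentBase s n, U] μ ξ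
      ((40 * n + 120) + ((20 * (2 * (stages s * factorLen c n)) + 50) + (10 + (10 + (10 +
      ((8 * s + 80) + ((2 * n * ((5 * toggleCost s + 600) * (n + 1) + 200 + 5) + 30) +
      (((2 * toggleCost s + 200) * (n + 1) + 60) +
      ((1 + n * (3 * toggleCost s + 300 + 5) + 3) + (1 + n * (20 + 5) + 3)) + 1) + 1) + 1) + 1) + 1)
      + 1) + 1) + 1) ∧
      ∀ i < n, ξ i = decoded s n (columns s m g n) (delBit s n y n ((n + 1) ^ s - 1))
        (G % 2 ^ (stages s * factorLen c n)) (G >>> (stages s * factorLen c n)) i := by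
  obtain ⟨r1, r2, r3, r4, r5, r6, r7, r8, r9, r10, r11, r12, r13, r14, r15, r16⟩ := id R
  rw [mul_assoc] at r14 r15
  set C := columns s m g n with hC
  set t := stages s with ht
  set β := factorLen c n with hβ
  have hpos : 0 < (n + 1) ^ s := by positivity
  have hm := Nat.two_pow_pos (m * (2 * s))
  have htW : t < W := by rw [ht, stages]; omega
  have h3 : 2 ^ (t * β) ≤ 2 ^ (2 * (t * β)) := Nat.pow_le_pow_right (by omega) (by omega)
  generalize hN : t * β = N at *
  generalize hY : 4 + 2 * N = Y at *
  generalize ha : G % 2 ^ N = a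
  generalize hr : G >>> N = r
  generalize he : (n + 1) ^ s - 1 = e
  set z := delBit s n y n e with hz
  have hz1 : ∀ j, z j ≤ 1 := delBit_le_one hy s n n e
  set ν := accepted s n C z a r with hν
  have hp : ν % n < n := Nat.mod_lt _ (by omega)
  have hGnum : iter (fun i x => x + μ (4 + i) <<< i) 0 (2 * N) = G := by
    rw [iter_congr (g := fun i x => x + (G >>> i % 2) <<< i) fun i hi x => by rw [hG i hi],
      number_digits, Nat.mod_eq_of_lt hGW]
  have hdiv : ∀ i < 2 * n, i / n ≤ 1 := fun i hi =>
    Nat.lt_succ_iff.1 ((Nat.div_lt_iff_lt_mul (by omega)).2 hi)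
  have hfold : iter (fun i x => if (testT s).eval μ
      [n, Y, n, e, i % n, i / n, U, 5 * U, 2 * U, a, r] = 0 then x else i + 1) 0 (2 * n) =
      lookup (accepts s n C z a r) 1 (2 * n) := by
    rw [← lookup_one _ (accepts_le_one s n C z a r)]
    refine iter_congr fun i hi x => ?_
    rw [L.eval_testT hy (Nat.mod_lt _ (by omega)) (hdiv i hi), accepts]
  refine ⟨scatter (fun i => i) (fun i => decoded s n C z a r i) n
    (scatter (fun i => 4 * U + i) (fun i => decoded s n C z a r i) n μ), ?_,
    fun i hi => scatter_id hi⟩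
  unfold decode
  rw [← ht]
  refine .bind ?_ (v := N) (by simp [← hβ, hN]) ?_ ?_
  · have := ok_factorT (μ := μ) (show 2 * n + c + 10 < W by omega)
    simp [this, ← hβ, hN]
    omega
  · have := cost_factorT μ c n
    simp
    omega
  refine .bind ?_ (v := G) (by simp [hGnum]) ?_ ?_
  · have := ok_numberT (μ := μ) (W := W) (X := 4) (k := 2 * N) (by omega) r15 (fun i hi => by
      rw [hG i hi]; omega)
    simp [this]
    omega
  · have := cost_numberT μ 4 (2 * N)
    simp
    omega
  refine .bind ?_ (v := a) (by simp [Nat.one_shiftLeft, ha]) (by simp) ?_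
  · simp [Nat.one_shiftLeft]
    omega
  refine .bind (by simp) (v := r) (by simp [hr]) (by simp) ?_
  refine .bind ?_ (v := Y) (by simp [hY]) (by simp) ?_
  · simp [hY]
    omega
  refine .bind ?_ (v := e) (by simp [he]) ?_ ?_
  · have := ok_powT (μ := μ) (show 0 < n + 1 by omega) (show (n + 1) ^ s < W from by omega)
    simp [this]
    omega
  · have := cost_powT μ (n + 1) s
    simp
    omega
  refine .bind ?_ (v := ν) ?_ ?_ ?_
  · have h1 := fun i => L.ok_testT R (d := n) (e := e) (p := i % n) (b := i / n) (a := a) (r := r)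
      (by omega) (Nat.mod_lt _ (by omega))
    simp [h1]
    exact ⟨⟨by omega, by omega, fun i hi => ⟨by omega, fun _ => by omega⟩⟩, by omega⟩
  · simp [hfold]
    rfl
  · have := cost_fold_le μ [n, m, 2 ^ m, g, momentBase s n, U, N, G, a, r, Y, e] (lit 2 * var 0)
      (lit 0) (ite (call (testT s) [var 0, var 10, var 0, var 11,
      var 12 % var 0, var 12 / var 0, var 5, lit 5 * var 5, lit 2 * var 5, var 8, var 9])
      (var 12 + lit 1) (var 13)) (N := 2 * n) (T := (5 * toggleCost s + 600) * (n + 1) + 200)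
      (by simp) (fun i _ x => (cost_ite_le _ _ _ _ _).trans (by
        have h1 := cost_testT μ s n Y n e (i % n) (i / n) U (5 * U) (2 * U) a r
        simp
        omega))
    simp only [cost_mul, cost_var, cost_lit, cost_sub, List.cons_append, List.nil_append] at this ⊢
    omega
  refine .bind ?_ (v := findPattern s n C z (ν % n) (ν / n) - 1) ?_ ?_ ?_
  · have h1 := L.ok_findT R (d := n) (e := e) (b := ν / n) (by omega) hp
    simp [h1]
    omega
  · have h1 := L.eval_findT (d := n) (e := e) (b := ν / n) hp
    simp only [eval_sub, eval_call, evalArgs, eval_var, eval_lit, eval_mod, eval_div, eval_mul,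
      List.cons_append, List.nil_append, List.getD_cons_succ, List.getD_cons_zero, h1]
    rfl
  · have h1 := cost_findT μ s n Y n e (ν % n) (ν / n) U (5 * U)
    simp
    omega
  -- The word is first assembled from cell `4 * U` on, since the received word lies in the low cells
  -- and is still being read; then it is moved to cell `0`.
  refine .seq (.loop_put _ _ (4 * U) (5 * U) (by simp) (by simp) (by simp)
    (fun i hi => by omega) (fun i hi ξ hξ => ?_)) (.loop_put _ _ 0 n (by simp) (by simp) (by simp)
    (fun i hi => by omega) (fun i hi ξ hξ => ⟨by simp, by simp; omega, by simp, ?_, by simp⟩))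
  · have L' : Layout s n U C Y y ξ :=
      ⟨fun j hj => (hξ _ (by omega)).trans (L.word j hj),
        fun j hj => (hξ _ (by omega)).trans (L.col j hj),
        fun j hj => (hξ _ (by omega)).trans (L.weight j hj),
        fun S => (hξ _ (by omega)).trans (L.table S)⟩
    have h1 := ok_patchT (μ := ξ) (W := W) (s := s) (n := n) (X := Y) (d := n) (e := e)
      (p := ν % n) (b := ν / n) (f := findPattern s n C z (ν % n) (ν / n) - 1) (i := i)
      (by omega) (by omega) (by omega) (by omega)
    have h2 := patched_congr (s := s) hp (L'.delBit_eq (d := n) (e := e)) (ν / n)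
      (findPattern s n C z (ν % n) (ν / n) - 1) i hi
    have h4 := cost_patchT ξ s n Y n e (ν % n) (ν / n)
      (findPattern s n C z (ν % n) (ν / n) - 1) i
    refine ⟨by simp; omega, by simp [h1], by simp, ?_, by simp; omega⟩
    simp [h2]
    rfl
  · simp only [eval_get, eval_add, eval_mul, eval_lit, eval_var, List.cons_append, List.nil_append,
      List.getD_cons_succ, List.getD_cons_zero]
    rw [hξ _ (by omega), scatter_add hi]

end WordRAM

/-! ### Word length and hash length -/

/-- The exponent in the bound for the checksums. -/
def checksumExp (s : ℕ) : ℕ := (2 * s + 3) + (2 + (2 * s + 5) * (2 * s + 2))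

/-- The length of the regions of the memory, up to a power of `n + 1`. -/
def regionFactor (s : ℕ) : ℕ := 4 * (s + 2) * (checksumExp s + 7) + checksumExp s + 20

/-- The factor by which words are longer than `bitLen n`. -/
def wordFactor (s : ℕ) : ℕ := 6 * regionFactor s + 2 * s * (4 * s + 6) + 4 * s + 60

theorem bitLen_pos (n : ℕ) : 0 < bitLen n := Nat.succ_pos _

theorem bitLen_le (n : ℕ) : bitLen n ≤ n + 1 := Nat.succ_le_succ (Nat.log_le_self 2 n)

theorem factorLen_le (c n : ℕ) : factorLen c n ≤ (c + 7) * bitLen n := by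
  have h1 := bitLen_pos n
  have h2 := Nat.log_le_self 2 (bitLen n)
  have h3 : (c + 5) * 1 ≤ (c + 5) * bitLen n := Nat.mul_le_mul_left _ h1
  have h4 : (c + 7) * bitLen n = (c + 5) * bitLen n + 2 * bitLen n := by ring
  unfold factorLen
  omega

/-- With `L = bitLen n`, the factor `L` that comes from `Nat.log 2 L` is absorbed by a second `2 ^
(L / 2)`. So a search over all trial factors multiplies the number of candidates by `O(n)` only. -/
theorem two_pow_factorLen_le (c n : ℕ) (hn : 0 < n) : 2 ^ factorLen c n ≤ 2 ^ (c + 8) * n := by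
  have h1 := two_pow_bitLen_le n hn
  generalize hL : bitLen n = L at h1
  have hL0 : L ≠ 0 := by have := bitLen_pos n; omega
  have h2 : L / 2 < 2 ^ (L / 2) := Nat.lt_two_pow_self
  have h3 : 2 ^ Nat.log 2 L ≤ L := Nat.pow_log_le_self 2 hL0
  have h4 : 2 ^ ((L + 1) / 2) ≤ 2 ^ (L / 2 + 1) := Nat.pow_le_pow_right (by omega) (by omega)
  have h5 : 2 ^ (L / 2) * 2 ^ (L / 2) ≤ 2 ^ L := by
    rw [← pow_add]; exact Nat.pow_le_pow_right (by omega) (by omega)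
  have h6 : 2 ^ Nat.log 2 L ≤ 2 * 2 ^ (L / 2) := by omega
  calc 2 ^ factorLen c n = 2 ^ ((L + 1) / 2) * 2 ^ Nat.log 2 L * 2 ^ (c + 5) := by
        rw [factorLen, hL, pow_add, pow_add]
    _ ≤ 2 ^ (L / 2 + 1) * (2 * 2 ^ (L / 2)) * 2 ^ (c + 5) := by gcongr
    _ = 4 * (2 ^ (L / 2) * 2 ^ (L / 2)) * 2 ^ (c + 5) := by ring
    _ ≤ 4 * (2 * n) * 2 ^ (c + 5) :=
        Nat.mul_le_mul_right _ (Nat.mul_le_mul_left _ (h5.trans h1))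
    _ = 2 ^ (c + 8) * n := by rw [pow_add, pow_add]; ring

/-- The base of each power is at most `n * momentBase s n ≤ (n + 1) ^ (2 * s + 5)` and the exponent
at most `2 * s + 2`; there are at most `(n + 1) ^ 2 * (2 * s + 3)` summands. -/
theorem sum_weight_le (s n : ℕ) : ∑ i ∈ Finset.range n, weight s (momentBase s n) i ≤
    2 ^ (checksumExp s * bitLen n) := by
  have h1 : n + 1 ≤ 2 ^ bitLen n := lt_two_pow_bitLen n
  have h2 : ∀ i < n, weight s (momentBase s n) i ≤
      (n + 1) * ((2 * s + 3) * ((n + 1) ^ (2 * s + 5)) ^ (2 * s + 2)) := by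
    intro i hi
    unfold weight
    refine (Finset.sum_le_card_nsmul _ _ ((2 * s + 3) * ((n + 1) ^ (2 * s + 5)) ^ (2 * s + 2))
      fun l hl => ?_).trans ?_
    · rw [Finset.mem_range] at hl
      refine (Finset.sum_le_card_nsmul _ _ (((n + 1) ^ (2 * s + 5)) ^ (2 * s + 2))
        fun j hj => ?_).trans (by simp)
      rw [Finset.mem_range] at hj
      refine (Nat.pow_le_pow_left (?_ : _ ≤ (n + 1) ^ (2 * s + 5)) j).trans
        (Nat.pow_le_pow_right (by positivity) (by omega))
      rw [momentBase, pow_succ' _ (2 * s + 4)]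
      exact Nat.mul_le_mul_right _ (by omega)
    · simp only [Finset.card_range, smul_eq_mul]
      exact Nat.mul_le_mul_right _ (by omega)
  refine (Finset.sum_le_card_nsmul _ _ _ fun i hi => h2 i (Finset.mem_range.1 hi)).trans ?_
  simp only [Finset.card_range, smul_eq_mul]
  have h3 : 2 * s + 3 ≤ 2 ^ ((2 * s + 3) * bitLen n) :=
    (Nat.lt_two_pow_self).le.trans (Nat.pow_le_pow_right (by omega)
      (Nat.le_mul_of_pos_right _ (bitLen_pos n)))
  calc _ ≤ (n + 1) * ((n + 1) * ((2 * s + 3) * ((n + 1) ^ (2 * s + 5)) ^ (2 * s + 2))) := by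
        gcongr; omega
    _ = (2 * s + 3) * (n + 1) ^ (2 + (2 * s + 5) * (2 * s + 2)) := by
        rw [← pow_mul, pow_add _ 2]
        generalize (n + 1) ^ ((2 * s + 5) * (2 * s + 2)) = Q
        ring
    _ ≤ 2 ^ ((2 * s + 3) * bitLen n) * (2 ^ bitLen n) ^ (2 + (2 * s + 5) * (2 * s + 2)) := by gcongr
    _ = 2 ^ (checksumExp s * bitLen n) := by
        rw [← pow_mul, ← pow_add]; congr 1; unfold checksumExp; ring

/-- Words of `O(log n)` bits are large enough. -/
theorem room (s m g n : ℕ) (hn : 0 < n) (hg : ∀ j, powCode m g j < 2 ^ m)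
    (hm : m ≤ (4 * s + 6) * bitLen n) : Room s (checksumExp s) m g n
      (regionLen s (regionFactor s) n) (2 ^ (wordFactor s * bitLen n)) := by
  have hL := bitLen_pos n
  have h1 : n + 1 ≤ 2 ^ bitLen n := lt_two_pow_bitLen n
  have hf := factorLen_le (checksumExp s) n
  have hLn := bitLen_le n
  have hsum := sum_weight_le s n
  set L := bitLen n with hLdef
  set c := checksumExp s with hc
  have hpow : ∀ {j}, (n + 1) ^ j ≤ 2 ^ (L * j) := fun {j} => by
    rw [pow_mul]; exact Nat.pow_le_pow_left h1 j
  have hlt : ∀ {a b : ℕ}, a ≤ 2 ^ b → b < wordFactor s * L → a < 2 ^ (wordFactor s * L) :=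
    fun h h' => h.trans_lt (Nat.pow_lt_pow_right (by omega) h')
  have hκ : regionFactor s = 4 * (s + 2) * (c + 7) + c + 20 := rfl
  have hA : wordFactor s * L = 6 * (regionFactor s * L) + (2 * s) * ((4 * s + 6) * L) + 4 * (s * L) + 60 * L := by
    unfold wordFactor; ring
  have hκL : regionFactor s * L = 4 * (s + 2) * (c + 7) * L + c * L + 20 * L := by rw [hκ]; ring
  have hκ1 : regionFactor s ≤ regionFactor s * L := Nat.le_mul_of_pos_right _ hL
  have hsL : s ≤ s * L := Nat.le_mul_of_pos_right _ hL
  have hms : m * (2 * s) ≤ 2 * s * ((4 * s + 6) * L) := by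
    rw [mul_comm]; exact Nat.mul_le_mul_left _ hm
  have hP : 1 ≤ (n + 1) ^ (s + 1) := Nat.one_le_pow _ _ (by omega)
  have hPn : n + 1 ≤ (n + 1) ^ (s + 2) := by
    rw [show s + 2 = s + 1 + 1 from rfl, pow_succ]; exact Nat.le_mul_of_pos_left _ hP
  have hPs : (n + 1) ^ s * (n + 1) ^ 2 = (n + 1) ^ (s + 2) := (pow_add _ _ _).symm
  have hn2 : n ^ 2 ≤ (n + 1) ^ 2 := Nat.pow_le_pow_left (by omega) 2
  have hcand : 2 * n ^ 2 * (n + 1) ^ s ≤ 2 * (n + 1) ^ (s + 2) := by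
    rw [← hPs]
    calc _ = 2 * ((n + 1) ^ s * n ^ 2) := by ring
      _ ≤ _ := by gcongr
  have hU : regionLen s (regionFactor s) n =
    4 * (s + 2) * (c + 7) * (n + 1) ^ (s + 2) + c * (n + 1) ^ (s + 2) + 20 * (n + 1) ^ (s + 2) := by
    rw [regionLen, hκ]; ring
  have hcP : c ≤ c * (n + 1) ^ (s + 2) := Nat.le_mul_of_pos_right _ (by positivity)
  have hx : 2 * stages s * factorLen c n ≤ 4 * (s + 2) * (c + 7) * L := by
    calc _ ≤ 2 * stages s * ((c + 7) * L) := Nat.mul_le_mul_left _ hf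
      _ = _ := by unfold stages; ring
  have hx' : 4 * (s + 2) * (c + 7) * L ≤ 4 * (s + 2) * (c + 7) * (n + 1) ^ (s + 2) :=
    Nat.mul_le_mul_left _ (hLn.trans hPn)
  have hPs' : (n + 1) ^ s ≤ (n + 1) ^ (s + 2) := Nat.pow_le_pow_right (by omega) (by omega)
  have hUW : regionLen s (regionFactor s) n ≤ 2 ^ (regionFactor s + L * (s + 2)) := by
    rw [pow_add]
    exact Nat.mul_le_mul (Nat.lt_two_pow_self).le hpow
  have hLs : L * (s + 2) = s * L + 2 * L := by ring
  have hLs2 : L * (2 * s + 4) = 2 * (s * L) + 4 * L := by ring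
  have hgl : gainLen n ≤ L + 1 := by unfold gainLen; omega
  refine ⟨hn, hg, ?_, ?_, ?_, ?_, ?_, ?_, ?_, ?_, ?_, ?_, ?_, ?_, ?_, ?_⟩
  · exact hlt (Nat.lt_two_pow_self (n := 2 * s + 10)).le (by omega)
  · refine Nat.pow_lt_pow_right (by omega) ?_
    have : (4 * s + 6) * L = 4 * (s * L) + 6 * L := by ring
    omega
  · refine hlt (b := L + 2 * s) ?_ (by omega)
    rw [pow_add]
    exact Nat.mul_le_mul (by omega) (Nat.lt_two_pow_self).le
  · exact hlt (Nat.lt_two_pow_self (n := m * (2 * s))).le (by omega)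
  · have e1 : 6 * regionLen s (regionFactor s) n ≤ 2 ^ (3 + (regionFactor s + L * (s + 2))) := by
      rw [pow_add]
      exact Nat.mul_le_mul (by norm_num) hUW
    set e := (3 + (regionFactor s + L * (s + 2))) + m * (2 * s) + 4 with he
    have e2 : 2 ^ (3 + (regionFactor s + L * (s + 2))) ≤ 2 ^ e :=
      Nat.pow_le_pow_right (by omega) (by omega)
    have e3 : 2 ^ (m * (2 * s)) ≤ 2 ^ e := Nat.pow_le_pow_right (by omega) (by omega)
    have e4 : 2 ^ 4 ≤ 2 ^ e := Nat.pow_le_pow_right (by omega) (by omega)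
    have e5 : 2 ^ (e + 2) ≤ 2 ^ (wordFactor s * L) := Nat.pow_le_pow_right (by omega) (by omega)
    rw [pow_add] at e5
    omega
  · exact hlt (b := L * (2 * s + 4)) hpow (by omega)
  · exact hlt hsum (by omega)
  · rw [hU]; omega
  · rw [hU]; omega
  · rw [hU]; omega
  · rw [hU]; omega
  · rw [hU]; omega
  · exact hlt (Nat.pow_le_pow_right (by omega) hx) (by omega)
  · refine hlt (b := 1 + L * (s + 2) + (L + 1)) ?_ (by omega)
    rw [pow_add, pow_add]
    exact Nat.mul_le_mul (hcand.trans (Nat.mul_le_mul (by omega) hpow)) (Nat.pow_le_pow_right (by omega) hgl)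

/-- The parameters of the input fit into a word. -/
theorem param_lt (s n : ℕ) : n + 1 < 2 ^ (wordFactor s * bitLen n) ∧
    regionFactor s < 2 ^ (wordFactor s * bitLen n) := by
  have hL := bitLen_pos n
  have h1 : n + 1 ≤ 2 ^ bitLen n := lt_two_pow_bitLen n
  have h2 : regionFactor s < 2 ^ regionFactor s := Nat.lt_two_pow_self
  have hA : wordFactor s ≤ wordFactor s * bitLen n := Nat.le_mul_of_pos_right _ hL
  have hA' : 60 * bitLen n ≤ wordFactor s * bitLen n :=
    Nat.mul_le_mul_right _ (by unfold wordFactor; omega)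
  refine ⟨h1.trans_lt (Nat.pow_lt_pow_right (by omega) (by omega)),
    h2.trans_le (Nat.pow_le_pow_right (by omega) (le_trans ?_ hA))⟩
  unfold wordFactor
  omega

/-- The degree of the field extension is logarithmic in the length. -/
theorem le_of_two_pow_le {s n M : ℕ} (h : 2 ^ M ≤ n + 2 * s * M) :
    M + 1 ≤ (4 * s + 6) * bitLen n := by
  have hL := bitLen_pos n
  have h1 : (4 * s + 5) * 1 ≤ (4 * s + 5) * bitLen n := Nat.mul_le_mul_left _ hL
  have h2 : (4 * s + 6) * bitLen n = (4 * s + 5) * bitLen n + bitLen n := by ring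
  suffices M ≤ bitLen n + (4 * s + 4) by omega
  -- Otherwise `2 * s * M` is at most half of `2 ^ M`, because `4 * s * M ≤ M * M ≤ 2 ^ M`, and `n`
  -- is less than the other half.
  by_contra hM
  have hsq : ∀ M, 4 ≤ M → M * M ≤ 2 ^ M := by
    intro M hM
    induction M, hM using Nat.le_induction with
    | base => norm_num
    | succ M hM ih =>
      rw [pow_succ]
      nlinarith
  have h3 := hsq M (by omega)
  have h4 : 4 * s * M ≤ M * M := Nat.mul_le_mul_right _ (by omega)
  have h5 : 2 ^ (bitLen n + 1) ≤ 2 ^ M := Nat.pow_le_pow_right (by omega) (by omega)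
  have h6 := lt_two_pow_bitLen n
  have h7 : 4 * s * M = 2 * (2 * s * M) := by ring
  rw [pow_succ] at h5
  omega

/-- The length of the hash. -/
def hashLen (s n : ℕ) : ℕ := 2 * (stages s * factorLen (checksumExp s) n)

-- `hashLen` is `4 * (s + 2)` times a factor length, whose main part is half of `bitLen n`; the rest
-- is `Nat.log 2 (bitLen n)` and a constant.
open Filter in
theorem isLittleO_hashLen (s : ℕ) :
    (fun n : ℕ => (hashLen s n : ℝ) - 2 * ((s : ℝ) + 2) * Real.logb 2 (n : ℝ))
      =o[atTop] fun n : ℕ => Real.logb 2 (n : ℝ) := by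
  have hlog : Tendsto (fun n : ℕ => Real.logb 2 (n : ℝ)) atTop atTop :=
    (Real.tendsto_logb_atTop (by norm_num)).comp tendsto_natCast_atTop_atTop
  have hbit : ∀ n : ℕ, 0 < n → Real.logb 2 n ≤ bitLen n ∧ (bitLen n : ℝ) ≤ Real.logb 2 n + 1 := by
    intro n hn
    have hn' : (0 : ℝ) < n := by exact_mod_cast hn
    constructor
    · rw [Real.logb_le_iff_le_rpow (by norm_num) hn', Real.rpow_natCast]
      exact_mod_cast (lt_two_pow_bitLen n).le
    · rw [bitLen, Nat.cast_add, Nat.cast_one, add_le_add_iff_right,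
        Real.le_logb_iff_rpow_le (by norm_num) hn', Real.rpow_natCast]
      exact_mod_cast Nat.pow_log_le_self 2 hn.ne'
  have hone : (fun _ : ℕ => (1 : ℝ)) =o[atTop] fun n : ℕ => Real.logb 2 (n : ℝ) := by
    rw [Asymptotics.isLittleO_one_left_iff]
    exact tendsto_norm_atTop_atTop.comp hlog
  have hL : (fun n : ℕ => (bitLen n : ℝ)) =O[atTop] fun n : ℕ => Real.logb 2 (n : ℝ) := by
    refine Asymptotics.IsBigO.of_bound 2 ?_
    filter_upwards [hlog.eventually_ge_atTop 1, eventually_gt_atTop 0] with n h1 h2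
    rw [Real.norm_of_nonneg (by positivity), Real.norm_of_nonneg (by linarith)]
    linarith [(hbit n h2).2]
  have hLtop : Tendsto (fun n : ℕ => (bitLen n : ℝ)) atTop atTop := by
    refine tendsto_atTop_mono' _ ?_ hlog
    filter_upwards [eventually_gt_atTop 0] with n hn using (hbit n hn).1
  have hloglog : (fun n : ℕ => Real.log (bitLen n)) =o[atTop] fun n : ℕ => Real.logb 2 (n : ℝ) :=
    (Real.isLittleO_log_id_atTop.comp_tendsto hLtop).trans_isBigO hL
  have hsum := ((hloglog.const_mul_left (4 * (s + 2) / Real.log 2)).add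
    (hone.const_mul_left (4 * ((s : ℝ) + 2) * (checksumExp s + 7))))
  refine Asymptotics.IsBigO.trans_isLittleO ?_ hsum
  refine Asymptotics.IsBigO.of_bound 1 ?_
  filter_upwards [eventually_gt_atTop 0] with n hn
  obtain ⟨h1, h2⟩ := hbit n hn
  have hpos : 0 < bitLen n := bitLen_pos n
  have h3 : ((Nat.log 2 (bitLen n) : ℕ) : ℝ) ≤ Real.log (bitLen n) / Real.log 2 := by
    rw [Real.log_div_log, Real.le_logb_iff_rpow_le (by norm_num) (by exact_mod_cast hpos),
      Real.rpow_natCast]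
    exact_mod_cast Nat.pow_log_le_self 2 hpos.ne'
  have h4 : 2 * (((bitLen n + 1) / 2 : ℕ) : ℝ) ≤ bitLen n + 1 := by
    have : 2 * ((bitLen n + 1) / 2) ≤ bitLen n + 1 := by omega
    exact_mod_cast this
  have h5 : (bitLen n : ℝ) ≤ 2 * (((bitLen n + 1) / 2 : ℕ) : ℝ) := by
    have : bitLen n ≤ 2 * ((bitLen n + 1) / 2) := by omega
    exact_mod_cast this
  have h6 : (0 : ℝ) ≤ (Nat.log 2 (bitLen n) : ℕ) := Nat.cast_nonneg _
  have h7 : (0 : ℝ) ≤ checksumExp s := Nat.cast_nonneg _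
  have e : (hashLen s n : ℝ) = 4 * (s + 2) * ((((bitLen n + 1) / 2 : ℕ) : ℝ) +
      (Nat.log 2 (bitLen n) : ℕ) + (checksumExp s + 5)) := by
    unfold hashLen stages factorLen
    push_cast
    ring
  have hs : (0 : ℝ) ≤ s + 2 := by positivity
  rw [e]
  generalize (((bitLen n + 1) / 2 : ℕ) : ℝ) = a at *
  generalize ((Nat.log 2 (bitLen n) : ℕ) : ℝ) = b at *
  generalize (bitLen n : ℝ) = L at *
  generalize (checksumExp s : ℝ) = c at *
  have e2 : 4 * ((s : ℝ) + 2) / Real.log 2 * Real.log L + 4 * ((s : ℝ) + 2) * (c + 7) * 1 =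
      ((s : ℝ) + 2) * (4 * (Real.log L / Real.log 2) + 4 * (c + 7)) := by ring
  have e3 : 4 * ((s : ℝ) + 2) * (a + b + (c + 5)) - 2 * ((s : ℝ) + 2) * Real.logb 2 n =
      ((s : ℝ) + 2) * (4 * (a + b + (c + 5)) - 2 * Real.logb 2 n) := by ring
  rw [e2, e3, one_mul, Real.norm_of_nonneg (mul_nonneg hs (by linarith)),
    Real.norm_of_nonneg (mul_nonneg hs (by linarith))]
  exact mul_le_mul_of_nonneg_left (by linarith) hs

/-! ### Precoded words as bit sequences -/

/-- The symbols of a word as numbers, followed by zeros. -/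
def BinWord.bits {n : ℕ} (c : BinWord n) (i : ℕ) : ℕ := if h : i < n then (c ⟨i, h⟩).val else 0

theorem BinWord.bits_le_one {n : ℕ} (c : BinWord n) (i : ℕ) : c.bits i ≤ 1 := by
  unfold bits
  split_ifs
  · exact Nat.lt_succ_iff.1 (ZMod.val_lt _)
  · omega

theorem BinWord.length_toWords {n : ℕ} (c : BinWord n) : c.toWords.length = n := by
  simp [toWords]

theorem BinWord.getD_toWords {n : ℕ} (c : BinWord n) (i : ℕ) : c.toWords.getD i 0 = c.bits i := by
  unfold toWords bits
  rw [List.getD_eq_getElem?_getD, List.getElem?_ofFn]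
  split_ifs <;> rfl

theorem BinWord.getElem_toWords {n : ℕ} (c : BinWord n) (i : ℕ) (hi : i < c.toWords.length) :
    c.toWords[i] = c.bits i := by
  rw [← c.getD_toWords, List.getD_eq_getElem _ _ hi]

namespace BCHPrecoder

variable {s k : ℕ} (H : BCHPrecoder s k)

theorem le_n₀ : k ≤ H.n₀ := by
  have h1 := H.le_dim
  have h2 := bchDim_le s H.m H.α
  unfold n₀ short
  omega

theorem n₀_le : H.n₀ ≤ 2 ^ H.m - 1 := Nat.sub_le _ _

theorem short_add_n₀ : H.short + H.n₀ = 2 ^ H.m - 1 := by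
  have h1 := H.le_dim
  have h2 := bchDim_le s H.m H.α
  unfold n₀ short
  omega

/-- By minimality of `m`, a code for degree `m - 1` has dimension below `k ≤ n₀`. But that dimension
is at least `2 ^ (m - 1) - 1 - 2 * s * (m - 1)`, so `m` is logarithmic in `n₀`. -/
theorem m_le : H.m ≤ (4 * s + 6) * bitLen H.n₀ := by
  have hL := bitLen_pos H.n₀
  rcases Nat.lt_or_ge 1 H.m with h | h
  · obtain ⟨β, hβ⟩ := bch_exists_primitive (H.m - 1) (by omega)
    have h1 := bch_le_dim s (H.m - 1) (by omega) β
    have h2 : bchDim s (H.m - 1) β < k := by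
      by_contra hcon
      have := H.minimal (H.m - 1) β (by omega) hβ (by omega)
      omega
    have h3 := H.le_n₀
    have := le_of_two_pow_le (s := s) (n := H.n₀) (M := H.m - 1) (by omega)
    omega
  · have := Nat.mul_le_mul_left (4 * s + 6) hL
    omega

theorem polyCode_spec : H.polyCode < 2 ^ (H.m + 1) ∧ H.polyCode.testBit H.m = true ∧
    bitEval H.α (H.m + 1) 0 H.polyCode = 0 := minpoly_code H.α H.m_pos H.primitive

theorem powCode_lt (i : ℕ) : powCode H.m H.polyCode i < 2 ^ H.m :=
  (powCode_spec H.α H.m_pos H.polyCode_spec.1 H.polyCode_spec.2.1 H.polyCode_spec.2.2 i).1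

/-- The columns of the parity check matrix of the precoded words. -/
noncomputable def cols : ℕ → ℕ := columns s H.m H.polyCode H.n₀

theorem syndrome_iff (z : ℕ → ℕ) : syndrome H.n₀ H.cols z = 0 ↔
    ∀ j < 2 * s, ∑ i ∈ Finset.range H.n₀, (if z i = 0 then 0 else H.α ^ (i * (j + 1))) = 0 :=
  syndrome_eq_zero_iff H.α H.m_pos H.primitive H.polyCode_spec.1 H.polyCode_spec.2.1
    H.polyCode_spec.2.2 s H.n₀ _ z fun _ hi => if_pos hi

theorem cols_n₀ : H.cols H.n₀ = 0 := if_neg (lt_irrefl _)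

/-- Shortening only restricts the support to positions below `n₀ ≤ 2 ^ m - 1`, where the BCH bound
applies. -/
theorem distance (v : ℕ → ℕ) (P : Finset ℕ) (hP : P.card ≤ 2 * s)
    (h : ∀ i, v i ≠ 0 → i ∈ P) (h0 : syndrome H.n₀ H.cols v = 0) : ∀ i < H.n₀, v i = 0 := by
  have h1 := (H.syndrome_iff v).1 h0
  have h2 := card_of_power_sums H.α H.m_pos H.primitive s
    ((Finset.range H.n₀).filter fun i => v i ≠ 0)
    ((Finset.card_le_card fun i hi => h i (Finset.mem_filter.1 hi).2).trans hP)
    (fun i hi => by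
      have := Finset.mem_range.1 (Finset.mem_filter.1 hi).1
      have := H.n₀_le
      omega)
    (fun j hj => by
      rw [← h1 j hj, Finset.sum_filter]
      refine Finset.sum_congr rfl fun i _ => ?_
      split_ifs <;> simp_all)
  intro i hi
  by_contra hv
  have : i ∈ (Finset.range H.n₀).filter fun i => v i ≠ 0 := by simp [hi, hv]
  rw [h2] at this
  simp at this

theorem enc_pad (x : BinWord k) (i : Fin (2 ^ H.m - 1)) (hi : (i : ℕ) < H.short) :
    H.enc (H.pad x) i = 0 := by
  have h1 := H.enc_systematic (H.pad x) ⟨i, by unfold short at hi; omega⟩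
  have h2 : Fin.castLE (bchDim_le s H.m H.α) ⟨i, by unfold short at hi; omega⟩ = i := rfl
  rw [h2] at h1
  rw [h1, pad, dif_neg (by simpa using hi)]

/-- The codeword begins with `short` zeros. Its power sum of order `j + 1` is that of the precoded
word, numbered from `0`, times a power of `α`, which can be cancelled. -/
theorem syndrome_h (x : BinWord k) : syndrome H.n₀ H.cols (H.h x).bits = 0 := by
  rw [H.syndrome_iff]
  intro j hj
  have hα := primitive_ne_zero H.α H.m_pos H.primitive
  have h1 := H.enc_mem (H.pad x) (j + 1) (Finset.mem_Icc.2 ⟨by omega, by omega⟩)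
  have hone : ∀ a : ZMod 2, a ≠ 0 → a = 1 := by decide
  have h2 : ∑ i ∈ Finset.range (2 ^ H.m - 1), (if h : i < 2 ^ H.m - 1 then
      algebraMap (ZMod 2) (GaloisField 2 H.m) (H.enc (H.pad x) ⟨i, h⟩) * (H.α ^ (j + 1)) ^ i else 0)
      = 0 := by
    rw [Finset.sum_range, ← h1]
    exact Finset.sum_congr rfl fun i _ => by simp
  rw [show Finset.range (2 ^ H.m - 1) = Finset.range (H.short + H.n₀) by rw [H.short_add_n₀],
    Finset.sum_range_add, Finset.sum_eq_zero, zero_add] at h2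
  · refine (mul_eq_zero.1 ?_).resolve_left (pow_ne_zero H.short (pow_ne_zero (j + 1) hα))
    refine Eq.trans ?_ h2
    rw [Finset.mul_sum]
    refine Finset.sum_congr rfl fun i hi => ?_
    rw [Finset.mem_range] at hi
    have hlt : H.short + i < 2 ^ H.m - 1 := by have := H.short_add_n₀; omega
    rw [dif_pos hlt, BinWord.bits, dif_pos hi]
    by_cases hz : H.h x ⟨i, hi⟩ = 0
    · have : H.enc (H.pad x) ⟨H.short + i, hlt⟩ = 0 := hz
      rw [if_pos (by rw [hz, ZMod.val_zero]), this, map_zero, zero_mul, mul_zero]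
    · have : H.enc (H.pad x) ⟨H.short + i, hlt⟩ = 1 := hone _ hz
      rw [if_neg (by rwa [ZMod.val_eq_zero]), this, map_one, one_mul, pow_add _ H.short, mul_comm i, pow_mul]
  · intro i hi
    rw [Finset.mem_range] at hi
    split_ifs with h
    · rw [H.enc_pad x ⟨i, h⟩ hi, map_zero, zero_mul]
    · rfl

end BCHPrecoder

theorem exists_skip_of_mem_delSubBall {s n : ℕ} (hn : 0 < n) {c : BinWord n} {y : BinWord (n - 1)}
    (hy : y ∈ delSubBall 1 s c) : ∃ d < n, ∃ M : Finset ℕ, M.card ≤ s ∧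
      ∀ j, j + 1 < n → j ∉ M → y.bits j = c.bits (skip d j) := by
  obtain ⟨e, he⟩ := hy
  obtain ⟨d, hd, hskip⟩ := exists_skip_of_orderEmbedding hn e
  refine ⟨d, hd, (Finset.univ.filter fun i => y i ≠ (c ∘ e) i).image Fin.val,
    Finset.card_image_le.trans he, fun j hj hjM => ?_⟩
  have hj' : j < n - 1 := by omega
  have h1 : y ⟨j, hj'⟩ = c (e ⟨j, hj'⟩) := by
    by_contra hne
    exact hjM (Finset.mem_image.2 ⟨⟨j, hj'⟩, by simpa using hne, rfl⟩)
  have h2 := hskip ⟨j, hj'⟩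
  rw [BinWord.bits, dif_pos hj', h1, BinWord.bits, ← h2, dif_pos (e ⟨j, hj'⟩).2]

/-! ### The two programs and the theorem -/

namespace WordRAM

open Term Cmd

theorem Prepared.layout {s m g n U X : ℕ} {μ ν x : ℕ → ℕ} (P : Prepared s m g n U μ ν)
    (hX : X + n ≤ U) (h : ∀ i < n, μ (X + i) = x i) : Layout s n U (columns s m g n) X x ν :=
  ⟨fun i hi => (P.input _ (by omega)).trans (h i hi), fun i hi => P.col i hi.le, P.weight, P.table⟩

/-- The program that computes the hash of a precoded word. -/
def encoder (s : ℕ) : Prog := program (get (lit 0))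
  (prepare s (regionFactor s) (encode s (checksumExp s)))
  (lit 2 * (lit (stages s) * call (factorT (checksumExp s)) [var 0]))

/-- The program that recovers a precoded word from its hash and the received word. -/
def decoder (s : ℕ) : Prog := program (get (lit 0))
  (prepare s (regionFactor s) (decode s (checksumExp s))) (var 0)

/-- The constant in the bound for the time of the encoder. -/
def encoderCost (s : ℕ) : ℕ := 2 * prepareCost s + 8 * s + 30 * regionFactor s +
  (10 * toggleCost s + 1410) + 900 * (stages s + 1) * (2 ^ (checksumExp s + 8) + 1) + 1000

/-- The constant in the bound for the time of the decoder. -/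
def decoderCost (s : ℕ) : ℕ := 2 * prepareCost s + 8 * s + 40 * regionFactor s +
  20 * toggleCost s + 5000

/-- The word of the last `N` binary digits of `G`. -/
def digitsWord (N G : ℕ) : BinWord N := fun i => ((G >>> (i : ℕ) % 2 : ℕ) : ZMod 2)

theorem bits_digitsWord {N : ℕ} (G : ℕ) {i : ℕ} (hi : i < N) :
    (digitsWord N G).bits i = G >>> i % 2 := by
  rw [BinWord.bits, dif_pos hi, digitsWord, ZMod.val_natCast, Nat.mod_mod]

theorem encoderCost_le {s n : ℕ} (hn : 0 < n)
    (hU : 4 + 2 * stages s * factorLen (checksumExp s) n + n < regionLen s (regionFactor s) n) :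
    prepareCost s * ((n + 1) ^ 2 + (n + 1) ^ s) +
      ((30 * n + 80) + ((8 * s + 80) + ((1 + candidates s n *
        ((5 * toggleCost s + 600) * (n + 1) + 100 + 5) + 3) + ((40 * n + 100) + ((20 * n + 50) +
        ((300 * (stages s + 1) * ((candidates s n + 1) * (2 ^ factorLen (checksumExp s) n + 1)) + 20)
        + (20 + (10 + 2 * (stages s * factorLen (checksumExp s) n) * (10 + 5) + 3) + 1) + 1) + 1) + 1))
        + 1) + 1) + (40 * n + 100) ≤ encoderCost s * (n + 1) ^ (s + 3) := by
  have hβ := two_pow_factorLen_le (checksumExp s) n hn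
  rw [mul_assoc] at hU
  unfold regionLen at hU
  have hP1 : 1 ≤ (n + 1) ^ (s + 2) := Nat.one_le_pow _ _ (by omega)
  have hPs : (n + 1) ^ s ≤ (n + 1) ^ (s + 2) := Nat.pow_le_pow_right (by omega) (by omega)
  have hP2 : (n + 1) ^ 2 ≤ (n + 1) ^ (s + 2) := Nat.pow_le_pow_right (by omega) (by omega)
  have hN : candidates s n ≤ 2 * (n + 1) ^ (s + 2) := by
    rw [candidates, pow_add]
    calc _ ≤ 2 * (n + 1) ^ 2 * (n + 1) ^ s := by gcongr; omega
      _ = _ := by ring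
  rw [show s + 3 = s + 2 + 1 from rfl, pow_succ _ (s + 2)]
  -- `hU` bounds the hash length by a multiple of `P`. With the powers as unknowns, the claim is a
  -- linear consequence of the products `f1` to `f5`.
  generalize (n + 1) ^ (s + 2) = P at *
  generalize stages s * factorLen (checksumExp s) n = h at *
  generalize 2 ^ factorLen (checksumExp s) n = b at *
  generalize (n + 1) ^ 2 = p at *
  generalize (n + 1) ^ s = q at *
  generalize candidates s n = N at *
  have hQ : P * 1 ≤ P * (n + 1) := Nat.mul_le_mul_left _ (by omega)
  have hQn : 1 * (n + 1) ≤ P * (n + 1) := Nat.mul_le_mul_right _ hP1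
  have f1 : prepareCost s * (p + q) ≤ prepareCost s * (2 * (P * (n + 1))) :=
    Nat.mul_le_mul_left _ (by omega)
  have f2 : N * ((5 * toggleCost s + 600) * (n + 1) + 100 + 5) ≤
      2 * P * ((5 * toggleCost s + 600) * (n + 1) + 105 * (n + 1)) :=
    Nat.mul_le_mul hN (by omega)
  have f3 : 300 * (stages s + 1) * ((N + 1) * (b + 1)) ≤ 300 * (stages s + 1) *
      ((3 * P) * ((2 ^ (checksumExp s + 8) + 1) * (n + 1))) := by
    refine Nat.mul_le_mul_left _ (Nat.mul_le_mul (by omega) ?_)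
    generalize 2 ^ (checksumExp s + 8) = B at *
    linarith
  have f4 : regionFactor s * P ≤ regionFactor s * (P * (n + 1)) := Nat.mul_le_mul_left _ (by omega)
  have f5 : s * 1 ≤ s * (P * (n + 1)) := Nat.mul_le_mul_left _ (by omega)
  unfold encoderCost
  generalize 2 ^ (checksumExp s + 8) = B at *
  linarith

theorem decoderCost_le {s n : ℕ} (hn : 0 < n)
    (hU : 4 + 2 * stages s * factorLen (checksumExp s) n + n < regionLen s (regionFactor s) n) :
    prepareCost s * ((n + 1) ^ 2 + (n + 1) ^ s) +
      ((40 * n + 120) + ((20 * (2 * (stages s * factorLen (checksumExp s) n)) + 50) + (10 + (10 +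
      (10 + ((8 * s + 80) + ((2 * n * ((5 * toggleCost s + 600) * (n + 1) + 200 + 5) + 30) +
      (((2 * toggleCost s + 200) * (n + 1) + 60) +
      ((1 + n * (3 * toggleCost s + 300 + 5) + 3) + (1 + n * (20 + 5) + 3)) + 1) + 1) + 1) + 1) + 1)
      + 1) + 1) + 1) + 10 ≤ decoderCost s * (n + 1) ^ (s + 2) := by
  rw [mul_assoc] at hU
  unfold regionLen at hU
  have hP1 : 1 ≤ (n + 1) ^ (s + 2) := Nat.one_le_pow _ _ (by omega)
  have hPs : (n + 1) ^ s ≤ (n + 1) ^ (s + 2) := Nat.pow_le_pow_right (by omega) (by omega)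
  have hP2 : (n + 1) ^ 2 ≤ (n + 1) ^ (s + 2) := Nat.pow_le_pow_right (by omega) (by omega)
  have hp : (n + 1) * (n + 1) = (n + 1) ^ 2 := by ring
  generalize (n + 1) ^ (s + 2) = P at *
  generalize stages s * factorLen (checksumExp s) n = h at *
  generalize (n + 1) ^ 2 = p at *
  generalize (n + 1) ^ s = q at *
  have hn1 : 1 * (n + 1) ≤ (n + 1) * (n + 1) := Nat.mul_le_mul_right _ (by omega)
  have hnP : n + 1 ≤ P := by omega
  have f1 : prepareCost s * (p + q) ≤ prepareCost s * (2 * P) :=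
    Nat.mul_le_mul_left _ (by omega)
  have f2 : 2 * n * ((5 * toggleCost s + 600) * (n + 1) + 200 + 5) ≤
      2 * (5 * toggleCost s + 805) * P := by
    calc _ ≤ 2 * (n + 1) * ((5 * toggleCost s + 600) * (n + 1) + 205 * (n + 1)) :=
          Nat.mul_le_mul (by omega) (by omega)
      _ = 2 * (5 * toggleCost s + 805) * ((n + 1) * (n + 1)) := by ring
      _ ≤ _ := Nat.mul_le_mul_left _ (by omega)
  have f3 : (2 * toggleCost s + 200) * (n + 1) ≤ (2 * toggleCost s + 200) * P :=
    Nat.mul_le_mul_left _ hnP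
  have f4 : n * (3 * toggleCost s + 300 + 5) ≤ P * (3 * toggleCost s + 305) :=
    Nat.mul_le_mul (by omega) le_rfl
  have f5 : s * 1 ≤ s * P := Nat.mul_le_mul_left _ hP1
  have f6 : 0 ≤ toggleCost s * P := Nat.zero_le _
  unfold decoderCost
  linarith

end WordRAM

open Term

namespace BCHPrecoder

variable {s k : ℕ} (H : BCHPrecoder s k)

theorem room (hk : 0 < k) : Room s (checksumExp s) H.m H.polyCode H.n₀
    (regionLen s (regionFactor s) H.n₀) (2 ^ (wordFactor s * bitLen H.n₀)) :=
  _root_.room s H.m H.polyCode H.n₀ (hk.trans_le H.le_n₀) H.powCode_lt H.m_le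

/-- The hash of a precoded word. -/
noncomputable def hashCode (c : BinWord H.n₀) : ℕ := hashWord (checksumExp s) s H.n₀ H.cols c.bits

theorem description_lt (hk : 0 < k) : ∀ v ∈ H.description, v < 2 ^ (wordFactor s * bitLen H.n₀) := by
  have R := H.room hk
  have h1 := (param_lt s H.n₀).1
  have h2 := H.le_n₀
  have h3 := H.polyCode_spec.1
  have h4 := R.field
  have h5 : H.m < 2 ^ H.m := Nat.lt_two_pow_self
  have h6 : 2 ^ H.m ≤ 2 ^ (H.m + 1) := Nat.pow_le_pow_right (by omega) (by omega)
  intro v hv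
  simp only [description, List.mem_cons, List.not_mem_nil, or_false] at hv
  rcases hv with rfl | rfl | rfl | rfl <;> omega

theorem toWords_lt {n W : ℕ} (c : BinWord n) (hW : 1 < W) : ∀ v ∈ c.toWords, v < W := by
  intro v hv
  obtain ⟨i, hi, rfl⟩ := List.getElem_of_mem hv
  rw [c.getElem_toWords]
  exact (c.bits_le_one i).trans_lt hW

theorem getD_description_append (l : List ℕ) (i : ℕ) :
    (H.description ++ l).getD (4 + i) 0 = l.getD i 0 := by
  rw [List.getD_append_right _ _ _ _ (by simp [description])]
  simp [description]

theorem getD_eq_zero {l : List ℕ} {i : ℕ} (h : l.length ≤ i) : l.getD i 0 = 0 := by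
  simp [List.getD_eq_getElem?_getD, h]

theorem encoder_computes (hk : 0 < k) (c : BinWord H.n₀) :
    ComputesWithin (wordFactor s * bitLen H.n₀) (encoder s) (H.description ++ c.toWords)
      (digitsWord (hashLen s H.n₀) (H.hashCode c)).toWords
      (encoderCost s * (H.n₀ + 1) ^ (s + 3)) := by
  have R := H.room hk
  have hn := R.pos
  have hA : 0 < wordFactor s * bitLen H.n₀ :=
    Nat.mul_pos (by unfold wordFactor; omega) (bitLen_pos _)
  have hin := R.input
  have hreg := R.region
  have hlit := R.lit
  have hsm := R.small
  have h2p := Nat.two_pow_pos (H.m * (2 * s))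
  have hlen : (H.description ++ c.toWords).length = 4 + H.n₀ := by
    simp [description, BinWord.length_toWords]; omega
  have hcost := encoderCost_le hn hin
  set W := 2 ^ (wordFactor s * bitLen H.n₀) with hW
  set U := regionLen s (regionFactor s) H.n₀ with hU
  obtain ⟨ξ, hξ, hout⟩ := prepare_does (κ := regionFactor s) (k := encode s (checksumExp s))
    (Q := fun ξ => ∀ i < 2 * (stages s * factorLen (checksumExp s) H.n₀),
      ξ i = H.hashCode c >>> i % 2)
    (μ := fun a => (H.description ++ c.toWords).getD a 0) R (param_lt s H.n₀).2 rfl rfl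
    (fun x hx => getD_eq_zero (by rw [← hU] at hx; omega))
    (fun ν hν => encode_does R (hν.layout (X := 4) (by omega) fun i _ => by
      rw [H.getD_description_append, c.getD_toWords]) c.bits_le_one)
  have hf := cost_factorT ξ (checksumExp s) H.n₀
  have hfo := ok_factorT (μ := ξ) (c := checksumExp s) (n := H.n₀) (W := W) (by omega)
  refine program_computes hA (by omega) ?_ rfl (v := H.n₀) ?_ rfl hξ.ok hξ.run ?_ ?_ ?_ ?_
  · intro v hv
    rcases List.mem_append.1 hv with h | h
    · exact H.description_lt hk v h
    · exact toWords_lt c (by omega) v h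
  · simp
  · have : stages s ≤ 2 * s + 10 := by unfold stages; omega
    rw [mul_assoc] at hin
    rw [← hW]
    simp [hfo]
    omega
  · simp [BinWord.length_toWords, hashLen]
  · intro i hi
    rw [BinWord.getElem_toWords, bits_digitsWord, hout]
    · simpa [BinWord.length_toWords, hashLen] using hi
    · simpa [BinWord.length_toWords] using hi
  · have := hξ.cost
    simp only [cost_get, cost_lit, cost_mul, cost_call, costArgs, evalArgs, cost_var, eval_var,
      List.getD_cons_zero]
    omega

theorem decoder_computes (hk : 0 < k) (x : BinWord k) (y : BinWord (H.n₀ - 1))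
    (hy : y ∈ delSubBall 1 s (H.h x)) :
    ComputesWithin (wordFactor s * bitLen H.n₀) (decoder s) (H.description ++
      (digitsWord (hashLen s H.n₀) (H.hashCode (H.h x))).toWords ++ y.toWords)
      (H.h x).toWords (decoderCost s * (H.n₀ + 1) ^ (s + 2)) := by
  have R := H.room hk
  have hn := R.pos
  have hA : 0 < wordFactor s * bitLen H.n₀ :=
    Nat.mul_pos (by unfold wordFactor; omega) (bitLen_pos _)
  have hin := R.input
  have hreg := R.region
  have hlit := R.lit
  have h2p := Nat.two_pow_pos (H.m * (2 * s))
  set N := hashLen s H.n₀ with hN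
  set u := digitsWord N (H.hashCode (H.h x)) with hu
  have hlen : (H.description ++ u.toWords ++ y.toWords).length = 4 + N + (H.n₀ - 1) := by
    simp [description, BinWord.length_toWords]; omega
  have hcost := decoderCost_le hn hin
  set W := 2 ^ (wordFactor s * bitLen H.n₀) with hW
  set U := regionLen s (regionFactor s) H.n₀ with hU
  have hNe : 2 * stages s * factorLen (checksumExp s) H.n₀ = N := mul_assoc _ _ _
  have hNe' : 2 * (stages s * factorLen (checksumExp s) H.n₀) = N := rfl
  rw [hNe] at hin
  have hGlt := hashWord_lt (checksumExp s) s H.n₀ H.cols (H.h x).bits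
  obtain ⟨d, hd, M, hM, hball⟩ := exists_skip_of_mem_delSubBall hn hy
  obtain ⟨ξ, hξ, hout⟩ := prepare_does (κ := regionFactor s) (k := decode s (checksumExp s))
    (Q := fun ξ => ∀ i < H.n₀, ξ i = (H.h x).bits i)
    (μ := fun a => (H.description ++ u.toWords ++ y.toWords).getD a 0) R (param_lt s H.n₀).2 rfl rfl
    (fun x hx => getD_eq_zero (by rw [← hU] at hx; omega))
    (fun ν hν => by
      obtain ⟨ξ, hξ, hout⟩ := decode_does R (G := H.hashCode (H.h x)) (y := y.bits) (μ := ν)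
        (hν.layout (by omega) fun i _ => by
          rw [hNe', List.append_assoc, add_assoc, H.getD_description_append,
            List.getD_append_right _ _ _ _ (by rw [u.length_toWords]; omega), u.length_toWords,
            Nat.add_sub_cancel_left, y.getD_toWords]) y.bits_le_one
        (fun i hi => by
          rw [hNe'] at hi
          rw [hν.input _ (by omega)]
          rw [List.append_assoc, H.getD_description_append, List.getD_append _ _ _ _ (by
            rw [u.length_toWords]; exact hi), u.getD_toWords, hu, bits_digitsWord _ hi]) hGlt
      refine ⟨ξ, hξ, fun i hi => (hout i hi).trans ?_⟩
      have e1 : H.hashCode (H.h x) = hashWord (checksumExp s) s H.n₀ H.cols (H.h x).bits := rfl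
      rw [e1, hashWord_mod, hashWord_shiftRight]
      refine decoded_eq H.cols_n₀ (fun v _ => H.distance v) (sum_weight_le s H.n₀)
        (H.h x).bits_le_one (H.syndrome_h x) (delBit_le_one y.bits_le_one _ _ _ _) hd M hM
        (fun j hj hjM => ?_) i hi
      -- The artificial deletion at `n` and the empty pattern do not touch symbol `j`.
      rw [← hball j hj hjM, delBit, toggle_pred_pow _ _ _ (by omega), skip, if_pos (by omega),
        Nat.xor_zero])
  refine program_computes hA (by omega) ?_ rfl (v := H.n₀) ?_ rfl hξ.ok hξ.run ?_ ?_ ?_ ?_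
  · intro v hv
    rcases List.mem_append.1 hv with h | h
    · rcases List.mem_append.1 h with h | h
      · exact H.description_lt hk v h
      · exact toWords_lt u (by omega) v h
    · exact toWords_lt y (by omega) v h
  · simp
  · simp
  · simp [BinWord.length_toWords]
  · intro i hi
    rw [BinWord.getElem_toWords, hout]
    simpa [BinWord.length_toWords] using hi
  · have := hξ.cost
    simp only [cost_get, cost_lit, cost_var]
    omega

/-- The number with the given binary digits. -/
def numberOf {N : ℕ} (u : BinWord N) : ℕ := iter (fun i x => x + u.bits i <<< i) 0 N

theorem numberOf_digitsWord {N G : ℕ} (hG : G < 2 ^ N) : numberOf (digitsWord N G) = G := by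
  rw [numberOf, iter_congr (g := fun i x => x + (G >>> i % 2) <<< i) fun i hi x => by
    rw [bits_digitsWord G hi], number_digits, Nat.mod_eq_of_lt hG]

/-- The word that is recovered from a hash and a received word. -/
noncomputable def recover (u : BinWord (hashLen s H.n₀)) (y : BinWord (H.n₀ - 1)) : BinWord H.n₀ :=
  fun i => (decoded s H.n₀ H.cols y.bits
    (numberOf u % 2 ^ (stages s * factorLen (checksumExp s) H.n₀))
    (numberOf u >>> (stages s * factorLen (checksumExp s) H.n₀)) i : ZMod 2)

/-- `recover` takes the received word as it is, while the program sees it through `delBit`. The two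
need agree only on received words in the ball, where both give `h x`. -/
theorem recover_eq (hk : 0 < k) (x : BinWord k) (y : BinWord (H.n₀ - 1))
    (hy : y ∈ delSubBall 1 s (H.h x)) :
    H.recover (digitsWord (hashLen s H.n₀) (H.hashCode (H.h x))) y = H.h x := by
  obtain ⟨d, hd, M, hM, hball⟩ := exists_skip_of_mem_delSubBall (hk.trans_le H.le_n₀) hy
  have hG : H.hashCode (H.h x) < 2 ^ hashLen s H.n₀ := hashWord_lt ..
  funext i
  rw [recover, numberOf_digitsWord hG, hashCode, hashWord_mod, hashWord_shiftRight,
    decoded_eq H.cols_n₀ (fun v _ => H.distance v) (sum_weight_le s H.n₀) (H.h x).bits_le_one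
      (H.syndrome_h x) y.bits_le_one hd M hM hball i i.2, BinWord.bits, dif_pos i.2]
  exact ZMod.natCast_zmod_val _

end BCHPrecoder

theorem lemma4 (s : ℕ) (hs : 2 ≤ s) :
    ∃ (n₁ : ℕ → ℕ) (P Q : WordRAM.Prog) (A C : ℕ),
      ((fun n : ℕ => (n₁ n : ℝ) - 2 * ((s : ℝ) + 2) * Real.logb 2 (n : ℝ))
        =o[Filter.atTop] fun n : ℕ => Real.logb 2 (n : ℝ)) ∧
      ∀ (k : ℕ), 0 < k → ∀ H : BCHPrecoder s k,
        ∃ (g : BinWord H.n₀ → BinWord (n₁ H.n₀))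
          (dec : BinWord (n₁ H.n₀) → BinWord (H.n₀ - 1) → BinWord H.n₀),
          (∀ x : BinWord k, ∀ y ∈ delSubBall 1 s (H.h x), dec (g (H.h x)) y = H.h x) ∧
          (∀ x : BinWord k,
            WordRAM.ComputesWithin (A * (Nat.log 2 H.n₀ + 1)) P
              (H.description ++ (H.h x).toWords) (g (H.h x)).toWords
              (C * H.n₀ ^ (s + 3))) ∧
          (∀ x : BinWord k, ∀ y ∈ delSubBall 1 s (H.h x),
            WordRAM.ComputesWithin (A * (Nat.log 2 H.n₀ + 1)) Q
              (H.description ++ (g (H.h x)).toWords ++ y.toWords) (H.h x).toWords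
              (C * H.n₀ ^ (s + 2))) := by
  -- The costs are bounded by powers of `n₀ + 1 ≤ 2 * n₀`, whence the factor `2 ^ (s + 3)`.
  refine ⟨hashLen s, encoder s, decoder s, wordFactor s,
    (encoderCost s + decoderCost s) * 2 ^ (s + 3), isLittleO_hashLen s, fun k hk H =>
    ⟨fun c => digitsWord _ (H.hashCode c), H.recover, H.recover_eq hk, fun x => ?_, fun x y hy => ?_⟩⟩
  · obtain ⟨h1, h2, τ, t, h3, h4, h5⟩ := H.encoder_computes hk (H.h x)
    refine ⟨h1, h2, τ, t, h3, h4, h5.trans ?_⟩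
    have hn := hk.trans_le H.le_n₀
    calc _ ≤ (encoderCost s + decoderCost s) * (2 * H.n₀) ^ (s + 3) :=
          Nat.mul_le_mul (by omega) (Nat.pow_le_pow_left (by omega) _)
      _ = _ := by rw [mul_pow, mul_assoc]
  · obtain ⟨h1, h2, τ, t, h3, h4, h5⟩ := H.decoder_computes hk x y hy
    refine ⟨h1, h2, τ, t, h3, h4, h5.trans ?_⟩
    have hn := hk.trans_le H.le_n₀
    calc _ ≤ (encoderCost s + decoderCost s) * (2 * H.n₀) ^ (s + 2) :=
          Nat.mul_le_mul (by omega) (Nat.pow_le_pow_left (by omega) _)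
      _ = (encoderCost s + decoderCost s) * 2 ^ (s + 2) * H.n₀ ^ (s + 2) := by
          rw [mul_pow, mul_assoc]
      _ ≤ _ := by gcongr <;> omega
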